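/- **Setting.** Let $u\ge 2$, let $q_1,\dots,q_u\ge 1$ be integers and $n=\sum_g q_g$. Divide $n$ oscillators into $u$ consecutive groups $G_1,\dots,G_u$ of sizes $q_1,\dots,q_u$; let $\epsilon_i\in\{1,-1\}$ for each oscillator $i$, and let $s_1,\dots,s_u$ be positive integers (the frequencies are $l_i=\epsilon_i s_g$ for $i\in G_g$). For each $g$ let $z_g=0$ if $q_g=1$ and $1\le z_g\le q_g-1$ if $q_g>1$; put $z=\sum_g z_g$. *Operators.* On the Schwartz space of $\mathbb R^n$ let $x_j$ be multiplication by the coordinate, $\hat p_j=-i\,\partial/\partial x_j$, $\hat z_j=(x_j+i\hat p_j)/\sqrt2$, $\hat z_j^*=(x_j-i\hat p_j)/\sqrt2$, $\hat w_j=\hat z_j$ if $\epsilon_j=1$ and $\hat w_j=\hat z_j^*$ if $\epsilon_j=-1$, $\hat I_j=\frac12(x_j^2+\hat p_j^2)$, and $$\hat P_{ij}=i(\hat w_i\hat w_j^*-\hat w_j\hat w_i^*),\qquad \hat K_g=\sum_{i\in G_g}\epsilon_i\hat I_i,\qquad \hat W_g=\sum_{i\in G_g}\epsilon_i\hat w_i^2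 .$$ For $r,m\in\mathbb Z^u$ put $\hat J_r=\sum_g r_g\hat K_g$, $\hat R_m=\hat\Omega_1^{m_1}\cdots\hat\Omega_u^{m_u}$, where $\hat\Omega_g^{t}=\hat W_g^{t}$ for $t\ge0$ and $\hat\Omega_g^{t}=(\hat W_g^*)^{-t}$ for $t<0$, and $\operatorname{Im}\hat R_m=\frac1{2i}(\hat R_m-\hat R_m^*)$. *Momentum systems.* Let $P_{ij}$ be the classical functions on phase space given by the same formulas with $x,p$ instead of $x,\hat p$. For each $g$ let $Z_g$ and $L_g$ be sets of $z_g$ and $2(q_g-z_g-1)$ real polynomials in the variables $P_{ij}$, $i<j$ in $G_g$, each of which is either a linear combination of the $P_{ij}$ or a linear combination of the squares $P_{ij}^2$, such that, as functions on phase space, the elements of $(Z_g,L_g)$ are functionally independent and every element of $Z_g$ Poisson-commutes with every element of $(Z_g,L_g)$. Let $\hat{\mathcal Z}$ and $\hat{\mathcal L}$ be the sets of operators obtained from all $Z_g$, respectively all $L_g$, by replacing $P_{ij}$ with $\hat P_{ij}$. *Parameters.* Let $1\le k'\le u/2$ and $h\ge k'$. Let $m^{(1)},\dots,m^{(h)}\in\mathbb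 Z^u$ be linearly independent with $m^{(i)}\cdot s=0$ for all $i$ and $m^{(i)}_a m^{(j)}_a=0$ for all $a=1,\dots,u$, all $j\le k'$ and all $i\ne j$. Let $r^{(1)},\dots,r^{(u-k')}\in\mathbb Z^u$ be linearly independent with $r^{(1)}=s$, $r^{(i)}\cdot m^{(j)}=0$ for all $i\le u-k'$, $j\le k'$, and $r^{(i)}\cdot m^{(j)}=0$ for $i\le u-h$, $k'<j\le h$. Put $$\hat{\mathcal J}_1=(\hat J_{r^{(1)}},\dots,\hat J_{r^{(u-h)}}),\quad \hat{\mathcal J}_2=(\hat J_{r^{(u-h+1)}},\dots,\hat J_{r^{(u-k')}}),$$ $$\hat{\mathcal R}_1=(\operatorname{Im}\hat R_{m^{(1)}},\dots,\operatorname{Im}\hat R_{m^{(k')}}),\quad \hat{\mathcal R}_2=(\operatorname{Im}\hat R_{m^{(k'+1)}},\dots,\operatorname{Im}\hat R_{m^{(h)}}).$$ *Quasi-integrability.* A family of differential operators $\sum_{a,b}c_{a,b}x^a\hat p^b$ is *quasi-independent* if the main parts of their symbols $\sum c_{a,b}x^ap^b$ (the homogeneous parts of highest degree in the momenta $p$)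 are functionally independent, that is, have linearly independent differentials on an open dense subset of phase space. A set $(C;D)$ of operators is *quasi-integrable with $k$ central elements $C$* if $\sharp C=k$, $\sharp C+\sharp D=2n-k$, every element of $C$ commutes with every element of $(C;D)$, and $(C;D)$ is quasi-independent. **Proposition.** Sets $Z_g,L_g$ ($g=1,\dots,u$) with the above properties exist, and for any choice of them the set $$\hat F=(\hat{\mathcal J}_1,\hat{\mathcal R}_1,\hat{\mathcal Z};\ \hat{\mathcal J}_2,\hat{\mathcal R}_2,\hat{\mathcal L})$$ is a quasi-integrable set of operators with $k$ central elements $(\hat{\mathcal J}_1,\hat{\mathcal R}_1,\hat{\mathcal Z})$, where $k=u-h+k'+z$. -/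

import Mathlib

open scoped SchwartzMap LineDeriv

noncomputable section

namespace ResonantOscillators

/-! ### Classical phase space functions -/

/-- Polynomial functions on the phase space `ℝ^ι × ℝ^ι`: the variable `Sum.inl i` is the position
`x_i`, the variable `Sum.inr i` is the momentum `p_i`. -/
abbrev PhasePoly (ι : Type) : Type := MvPolynomial (ι ⊕ ι) ℂ

/-- The Poisson bracket, with the sign convention `{p_i, x_i} = 1`. -/
def poisson {ι : Type} [Fintype ι] (f g : PhasePoly ι) : PhasePoly ι :=
  ∑ i, (MvPolynomial.pderiv (Sum.inr i) f * MvPolynomial.pderiv (Sum.inl i) g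
    - MvPolynomial.pderiv (Sum.inl i) f * MvPolynomial.pderiv (Sum.inr i) g)

/-- Functional independence: the differentials are linearly independent at all points of an open
dense subset of the real phase space. -/
def FunctionallyIndependent {ι α : Type} (g : α → PhasePoly ι) : Prop :=
  ∃ U : Set (ι ⊕ ι → ℝ), IsOpen U ∧ Dense U ∧ ∀ y ∈ U,
    LinearIndependent ℂ (fun a : α => fun v : ι ⊕ ι =>
      MvPolynomial.eval (fun t => (y t : ℂ)) (MvPolynomial.pderiv v (g a)))

/-- `z_i = (x_i + i p_i) / √2`. -/
def zCl {ι : Type} (i : ι) : PhasePoly ι :=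
  MvPolynomial.C (1 / (Real.sqrt 2 : ℂ)) *
    (MvPolynomial.X (Sum.inl i) + MvPolynomial.C Complex.I * MvPolynomial.X (Sum.inr i))

/-- The complex conjugate `(x_i - i p_i) / √2` of `z_i`. -/
def zBarCl {ι : Type} (i : ι) : PhasePoly ι :=
  MvPolynomial.C (1 / (Real.sqrt 2 : ℂ)) *
    (MvPolynomial.X (Sum.inl i) - MvPolynomial.C Complex.I * MvPolynomial.X (Sum.inr i))

/-- `w_i = z_i` if `ε_i = 1`, and `w_i` is the conjugate of `z_i` if `ε_i = -1`. -/
def wCl {ι : Type} (ε : ι → ℤˣ) (i : ι) : PhasePoly ι :=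
  if ε i = 1 then zCl i else zBarCl i

/-- The complex conjugate of `w_i`. -/
def wBarCl {ι : Type} (ε : ι → ℤˣ) (i : ι) : PhasePoly ι :=
  if ε i = 1 then zBarCl i else zCl i

/-- The momentum `P_ij = i (w_i w̄_j - w_j w̄_i)`. -/
def momentumCl {ι : Type} (ε : ι → ℤˣ) (i j : ι) : PhasePoly ι :=
  MvPolynomial.C Complex.I * (wCl ε i * wBarCl ε j - wCl ε j * wBarCl ε i)

/-- The index set `{(i, j) : i < j}` of the momenta of a group of `q` oscillators. -/
abbrev Pair (q : ℕ) : Type := {a : Fin q × Fin q // a.1 < a.2}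

/-- The phase space function obtained by substituting the momenta `P_ij` for the variables of
a real polynomial. -/
def substMomenta {q : ℕ} (ε : Fin q → ℤˣ) (f : MvPolynomial (Pair q) ℝ) : PhasePoly (Fin q) :=
  MvPolynomial.aeval (fun a : Pair q => momentumCl ε a.1.1 a.1.2) f

/-- Linear combinations of the variables, and linear combinations of the squares of the
variables. -/
def IsLinearOrSquares {σ : Type} (f : MvPolynomial σ ℝ) : Prop :=
  f.IsHomogeneous 1 ∨
    (f.IsHomogeneous 2 ∧ ∀ d ∈ f.support, ∃ a : σ, d = Finsupp.single a 2)

/-- `Z` (with `z` elements) and `L` (with `2 (q - z - 1)` elements) are sets of polynomials in the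
momenta of a group of `q` oscillators with signs `ε` such that `(Z, L)` is functionally
independent and every element of `Z` is in involution with every element of `(Z, L)`. -/
structure IsMomentumSystem {q z : ℕ} (ε : Fin q → ℤˣ) (Z : Fin z → MvPolynomial (Pair q) ℝ)
    (L : Fin (2 * (q - z - 1)) → MvPolynomial (Pair q) ℝ) : Prop where
  form_Z : ∀ a, IsLinearOrSquares (Z a)
  form_L : ∀ a, IsLinearOrSquares (L a)
  independent : FunctionallyIndependent
    (Sum.elim (fun a => substMomenta ε (Z a)) (fun a => substMomenta ε (L a)))
  involution_Z : ∀ a b, poisson (substMomenta ε (Z a)) (substMomenta ε (Z b)) = 0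
  involution_L : ∀ a b, poisson (substMomenta ε (Z a)) (substMomenta ε (L b)) = 0

/-! ### Operators, symbols, quasi-integrability -/

/-- Operators on the Schwartz space of `ℝ^ι`. -/
abbrev Op (ι : Type) [Fintype ι] : Type := Module.End ℂ 𝓢(EuclideanSpace ℝ ι, ℂ)

/-- Multiplication by the coordinate `x_i`. -/
def xOp {ι : Type} [Fintype ι] (i : ι) : Op ι :=
  (SchwartzMap.smulLeftCLM ℂ (fun x : EuclideanSpace ℝ ι => ((x i : ℝ) : ℂ))).toLinearMap

/-- `p_i = -i ∂/∂x_i`. -/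
def pOp {ι : Type} [Fintype ι] [DecidableEq ι] (i : ι) : Op ι :=
  (-Complex.I) • (LineDeriv.lineDerivOpCLM ℂ 𝓢(EuclideanSpace ℝ ι, ℂ)
    (EuclideanSpace.single i (1 : ℝ))).toLinearMap

lemma hasTemperateGrowth_coord {ι : Type} [Fintype ι] (i : ι) :
    (fun x : EuclideanSpace ℝ ι => ((x i : ℝ) : ℂ)).HasTemperateGrowth :=
  (Complex.ofRealCLM.comp (EuclideanSpace.proj i : EuclideanSpace ℝ ι →L[ℝ] ℝ)).hasTemperateGrowth

lemma xOp_apply {ι : Type} [Fintype ι] (i : ι) (f : 𝓢(EuclideanSpace ℝ ι, ℂ))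
    (x : EuclideanSpace ℝ ι) : xOp i f x = ((x i : ℝ) : ℂ) * f x := by
  simp [xOp, SchwartzMap.smulLeftCLM_apply_apply (hasTemperateGrowth_coord i)]

lemma pOp_apply {ι : Type} [Fintype ι] [DecidableEq ι] (i : ι) (f : 𝓢(EuclideanSpace ℝ ι, ℂ))
    (x : EuclideanSpace ℝ ι) :
    pOp i f x = -Complex.I * lineDeriv ℝ f x (EuclideanSpace.single i (1 : ℝ)) := by
  simp [pOp, SchwartzMap.lineDerivOp_apply]

/-- The operator `x^a p^b` (positions to the left of the momenta), `d = (a, b)`. The order of the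
factors inside each of the two products is immaterial, as the positions commute with each other
and so do the momenta. -/
def monomialOp {ι : Type} [Fintype ι] [DecidableEq ι] (d : ι ⊕ ι →₀ ℕ) : Op ι :=
  (Finset.univ.toList.map (fun i : ι => xOp i ^ d (Sum.inl i))).prod *
    (Finset.univ.toList.map (fun i : ι => pOp i ^ d (Sum.inr i))).prod

/-- `A` is the differential operator with (standard) symbol `f`, that is
`A = ∑ c_{a,b} x^a p^b` where `f = ∑ c_{a,b} x^a p^b`. -/
def IsSymbol {ι : Type} [Fintype ι] [DecidableEq ι] (A : Op ι) (f : PhasePoly ι) : Prop :=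
  A = ∑ d ∈ f.support, f.coeff d • monomialOp d

/-- The weight that counts the degree with respect to the momenta. -/
def momentumWeight {ι : Type} : ι ⊕ ι → ℕ := Sum.elim (fun _ => 0) (fun _ => 1)

/-- The main part of a symbol: the homogeneous part of highest degree in the momenta. -/
def mainPart {ι : Type} (f : PhasePoly ι) : PhasePoly ι :=
  MvPolynomial.weightedHomogeneousComponent momentumWeight
    (MvPolynomial.weightedTotalDegree momentumWeight f) f

/-- A family of differential operators is quasi-independent if the main parts of their symbols
(with respect to the momenta) are functionally independent. -/
def QuasiIndependent {ι α : Type} [Fintype ι] [DecidableEq ι] (F : α → Op ι) : Prop :=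
  ∃ f : α → PhasePoly ι, (∀ a, IsSymbol (F a) (f a)) ∧
    FunctionallyIndependent (fun a => mainPart (f a))

/-- `(C; D)` is a quasi-integrable set of operators in `n = #ι` degrees of freedom with `k` central
elements `C`: it has `2 n - k` elements, the elements of `C` commute with all elements of `(C; D)`,
and `(C; D)` is quasi-independent. -/
structure IsQuasiIntegrable {ι α β : Type} [Fintype ι] [DecidableEq ι] [Fintype α] [Fintype β]
    (k : ℕ) (C : α → Op ι) (D : β → Op ι) : Prop where
  card_central : Fintype.card α = k
  card_total : Fintype.card α + Fintype.card β + k = 2 * Fintype.card ι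
  commute_central : ∀ a b, C a * C b = C b * C a
  commute_other : ∀ a b, C a * D b = D b * C a
  quasiIndependent : QuasiIndependent (Sum.elim C D)

/-! ### The oscillator operators -/

/-- `z_i = (x_i + i p_i) / √2`. -/
def zOp {ι : Type} [Fintype ι] [DecidableEq ι] (i : ι) : Op ι :=
  (1 / (Real.sqrt 2 : ℂ)) • (xOp i + Complex.I • pOp i)

/-- The hermitian conjugate of `zOp i`. -/
def zStarOp {ι : Type} [Fintype ι] [DecidableEq ι] (i : ι) : Op ι :=
  (1 / (Real.sqrt 2 : ℂ)) • (xOp i - Complex.I • pOp i)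

def wOp {ι : Type} [Fintype ι] [DecidableEq ι] (ε : ι → ℤˣ) (i : ι) : Op ι :=
  if ε i = 1 then zOp i else zStarOp i

/-- The hermitian conjugate of `wOp ε i`. -/
def wStarOp {ι : Type} [Fintype ι] [DecidableEq ι] (ε : ι → ℤˣ) (i : ι) : Op ι :=
  if ε i = 1 then zStarOp i else zOp i

/-- `I_i = (x_i² + p_i²) / 2`. -/
def iOp {ι : Type} [Fintype ι] [DecidableEq ι] (i : ι) : Op ι :=
  (1 / 2 : ℂ) • (xOp i ^ 2 + pOp i ^ 2)

/-- `P_ij = i (w_i w_j^* - w_j w_i^*)`. -/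
def momentumOp {ι : Type} [Fintype ι] [DecidableEq ι] (ε : ι → ℤˣ) (i j : ι) : Op ι :=
  Complex.I • (wOp ε i * wStarOp ε j - wOp ε j * wStarOp ε i)

/-- The oscillators, divided into `u` consecutive groups of sizes `q 0, …, q (u - 1)`. -/
abbrev Osc {u : ℕ} (q : Fin u → ℕ) : Type := (g : Fin u) × Fin (q g)

/-- `K_g = ∑ ε_i I_i`, the sum being over the group `g`. -/
def kOp {u : ℕ} {q : Fin u → ℕ} (ε : Osc q → ℤˣ) (g : Fin u) : Op (Osc q) :=
  ∑ i : Fin (q g), ((ε ⟨g, i⟩ : ℤ) : ℂ) • iOp (⟨g, i⟩ : Osc q)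

/-- `J_r = ∑ r_g K_g`. -/
def jOp {u : ℕ} {q : Fin u → ℕ} (ε : Osc q → ℤˣ) (r : Fin u → ℤ) : Op (Osc q) :=
  ∑ g, ((r g : ℤ) : ℂ) • kOp ε g

/-- `W_g = ∑ ε_i w_i²`, the sum being over the group `g`. -/
def bigWOp {u : ℕ} {q : Fin u → ℕ} (ε : Osc q → ℤˣ) (g : Fin u) : Op (Osc q) :=
  ∑ i : Fin (q g), ((ε ⟨g, i⟩ : ℤ) : ℂ) • wOp ε (⟨g, i⟩ : Osc q) ^ 2

/-- The hermitian conjugate of `bigWOp ε g`. -/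
def bigWStarOp {u : ℕ} {q : Fin u → ℕ} (ε : Osc q → ℤˣ) (g : Fin u) : Op (Osc q) :=
  ∑ i : Fin (q g), ((ε ⟨g, i⟩ : ℤ) : ℂ) • wStarOp ε (⟨g, i⟩ : Osc q) ^ 2

/-- `Ω_g^t`, which is `W_g^t` if `t ≥ 0` and `(W_g^*)^(-t)` if `t < 0`. -/
def omegaOp {u : ℕ} {q : Fin u → ℕ} (ε : Osc q → ℤˣ) (g : Fin u) (t : ℤ) : Op (Osc q) :=
  if 0 ≤ t then bigWOp ε g ^ t.toNat else bigWStarOp ε g ^ (-t).toNat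

/-- `R_m = Ω_1^{m_1} ⋯ Ω_u^{m_u}`. -/
def rOp {u : ℕ} {q : Fin u → ℕ} (ε : Osc q → ℤˣ) (m : Fin u → ℤ) : Op (Osc q) :=
  (List.ofFn (fun g => omegaOp ε g (m g))).prod

/-- The hermitian conjugate of `rOp ε m`: the product of the hermitian conjugates of the factors
in the reversed order (see `isFormalAdjoint_rOp`). -/
def rStarOp {u : ℕ} {q : Fin u → ℕ} (ε : Osc q → ℤˣ) (m : Fin u → ℤ) : Op (Osc q) :=
  (List.ofFn (fun g => omegaOp ε g (-(m g)))).reverse.prod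

/-- `Im R_m = (R_m - R_m^*) / (2 i)`. -/
def imROp {u : ℕ} {q : Fin u → ℕ} (ε : Osc q → ℤˣ) (m : Fin u → ℤ) : Op (Osc q) :=
  (1 / (2 * Complex.I)) • (rOp ε m - rStarOp ε m)

/-- The operator obtained by substituting the momentum operators of the group `g` into a polynomial
of degree at most two all of whose monomials of degree two are squares. -/
def polyOp {u : ℕ} {q : Fin u → ℕ} (ε : Osc q → ℤˣ) (g : Fin u)
    (f : MvPolynomial (Pair (q g)) ℝ) : Op (Osc q) :=
  ((f.coeff 0 : ℝ) : ℂ) • (1 : Op (Osc q))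
    + ∑ a : Pair (q g), ((f.coeff (Finsupp.single a 1) : ℝ) : ℂ) •
        momentumOp ε (⟨g, a.1.1⟩ : Osc q) ⟨g, a.1.2⟩
    + ∑ a : Pair (q g), ((f.coeff (Finsupp.single a 2) : ℝ) : ℂ) •
        momentumOp ε (⟨g, a.1.1⟩ : Osc q) ⟨g, a.1.2⟩ ^ 2

/-! ### The two sets of operators -/

/-- The family `(J_1, R_1, Z)`. -/
def centralSet {u : ℕ} {q : Fin u → ℕ} (ε : Osc q → ℤˣ) {z : Fin u → ℕ} {k' h : ℕ}
    (m : Fin h → Fin u → ℤ) (r : Fin (u - k') → Fin u → ℤ)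
    (Z : (g : Fin u) → Fin (z g) → MvPolynomial (Pair (q g)) ℝ) :
    ({i : Fin (u - k') // (i : ℕ) < u - h} ⊕ {j : Fin h // (j : ℕ) < k'}) ⊕
      ((g : Fin u) × Fin (z g)) → Op (Osc q) :=
  Sum.elim (Sum.elim (fun i => jOp ε (r i.1)) (fun j => imROp ε (m j.1)))
    (fun a => polyOp ε a.1 (Z a.1 a.2))

/-- The family `(J_2, R_2, L)`. -/
def otherSet {u : ℕ} {q : Fin u → ℕ} (ε : Osc q → ℤˣ) {z : Fin u → ℕ} {k' h : ℕ}
    (m : Fin h → Fin u → ℤ) (r : Fin (u - k') → Fin u → ℤ)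
    (L : (g : Fin u) → Fin (2 * (q g - z g - 1)) → MvPolynomial (Pair (q g)) ℝ) :
    ({i : Fin (u - k') // u - h ≤ (i : ℕ)} ⊕ {j : Fin h // k' ≤ (j : ℕ)}) ⊕
      ((g : Fin u) × Fin (2 * (q g - z g - 1))) → Op (Osc q) :=
  Sum.elim (Sum.elim (fun i => jOp ε (r i.1)) (fun j => imROp ε (m j.1)))
    (fun a => polyOp ε a.1 (L a.1 a.2))

/-! ### The operators marked with a star are the hermitian conjugates -/

/-- `B` is the (formal) hermitian conjugate of `A` with respect to the `L²` inner product. -/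
def IsFormalAdjoint {ι : Type} [Fintype ι] (A B : Op ι) : Prop :=
  ∀ f g : 𝓢(EuclideanSpace ℝ ι, ℂ),
    ∫ x, (starRingEnd ℂ) (A f x) * g x = ∫ x, (starRingEnd ℂ) (f x) * B g x

lemma integrable_conj_mul {ι : Type} [Fintype ι] (f g : 𝓢(EuclideanSpace ℝ ι, ℂ)) :
    MeasureTheory.Integrable (fun x => (starRingEnd ℂ) (f x) * g x) := by
  obtain ⟨c, hc⟩ := f.decay 0 0
  refine g.integrable.bdd_mul (c := c)
    (Complex.continuous_conj.comp f.continuous).aestronglyMeasurable ?_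
  refine Filter.Eventually.of_forall fun x => ?_
  have := hc.2 x
  simpa using this

lemma IsFormalAdjoint.add {ι : Type} [Fintype ι] {A A' B B' : Op ι}
    (h : IsFormalAdjoint A B) (h' : IsFormalAdjoint A' B') :
    IsFormalAdjoint (A + A') (B + B') := by
  intro f g
  simp only [LinearMap.add_apply, add_apply, map_add, add_mul, mul_add]
  rw [MeasureTheory.integral_add (integrable_conj_mul _ _) (integrable_conj_mul _ _),
    MeasureTheory.integral_add (integrable_conj_mul _ _) (integrable_conj_mul _ _), h, h']

lemma IsFormalAdjoint.smul {ι : Type} [Fintype ι] {A B : Op ι}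
    (h : IsFormalAdjoint A B) (c : ℂ) :
    IsFormalAdjoint (c • A) ((starRingEnd ℂ) c • B) := by
  intro f g
  simp only [LinearMap.smul_apply, smul_apply, smul_eq_mul, map_mul]
  simp only [mul_assoc, mul_left_comm _ ((starRingEnd ℂ) c) _]
  rw [MeasureTheory.integral_const_mul, MeasureTheory.integral_const_mul, h]

lemma IsFormalAdjoint.mul {ι : Type} [Fintype ι] {A A' B B' : Op ι}
    (h : IsFormalAdjoint A B) (h' : IsFormalAdjoint A' B') :
    IsFormalAdjoint (A * A') (B' * B) := by
  intro f g
  simp only [Module.End.mul_apply]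
  rw [h, h']

lemma IsFormalAdjoint.one {ι : Type} [Fintype ι] : IsFormalAdjoint (1 : Op ι) 1 :=
  fun _ _ => rfl

lemma IsFormalAdjoint.zero {ι : Type} [Fintype ι] : IsFormalAdjoint (0 : Op ι) 0 := by
  intro f g
  simp

lemma IsFormalAdjoint.pow {ι : Type} [Fintype ι] {A B : Op ι}
    (h : IsFormalAdjoint A B) (t : ℕ) : IsFormalAdjoint (A ^ t) (B ^ t) := by
  induction t with
  | zero => simpa using IsFormalAdjoint.one
  | succ t ih =>
    rw [pow_succ A, pow_succ' B]
    exact ih.mul h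

lemma IsFormalAdjoint.sum {ι κ : Type} [Fintype ι] (S : Finset κ) {A B : κ → Op ι}
    (h : ∀ a, IsFormalAdjoint (A a) (B a)) :
    IsFormalAdjoint (∑ a ∈ S, A a) (∑ a ∈ S, B a) := by
  classical
  induction S using Finset.induction_on with
  | empty => simpa using IsFormalAdjoint.zero
  | insert a S ha ih =>
    rw [Finset.sum_insert ha, Finset.sum_insert ha]
    exact (h a).add ih

lemma isFormalAdjoint_list {ι : Type} [Fintype ι] : ∀ {n : ℕ} {A B : Fin n → Op ι},
    (∀ a, IsFormalAdjoint (A a) (B a)) →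
    IsFormalAdjoint (List.ofFn A).prod (List.ofFn B).reverse.prod := by
  intro n
  induction n with
  | zero => intro A B _; simpa using IsFormalAdjoint.one
  | succ n ih =>
    intro A B h
    simp only [List.ofFn_succ, List.prod_cons, List.reverse_cons, List.prod_append,
      List.prod_nil, mul_one]
    exact (h 0).mul (ih fun a => h a.succ)

lemma isFormalAdjoint_xOp {ι : Type} [Fintype ι] (i : ι) :
    IsFormalAdjoint (xOp i) (xOp i) := by
  intro f g
  simp only [xOp_apply, map_mul, Complex.conj_ofReal]
  congr 1
  ext x
  ring

lemma isFormalAdjoint_pOp {ι : Type} [Fintype ι] [DecidableEq ι] (i : ι) :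
    IsFormalAdjoint (pOp i) (pOp i) := by
  intro f g
  have key := SchwartzMap.integral_bilinear_lineDerivOp_right_eq_neg_left
    (μ := MeasureTheory.volume) f g
    ((ContinuousLinearMap.mul ℝ ℂ).comp Complex.conjCLE.toContinuousLinearMap)
    (EuclideanSpace.single i (1 : ℝ))
  simp only [ContinuousLinearMap.comp_apply, ContinuousLinearMap.mul_apply',
    ContinuousLinearEquiv.coe_coe, Complex.conjCLE_apply, SchwartzMap.lineDerivOp_apply] at key
  simp only [pOp_apply, map_mul, map_neg, Complex.conj_I, neg_neg]
  simp only [mul_assoc, mul_left_comm _ (-Complex.I) _]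
  rw [MeasureTheory.integral_const_mul, MeasureTheory.integral_const_mul, key]
  ring

lemma isFormalAdjoint_zOp {ι : Type} [Fintype ι] [DecidableEq ι] (i : ι) :
    IsFormalAdjoint (zOp i) (zStarOp i) := by
  have h := ((isFormalAdjoint_xOp i).add ((isFormalAdjoint_pOp i).smul Complex.I)).smul
    (1 / (Real.sqrt 2 : ℂ))
  simpa [zOp, zStarOp, sub_eq_add_neg] using h

lemma isFormalAdjoint_zStarOp {ι : Type} [Fintype ι] [DecidableEq ι] (i : ι) :
    IsFormalAdjoint (zStarOp i) (zOp i) := by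
  have h := ((isFormalAdjoint_xOp i).add ((isFormalAdjoint_pOp i).smul (-Complex.I))).smul
    (1 / (Real.sqrt 2 : ℂ))
  simpa [zOp, zStarOp, sub_eq_add_neg] using h

lemma isFormalAdjoint_wOp {ι : Type} [Fintype ι] [DecidableEq ι] (ε : ι → ℤˣ) (i : ι) :
    IsFormalAdjoint (wOp ε i) (wStarOp ε i) := by
  unfold wOp wStarOp
  split_ifs
  · exact isFormalAdjoint_zOp i
  · exact isFormalAdjoint_zStarOp i

lemma isFormalAdjoint_wStarOp {ι : Type} [Fintype ι] [DecidableEq ι] (ε : ι → ℤˣ) (i : ι) :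
    IsFormalAdjoint (wStarOp ε i) (wOp ε i) := by
  unfold wOp wStarOp
  split_ifs
  · exact isFormalAdjoint_zStarOp i
  · exact isFormalAdjoint_zOp i

lemma isFormalAdjoint_bigWOp {u : ℕ} {q : Fin u → ℕ} (ε : Osc q → ℤˣ) (g : Fin u) :
    IsFormalAdjoint (bigWOp ε g) (bigWStarOp ε g) := by
  refine IsFormalAdjoint.sum _ fun i => ?_
  simpa using ((isFormalAdjoint_wOp ε (⟨g, i⟩ : Osc q)).pow 2).smul ((ε ⟨g, i⟩ : ℤ) : ℂ)

lemma isFormalAdjoint_bigWStarOp {u : ℕ} {q : Fin u → ℕ} (ε : Osc q → ℤˣ) (g : Fin u) :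
    IsFormalAdjoint (bigWStarOp ε g) (bigWOp ε g) := by
  refine IsFormalAdjoint.sum _ fun i => ?_
  simpa using ((isFormalAdjoint_wStarOp ε (⟨g, i⟩ : Osc q)).pow 2).smul ((ε ⟨g, i⟩ : ℤ) : ℂ)

lemma isFormalAdjoint_omegaOp {u : ℕ} {q : Fin u → ℕ} (ε : Osc q → ℤˣ) (g : Fin u) (t : ℤ) :
    IsFormalAdjoint (omegaOp ε g t) (omegaOp ε g (-t)) := by
  rcases lt_trichotomy t 0 with ht | ht | ht
  · have h1 : ¬ (0 ≤ t) := not_le.mpr ht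
    have h2 : 0 ≤ -t := by omega
    simp only [omegaOp, h1, h2, if_true, if_false]
    exact (isFormalAdjoint_bigWStarOp ε g).pow _
  · subst ht
    simpa [omegaOp] using IsFormalAdjoint.one
  · have h1 : 0 ≤ t := ht.le
    have h2 : ¬ (0 ≤ -t) := by omega
    simp only [omegaOp, h1, h2, if_true, if_false, neg_neg]
    exact (isFormalAdjoint_bigWOp ε g).pow _

theorem isFormalAdjoint_rOp {u : ℕ} {q : Fin u → ℕ} (ε : Osc q → ℤˣ) (m : Fin u → ℤ) :
    IsFormalAdjoint (rOp ε m) (rStarOp ε m) :=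
  isFormalAdjoint_list fun g => isFormalAdjoint_omegaOp ε g (m g)

end ResonantOscillators

end

open scoped SchwartzMap LineDeriv

noncomputable section

namespace ResonantOscillators

/-! ### Ring commutators and eigenvectors of an inner derivation -/

section Bracket

variable {A : Type*} [Ring A]

/-! Commutation. Each `kOp` acts as a grading: `wOp` has weight -1 and `wStarOp` weight +1 with
respect to the own group, and both have weight 0 with respect to the other groups. Hence the momenta
inside a group have weight 0, `omegaOp ε g t` has weight -2t, and `rOp ε m` is an eigenvector of the
commutator with `jOp ε r` with eigenvalue -2 r·m, so that r·m = 0 gives commutation. The momenta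
span an orthogonal type algebra that preserves the quadratic forms `bigWOp` and `bigWStarOp`, hence
they commute with every resonance operator. Two resonance operators with disjoint exponent vectors
involve different groups and commute.

The delicate point is that involution of momentum polynomials passes to their quantizations
(`commute_polyOp_of_poisson_eq_zero`). The Poisson bracket and the commutator are both
biderivations, and the momenta obey the same relations up to a nonzero constant
(`IsMomentumAlgebra`). In both algebras the bracket of two linear or square combinations is a
multiple of the same explicit sum. If the classical sum vanishes, evaluation at suitable points
yields a symmetry of its coefficients, and this symmetry annihilates the quantum sum. For two
combinations of squares the only ordering obstruction is the commutator of P_ik with [P_il, P_kl],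
which is zero because the inner commutator is a multiple of P_ik.

Quasi-independence. With T_g the kinetic form `kineticCl`, the main part of J_r is the sum of r_g
T_g, and that of a momentum polynomial is the polynomial itself. The symbols of R_m and of its
conjugate have the same top part A, the product of the (-T_g)^|m_g|, so A cancels in Im R_m and the
main part S_m has one order less. Its exact form is not needed: it suffices that the field
`shearField`, which annihilates the T_g and all momenta, maps S_m to -2 m_g A
(`exists_symbol_imROp`). Contract a linear relation between the differentials with the shear fields:
independence of the vectors m removes the resonance terms. Contraction with `squeezeField`, which
annihilates the momenta and scales T_g, then removes the J terms by independence of the vectors r.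
The rest decouples into the groups, where independence is assumed
(`functionallyIndependent_of_groups`).

Existence. Take for Z the Casimirs of the first q, q-1, ..., q-z+1 oscillators and for L the momenta
that join one of the first two oscillators to a later one of the smallest of these sets
(`functionallyIndependent_standard`). -/

lemma bracket_mul_right (a b c : A) : ⁅a, b * c⁆ = ⁅a, b⁆ * c + b * ⁅a, c⁆ := by
  simp only [Ring.lie_def]
  noncomm_ring

lemma bracket_mul_left (a b c : A) : ⁅a * b, c⁆ = a * ⁅b, c⁆ + ⁅a, c⁆ * b := by
  simp only [Ring.lie_def]
  noncomm_ring

lemma bracket_one_left (a : A) : ⁅(1 : A), a⁆ = 0 := by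
  simp [Ring.lie_def]

lemma bracket_one_right (a : A) : ⁅a, (1 : A)⁆ = 0 := by
  simp [Ring.lie_def]

lemma bracket_sub_left (a b c : A) : ⁅a - b, c⁆ = ⁅a, c⁆ - ⁅b, c⁆ := by
  simp only [Ring.lie_def]
  noncomm_ring

lemma bracket_sub_right (a b c : A) : ⁅a, b - c⁆ = ⁅a, b⁆ - ⁅a, c⁆ := by
  simp only [Ring.lie_def]
  noncomm_ring

lemma neg_bracket (a b : A) : -⁅b, a⁆ = ⁅a, b⁆ := by
  simp only [Ring.lie_def]
  noncomm_ring

lemma bracket_sum_left {κ : Type*} (s : Finset κ) (f : κ → A) (a : A) :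
    ⁅∑ k ∈ s, f k, a⁆ = ∑ k ∈ s, ⁅f k, a⁆ := by
  simp only [Ring.lie_def, Finset.sum_mul, Finset.mul_sum, Finset.sum_sub_distrib]

lemma bracket_sum_right {κ : Type*} (s : Finset κ) (f : κ → A) (a : A) :
    ⁅a, ∑ k ∈ s, f k⁆ = ∑ k ∈ s, ⁅a, f k⁆ := by
  simp only [Ring.lie_def, Finset.sum_mul, Finset.mul_sum, Finset.sum_sub_distrib]

variable [Module ℂ A] [IsScalarTower ℂ A A] [SMulCommClass ℂ A A]

lemma bracket_smul_left (c : ℂ) (a b : A) : ⁅c • a, b⁆ = c • ⁅a, b⁆ := by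
  simp only [Ring.lie_def, smul_mul_assoc, mul_smul_comm, smul_sub]

lemma bracket_smul_right (c : ℂ) (a b : A) : ⁅a, c • b⁆ = c • ⁅a, b⁆ := by
  simp only [Ring.lie_def, smul_mul_assoc, mul_smul_comm, smul_sub]

lemma bracket_pow_of_bracket_eq_smul {K B : A} {c : ℂ} (h : ⁅K, B⁆ = c • B) (t : ℕ) :
    ⁅K, B ^ t⁆ = (t * c) • B ^ t := by
  induction t with
  | zero => simp [bracket_one_right]
  | succ t ih =>
    rw [pow_succ, bracket_mul_right, ih, h, smul_mul_assoc, mul_smul_comm, ← add_smul]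
    congr 1
    push_cast
    ring

lemma bracket_list_prod_of_bracket_eq_smul {α : Type*} {K : A} {F : α → A} {c : α → ℂ}
    (h : ∀ a, ⁅K, F a⁆ = c a • F a) (l : List α) :
    ⁅K, (l.map F).prod⁆ = (l.map c).sum • (l.map F).prod := by
  induction l with
  | nil => simp [bracket_one_right]
  | cons a l ih =>
    rw [List.map_cons, List.prod_cons, List.map_cons, List.sum_cons, bracket_mul_right, ih, h,
      smul_mul_assoc, mul_smul_comm, ← add_smul]

end Bracket

/-! ### Canonical commutation relations -/

section CCR

variable {ι : Type} [Fintype ι]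

lemma xOp_mul_comm (i j : ι) : xOp i * xOp j = xOp j * xOp i := by
  ext f x
  simp only [Module.End.mul_apply, xOp_apply]
  ring

variable [DecidableEq ι]

lemma pOp_apply_fderiv (i : ι) (f : 𝓢(EuclideanSpace ℝ ι, ℂ)) (x : EuclideanSpace ℝ ι) :
    pOp i f x = -Complex.I * fderiv ℝ f x (EuclideanSpace.single i (1 : ℝ)) := by
  rw [pOp_apply, ← SchwartzMap.lineDerivOp_apply, SchwartzMap.lineDerivOp_apply_eq_fderiv]

lemma fderiv_pOp (i : ι) (f : 𝓢(EuclideanSpace ℝ ι, ℂ)) (x v : EuclideanSpace ℝ ι) :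
    fderiv ℝ (pOp i f) x v =
      -Complex.I * fderiv ℝ (fderiv ℝ f) x v (EuclideanSpace.single i (1 : ℝ)) := by
  have hd : DifferentiableAt ℝ (fderiv ℝ f) x :=
    ((f.smooth 2).fderiv_right (m := 1) (by norm_num)).differentiable (by norm_num) x
  have hfun : (pOp i f : EuclideanSpace ℝ ι → ℂ) =
      fun y => -Complex.I * fderiv ℝ f y (EuclideanSpace.single i (1 : ℝ)) :=
    funext (pOp_apply_fderiv i f)
  rw [hfun, fderiv_const_mul (hd.clm_apply (differentiableAt_const _)),
    fderiv_clm_apply hd (differentiableAt_const _)]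
  simp

lemma pOp_mul_comm (i j : ι) : pOp i * pOp j = pOp j * pOp i := by
  ext f x
  have hs : IsSymmSndFDerivAt ℝ f x :=
    ((f.smooth 2).contDiffAt).isSymmSndFDerivAt (by simp)
  simp only [Module.End.mul_apply]
  rw [pOp_apply_fderiv, pOp_apply_fderiv, fderiv_pOp, fderiv_pOp, hs]

/-- The canonical commutation relation, in the form that moves positions to the left, as standard
ordering requires. -/
lemma pOp_mul_xOp (i j : ι) :
    pOp i * xOp j = xOp j * pOp i - if i = j then Complex.I • (1 : Op ι) else 0 := by
  ext f x
  have hfun : (xOp j f : EuclideanSpace ℝ ι → ℂ) = fun y => ((y j : ℝ) : ℂ) * f y :=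
    funext (xOp_apply j f)
  have hc : HasFDerivAt (fun y : EuclideanSpace ℝ ι => ((y j : ℝ) : ℂ))
      (Complex.ofRealCLM.comp (EuclideanSpace.proj j : EuclideanSpace ℝ ι →L[ℝ] ℝ)) x :=
    (Complex.ofRealCLM.comp (EuclideanSpace.proj j : EuclideanSpace ℝ ι →L[ℝ] ℝ)).hasFDerivAt
  have h1 : pOp i (xOp j f) x = -Complex.I * (((x j : ℝ) : ℂ) *
      fderiv ℝ f x (EuclideanSpace.single i (1 : ℝ)) + (if i = j then 1 else 0) * f x) := by
    rw [pOp_apply_fderiv, hfun, (hc.fun_mul f.differentiableAt.hasFDerivAt).fderiv]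
    by_cases h : i = j
    · subst h
      simp [mul_comm]
    · simp [h, Ne.symm h]
  simp only [Module.End.mul_apply, h1]
  split_ifs
  · simp [xOp_apply, pOp_apply_fderiv, Module.End.mul_apply]
    ring
  · simp [xOp_apply, pOp_apply_fderiv, Module.End.mul_apply]
    ring


lemma linComb_mul_linComb (i j : ι) (a b : ℂ) :
    (xOp i + a • pOp i) * (xOp j + b • pOp j) = (xOp j + b • pOp j) * (xOp i + a • pOp i)
      + if i = j then (Complex.I * (b - a)) • (1 : Op ι) else 0 := by
  have h1 := pOp_mul_xOp i j
  have h2 := pOp_mul_xOp j i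
  simp only [add_mul, mul_add, smul_mul_assoc, mul_smul_comm, h1, h2, xOp_mul_comm i j,
    pOp_mul_comm i j, eq_comm (a := j) (b := i)]
  split_ifs <;> module

/-- The sign enters linearly here, so that all later computations treat both values of ε at once. -/
lemma wOp_eq (ε : ι → ℤˣ) (i : ι) : wOp ε i =
    (1 / (Real.sqrt 2 : ℂ)) • (xOp i + (Complex.I * ((ε i : ℤ) : ℂ)) • pOp i) := by
  rcases Int.units_eq_one_or (ε i) with h | h
  · simp [wOp, zOp, h]
  · simp [wOp, zStarOp, h, sub_eq_add_neg]

lemma wStarOp_eq (ε : ι → ℤˣ) (i : ι) : wStarOp ε i =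
    (1 / (Real.sqrt 2 : ℂ)) • (xOp i + (-Complex.I * ((ε i : ℤ) : ℂ)) • pOp i) := by
  rcases Int.units_eq_one_or (ε i) with h | h
  · simp [wStarOp, zStarOp, h, sub_eq_add_neg]
  · simp [wStarOp, zOp, h]

lemma one_div_sqrt_two_mul_self :
    (1 / (Real.sqrt 2 : ℂ)) * (1 / (Real.sqrt 2 : ℂ)) = 1 / 2 := by
  rw [div_mul_div_comm, ← Complex.ofReal_mul, Real.mul_self_sqrt (by norm_num)]
  norm_num

lemma sign_mul_self (e : ℤˣ) : ((e : ℤ) : ℂ) * ((e : ℤ) : ℂ) = 1 := by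
  rcases Int.units_eq_one_or e with h | h <;> simp [h]

lemma wOp_lie_wOp (ε : ι → ℤˣ) (i j : ι) : ⁅wOp ε i, wOp ε j⁆ = 0 := by
  rw [Ring.lie_def, wOp_eq, wOp_eq]
  simp only [smul_mul_assoc, mul_smul_comm]
  rw [linComb_mul_linComb]
  split_ifs with h
  · subst h
    simp
  · simp

lemma wStarOp_lie_wStarOp (ε : ι → ℤˣ) (i j : ι) : ⁅wStarOp ε i, wStarOp ε j⁆ = 0 := by
  rw [Ring.lie_def, wStarOp_eq, wStarOp_eq]
  simp only [smul_mul_assoc, mul_smul_comm]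
  rw [linComb_mul_linComb]
  split_ifs with h
  · subst h
    simp
  · simp

lemma wOp_lie_wStarOp (ε : ι → ℤˣ) (i j : ι) :
    ⁅wOp ε i, wStarOp ε j⁆ = if i = j then ((ε i : ℤ) : ℂ) • (1 : Op ι) else 0 := by
  rw [Ring.lie_def, wOp_eq, wStarOp_eq]
  simp only [smul_mul_assoc, mul_smul_comm]
  rw [linComb_mul_linComb, smul_add, smul_add, add_sub_cancel_left]
  split_ifs with h
  · subst h
    rw [smul_smul, smul_smul, ← mul_assoc, one_div_sqrt_two_mul_self]
    congr 1
    linear_combination (-((ε i : ℤ) : ℂ)) * Complex.I_mul_I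
  · simp

lemma wStarOp_lie_wOp (ε : ι → ℤˣ) (i j : ι) :
    ⁅wStarOp ε i, wOp ε j⁆ = if i = j then (-((ε i : ℤ) : ℂ)) • (1 : Op ι) else 0 := by
  rw [← neg_bracket, wOp_lie_wStarOp]
  by_cases h : i = j
  · subst h
    simp
  · simp [h, Ne.symm h]

/-- Writing the action as w w^* up to a constant reduces all brackets with `kOp` to those between w
and w^*. -/
lemma iOp_eq (ε : ι → ℤˣ) (i : ι) : ((ε i : ℤ) : ℂ) • iOp i =
    ((ε i : ℤ) : ℂ) • (wOp ε i * wStarOp ε i) - (1 / 2 : ℂ) • (1 : Op ι) := by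
  have h1 := pOp_mul_xOp i i
  rw [if_pos rfl] at h1
  have h2 := sign_mul_self (ε i)
  rw [wOp_eq, wStarOp_eq, iOp]
  simp only [smul_mul_assoc, mul_smul_comm, add_mul, mul_add, h1, pow_two]
  set e : ℂ := ((ε i : ℤ) : ℂ)
  have hc := one_div_sqrt_two_mul_self
  set c : ℂ := 1 / (Real.sqrt 2 : ℂ)
  match_scalars
  · linear_combination -e * hc
  · linear_combination (e * e * e * c * c) * Complex.I_mul_I - e * hc - e * c * c * h2
  · ring
  · linear_combination (e * e * c * c) * Complex.I_mul_I - c * c * h2 - hc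

end CCR


/-! ### Commutation relations of the oscillator operators -/

section Oscillators

variable {u : ℕ} {q : Fin u → ℕ} (ε : Osc q → ℤˣ)

lemma kOp_lie_wOp (g : Fin u) (i : Osc q) :
    ⁅kOp ε g, wOp ε i⁆ = (if g = i.1 then (-1 : ℂ) else 0) • wOp ε i := by
  obtain ⟨g', i⟩ := i
  simp only [kOp, iOp_eq ε, bracket_sum_left, bracket_sub_left, bracket_smul_left,
    bracket_mul_left, wOp_lie_wOp,
    wStarOp_lie_wOp]
  by_cases hg : g = g'
  · subst hg
    rw [Finset.sum_eq_single i]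
    · simp [bracket_one_left, smul_smul, sign_mul_self]
    · intro b _ hb
      simp [hb, bracket_one_left]
    · simp
  · simp [hg, bracket_one_left]

lemma kOp_lie_wStarOp (g : Fin u) (i : Osc q) :
    ⁅kOp ε g, wStarOp ε i⁆ = (if g = i.1 then (1 : ℂ) else 0) • wStarOp ε i := by
  obtain ⟨g', i⟩ := i
  simp only [kOp, iOp_eq ε, bracket_sum_left, bracket_sub_left, bracket_smul_left,
    bracket_mul_left, wOp_lie_wStarOp,
    wStarOp_lie_wStarOp]
  by_cases hg : g = g'
  · subst hg
    rw [Finset.sum_eq_single i]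
    · simp [bracket_one_left, smul_smul, sign_mul_self]
    · intro b _ hb
      simp [hb, bracket_one_left]
    · simp
  · simp [hg, bracket_one_left]

/-- Each product w_i w_j^* has weight -1 + 1 = 0 when both oscillators lie in the same group. -/
lemma kOp_lie_momentumOp (g : Fin u) {i j : Osc q} (hij : i.1 = j.1) :
    ⁅kOp ε g, momentumOp ε i j⁆ = 0 := by
  simp only [momentumOp, bracket_smul_right, bracket_sub_right, bracket_mul_right, kOp_lie_wOp,
    kOp_lie_wStarOp, hij,
    smul_mul_assoc, mul_smul_comm]
  split_ifs <;> simp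

lemma kOp_lie_bigWOp (g g' : Fin u) :
    ⁅kOp ε g, bigWOp ε g'⁆ = (if g = g' then (-2 : ℂ) else 0) • bigWOp ε g' := by
  simp only [bigWOp, bracket_sum_right, bracket_smul_right, pow_two, bracket_mul_right,
    kOp_lie_wOp, smul_mul_assoc,
    mul_smul_comm, Finset.smul_sum]
  refine Finset.sum_congr rfl fun i _ => ?_
  split_ifs <;> module

lemma kOp_lie_bigWStarOp (g g' : Fin u) :
    ⁅kOp ε g, bigWStarOp ε g'⁆ = (if g = g' then (2 : ℂ) else 0) • bigWStarOp ε g' := by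
  simp only [bigWStarOp, bracket_sum_right, bracket_smul_right, pow_two, bracket_mul_right,
    kOp_lie_wStarOp,
    smul_mul_assoc, mul_smul_comm, Finset.smul_sum]
  refine Finset.sum_congr rfl fun i _ => ?_
  split_ifs <;> module

lemma kOp_lie_omegaOp (g g' : Fin u) (t : ℤ) :
    ⁅kOp ε g, omegaOp ε g' t⁆ = (if g = g' then -2 * (t : ℂ) else 0) • omegaOp ε g' t := by
  unfold omegaOp
  split_ifs with ht hg hg
  · have hc : ((t.toNat : ℕ) : ℂ) = t := by
      rw [← Int.cast_natCast, Int.toNat_of_nonneg ht]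
    rw [bracket_pow_of_bracket_eq_smul (kOp_lie_bigWOp ε g g'), if_pos hg, hc, mul_comm]
  · rw [bracket_pow_of_bracket_eq_smul (kOp_lie_bigWOp ε g g'), if_neg hg, mul_zero]
  · have hc : (((-t).toNat : ℕ) : ℂ) = -t := by
      rw [← Int.cast_natCast, Int.toNat_of_nonneg (by omega)]
      push_cast
      rfl
    rw [bracket_pow_of_bracket_eq_smul (kOp_lie_bigWStarOp ε g g'), if_pos hg, hc]
    congr 1
    ring
  · rw [bracket_pow_of_bracket_eq_smul (kOp_lie_bigWStarOp ε g g'), if_neg hg, mul_zero]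

lemma jOp_lie_omegaOp (r : Fin u → ℤ) (g : Fin u) (t : ℤ) :
    ⁅jOp ε r, omegaOp ε g t⁆ = (-2 * ((r g * t : ℤ) : ℂ)) • omegaOp ε g t := by
  simp only [jOp, bracket_sum_left, bracket_smul_left, kOp_lie_omegaOp, smul_smul, ←
    Finset.sum_smul, mul_ite,
    mul_zero, Finset.sum_ite_eq', Finset.mem_univ, if_true]
  congr 1
  push_cast
  ring

/-- Weights add up along the product, so `rOp` has weight -2 r·m and `rStarOp` has weight 2 r·m,
whatever the order of the factors. -/
lemma jOp_lie_imROp {r m : Fin u → ℤ} (h : ∑ g, r g * m g = 0) :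
    ⁅jOp ε r, imROp ε m⁆ = 0 := by
  have h' : ((∑ g, r g * m g : ℤ) : ℂ) = 0 := by simp [h]
  push_cast at h'
  have h1 : ⁅jOp ε r, rOp ε m⁆ = 0 := by
    rw [rOp, List.ofFn_eq_map,
      bracket_list_prod_of_bracket_eq_smul (fun g => jOp_lie_omegaOp ε r g (m g)), ←
      List.ofFn_eq_map,
      List.sum_ofFn, ← Finset.mul_sum]
    push_cast
    rw [h', mul_zero, zero_smul]
  have h2 : ⁅jOp ε r, rStarOp ε m⁆ = 0 := by
    rw [rStarOp, List.ofFn_eq_map, ← List.map_reverse,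
      bracket_list_prod_of_bracket_eq_smul (fun g => jOp_lie_omegaOp ε r g (-m g)),
      List.map_reverse,
      List.sum_reverse, ← List.ofFn_eq_map, List.sum_ofFn, ← Finset.mul_sum]
    push_cast
    simp only [mul_neg, Finset.sum_neg_distrib]
    rw [h', mul_zero, neg_zero, zero_smul]
  rw [imROp, bracket_smul_right, bracket_sub_right, h1, h2, sub_zero, smul_zero]

lemma wStarOp_lie_bigWOp (i : Osc q) (g : Fin u) :
    ⁅wStarOp ε i, bigWOp ε g⁆ = (if i.1 = g then (-2 : ℂ) else 0) • wOp ε i := by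
  obtain ⟨g', i⟩ := i
  simp only [bigWOp, bracket_sum_right, bracket_smul_right, pow_two, bracket_mul_right,
    wStarOp_lie_wOp]
  by_cases hg : g' = g
  · subst hg
    rw [Finset.sum_eq_single i]
    · simp only [if_true, smul_mul_assoc, mul_smul_comm, one_mul, mul_one]
      rw [← add_smul, smul_smul]
      congr 1
      linear_combination (-2 : ℂ) * sign_mul_self (ε ⟨g', i⟩)
    · intro b _ hb
      simp [Ne.symm hb]
    · simp
  · simp [hg]

lemma wOp_lie_bigWStarOp (i : Osc q) (g : Fin u) :
    ⁅wOp ε i, bigWStarOp ε g⁆ = (if i.1 = g then (2 : ℂ) else 0) • wStarOp ε i := by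
  obtain ⟨g', i⟩ := i
  simp only [bigWStarOp, bracket_sum_right, bracket_smul_right, pow_two, bracket_mul_right,
    wOp_lie_wStarOp]
  by_cases hg : g' = g
  · subst hg
    rw [Finset.sum_eq_single i]
    · simp only [if_true, smul_mul_assoc, mul_smul_comm, one_mul, mul_one]
      rw [← add_smul, smul_smul]
      congr 1
      linear_combination (2 : ℂ) * sign_mul_self (ε ⟨g', i⟩)
    · intro b _ hb
      simp [Ne.symm hb]
    · simp
  · simp [hg]

lemma wOp_lie_bigWOp (i : Osc q) (g : Fin u) : ⁅wOp ε i, bigWOp ε g⁆ = 0 := by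
  simp [bigWOp, bracket_sum_right, bracket_smul_right, pow_two, bracket_mul_right, wOp_lie_wOp]

lemma wStarOp_lie_bigWStarOp (i : Osc q) (g : Fin u) :
    ⁅wStarOp ε i, bigWStarOp ε g⁆ = 0 := by
  simp [bigWStarOp, bracket_sum_right, bracket_smul_right, pow_two, bracket_mul_right,
    wStarOp_lie_wStarOp]

/-- The bracket of w_i w_j^* with W_g is a multiple of w_i w_j, with the same factor for both orders
of the indices; the skew combination therefore cancels. -/
lemma momentumOp_lie_bigWOp {i j : Osc q} (hij : i.1 = j.1) (g : Fin u) :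
    ⁅momentumOp ε i j, bigWOp ε g⁆ = 0 := by
  simp only [momentumOp, bracket_smul_left, bracket_sub_left, bracket_mul_left, wOp_lie_bigWOp,
    wStarOp_lie_bigWOp,
    hij, mul_smul_comm, zero_mul, add_zero, ← smul_sub]
  have h := wOp_lie_wOp ε i j
  rw [Ring.lie_def] at h
  rw [h, smul_zero, smul_zero]

lemma momentumOp_lie_bigWStarOp {i j : Osc q} (hij : i.1 = j.1) (g : Fin u) :
    ⁅momentumOp ε i j, bigWStarOp ε g⁆ = 0 := by
  simp only [momentumOp, bracket_smul_left, bracket_sub_left, bracket_mul_left,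
    wStarOp_lie_bigWStarOp,
    wOp_lie_bigWStarOp, hij, smul_mul_assoc, mul_zero, zero_add, ← smul_sub]
  have h := wStarOp_lie_wStarOp ε i j
  rw [Ring.lie_def, sub_eq_zero] at h
  rw [h, sub_self, smul_zero, smul_zero]

lemma commute_momentumOp_omegaOp {i j : Osc q} (hij : i.1 = j.1) (g : Fin u) (t : ℤ) :
    Commute (momentumOp ε i j) (omegaOp ε g t) := by
  unfold omegaOp
  split_ifs
  · exact (commute_iff_lie_eq.mpr (momentumOp_lie_bigWOp ε hij g)).pow_right _
  · exact (commute_iff_lie_eq.mpr (momentumOp_lie_bigWStarOp ε hij g)).pow_right _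

lemma commute_imROp {A : Op (Osc q)} {m : Fin u → ℤ} (h : ∀ g, Commute A (omegaOp ε g (m g)))
    (h' : ∀ g, Commute A (omegaOp ε g (-m g))) : Commute A (imROp ε m) := by
  refine ((Commute.list_prod_right _ _ ?_).sub_right
    (Commute.list_prod_right _ _ ?_)).smul_right _
  · simpa [List.mem_ofFn] using h
  · simpa [List.mem_ofFn] using h'

lemma commute_polyOp {A : Op (Osc q)} {g : Fin u}
    (h : ∀ i j, Commute A (momentumOp ε (⟨g, i⟩ : Osc q) ⟨g, j⟩))
    (f : MvPolynomial (Pair (q g)) ℝ) : Commute A (polyOp ε g f) := by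
  refine (((Commute.one_right A).smul_right _).add_right ?_).add_right ?_
  · exact Commute.sum_right _ _ _ fun a _ => (h _ _).smul_right _
  · exact Commute.sum_right _ _ _ fun a _ => ((h _ _).pow_right _).smul_right _

lemma commute_jOp_polyOp (r : Fin u → ℤ) (g : Fin u) (f : MvPolynomial (Pair (q g)) ℝ) :
    Commute (jOp ε r) (polyOp ε g f) := by
  refine commute_polyOp ε (fun i j => ?_) f
  refine Commute.sum_left _ _ _ fun g' _ => Commute.smul_left ?_ _
  exact commute_iff_lie_eq.mpr (kOp_lie_momentumOp ε g' rfl)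

lemma commute_imROp_polyOp (m : Fin u → ℤ) (g : Fin u) (f : MvPolynomial (Pair (q g)) ℝ) :
    Commute (imROp ε m) (polyOp ε g f) := by
  refine commute_polyOp ε (fun i j => ?_) f
  have h := commute_momentumOp_omegaOp ε (i := ⟨g, i⟩) (j := ⟨g, j⟩) rfl
  exact (commute_imROp ε (fun g' => h g' _) (fun g' => h g' _)).symm

/-- The operators that commute with all operators of the oscillators outside the group `g`. -/
def CommutesOutside (g : Fin u) (A : Op (Osc q)) : Prop :=
  ∀ i : Osc q, i.1 ≠ g → Commute A (wOp ε i) ∧ Commute A (wStarOp ε i)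

lemma commutesOutside_wOp (i : Osc q) : CommutesOutside ε i.1 (wOp ε i) := by
  intro j hj
  have hij : i ≠ j := fun h => hj (h ▸ rfl)
  constructor <;> simp [commute_iff_lie_eq, wOp_lie_wOp, wOp_lie_wStarOp, hij]

lemma commutesOutside_wStarOp (i : Osc q) : CommutesOutside ε i.1 (wStarOp ε i) := by
  intro j hj
  have hij : i ≠ j := fun h => hj (h ▸ rfl)
  constructor <;> simp [commute_iff_lie_eq, wStarOp_lie_wOp, wStarOp_lie_wStarOp, hij]

lemma CommutesOutside.commute_momentumOp {g g' : Fin u} (hg : g ≠ g') {A : Op (Osc q)}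
    (hA : CommutesOutside ε g A) (i j : Fin (q g')) :
    Commute A (momentumOp ε ⟨g', i⟩ ⟨g', j⟩) := by
  have hi := hA ⟨g', i⟩ (Ne.symm hg)
  have hj := hA ⟨g', j⟩ (Ne.symm hg)
  exact ((hi.1.mul_right hj.2).sub_right (hj.1.mul_right hi.2)).smul_right _

lemma CommutesOutside.commute_omegaOp {g g' : Fin u} (hg : g ≠ g') {A : Op (Osc q)}
    (hA : CommutesOutside ε g A) (t : ℤ) : Commute A (omegaOp ε g' t) := by
  unfold omegaOp
  split_ifs
  · exact (Commute.sum_right _ _ _ fun i _ =>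
      ((hA ⟨g', i⟩ (Ne.symm hg)).1.pow_right _).smul_right _).pow_right _
  · exact (Commute.sum_right _ _ _ fun i _ =>
      ((hA ⟨g', i⟩ (Ne.symm hg)).2.pow_right _).smul_right _).pow_right _

lemma commutesOutside_momentumOp (g : Fin u) (i j : Fin (q g)) :
    CommutesOutside ε g (momentumOp ε ⟨g, i⟩ ⟨g, j⟩) := by
  intro k hk
  have hi := commutesOutside_wOp ε ⟨g, i⟩ k hk
  have hj := commutesOutside_wOp ε ⟨g, j⟩ k hk
  have hi' := commutesOutside_wStarOp ε ⟨g, i⟩ k hk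
  have hj' := commutesOutside_wStarOp ε ⟨g, j⟩ k hk
  exact ⟨((hi.1.mul_left hj'.1).sub_left (hj.1.mul_left hi'.1)).smul_left _,
    ((hi.2.mul_left hj'.2).sub_left (hj.2.mul_left hi'.2)).smul_left _⟩

lemma commutesOutside_omegaOp (g : Fin u) (t : ℤ) : CommutesOutside ε g (omegaOp ε g t) := by
  intro k hk
  unfold omegaOp
  split_ifs
  · exact ⟨(Commute.sum_left _ _ _ fun i _ =>
      ((commutesOutside_wOp ε ⟨g, i⟩ k hk).1.pow_left _).smul_left _).pow_left _,
      (Commute.sum_left _ _ _ fun i _ =>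
      ((commutesOutside_wOp ε ⟨g, i⟩ k hk).2.pow_left _).smul_left _).pow_left _⟩
  · exact ⟨(Commute.sum_left _ _ _ fun i _ =>
      ((commutesOutside_wStarOp ε ⟨g, i⟩ k hk).1.pow_left _).smul_left _).pow_left _,
      (Commute.sum_left _ _ _ fun i _ =>
      ((commutesOutside_wStarOp ε ⟨g, i⟩ k hk).2.pow_left _).smul_left _).pow_left _⟩

lemma commute_polyOp_polyOp_of_ne {g g' : Fin u} (hg : g ≠ g') (f : MvPolynomial (Pair (q g)) ℝ)
    (f' : MvPolynomial (Pair (q g')) ℝ) : Commute (polyOp ε g f) (polyOp ε g' f') :=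
  commute_polyOp ε (fun _ _ => (commute_polyOp ε (fun _ _ =>
    (commutesOutside_momentumOp ε g' _ _).commute_momentumOp ε (Ne.symm hg) _ _) f).symm) f'

/-- Within one group the hypothesis makes one exponent vanish, and then the factor is the identity;
`bigWOp` and `bigWStarOp` themselves are never commuted. -/
lemma commute_omegaOp_omegaOp {g g' : Fin u} {t t' : ℤ} (h : g = g' → t * t' = 0) :
    Commute (omegaOp ε g t) (omegaOp ε g' t') := by
  by_cases hg : g = g'
  · rcases mul_eq_zero.mp (h hg) with rfl | rfl
    · simp [omegaOp]
    · simp [omegaOp]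
  · exact (commutesOutside_omegaOp ε g t).commute_omegaOp ε hg t'

lemma commute_imROp_imROp {m m' : Fin u → ℤ} (h : ∀ g, m g * m' g = 0) :
    Commute (imROp ε m) (imROp ε m') := by
  refine commute_imROp ε (fun g => (commute_imROp ε (fun g' => ?_) (fun g' => ?_)).symm)
    (fun g => (commute_imROp ε (fun g' => ?_) (fun g' => ?_)).symm) <;>
  · refine commute_omegaOp_omegaOp ε ?_
    rintro rfl
    simp [mul_comm (m' g), h]

lemma commute_jOp_jOp (r r' : Fin u → ℤ) : Commute (jOp ε r) (jOp ε r') := by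
  refine Commute.sum_left _ _ _ fun g _ => Commute.smul_left ?_ _
  refine Commute.sum_right _ _ _ fun g' _ => Commute.smul_right ?_ _
  refine Commute.sum_right _ _ _ fun i _ => ?_
  rw [iOp_eq ε]
  refine Commute.sub_right (Commute.smul_right ?_ _) ((Commute.one_right _).smul_right _)
  rw [commute_iff_lie_eq, bracket_mul_right, kOp_lie_wOp, kOp_lie_wStarOp]
  split_ifs <;> simp

end Oscillators

open MvPolynomial

/-! ### Standard quantization -/

/-- The position and momentum factors of `monomialOp` are list products; this lemma lets one
variable be multiplied into the symbol. -/
lemma list_prod_map_pow_succ {M κ : Type*} [Monoid M] [DecidableEq κ] {F : κ → M}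
    (hF : ∀ i j, Commute (F i) (F j)) (i : κ) {d d' : κ → ℕ} (hi : d' i = d i + 1)
    (hd : ∀ j, j ≠ i → d' j = d j) :
    ∀ l : List κ, l.Nodup → i ∈ l →
      (l.map fun j => F j ^ d' j).prod = F i * (l.map fun j => F j ^ d j).prod := by
  intro l
  induction l with
  | nil => simp
  | cons a l ih =>
    intro hl hil
    rw [List.nodup_cons] at hl
    simp only [List.map_cons, List.prod_cons]
    by_cases h : a = i
    · subst h
      have hl' : (l.map fun j => F j ^ d' j) = l.map fun j => F j ^ d j := by
        refine List.map_congr_left fun j hj => ?_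
        rw [hd j (fun h => hl.1 (h ▸ hj))]
      rw [hl', hi, pow_succ', mul_assoc]
    · rw [ih hl.2 ((List.mem_cons.mp hil).resolve_left (Ne.symm h)), hd a h, ← mul_assoc,
        ← mul_assoc, ((hF i a).pow_right _).eq]

section Quantize

variable {ι : Type} [Fintype ι] [DecidableEq ι]

/-- The differential operator with a given standard symbol. -/
def quantize : PhasePoly ι →ₗ[ℂ] Op ι :=
  (MvPolynomial.basisMonomials (ι ⊕ ι) ℂ).constr ℂ monomialOp

lemma quantize_monomial (d : ι ⊕ ι →₀ ℕ) (c : ℂ) :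
    quantize (monomial d c) = c • monomialOp d := by
  have h : monomial d c = c • (MvPolynomial.basisMonomials (ι ⊕ ι) ℂ d) := by
    rw [MvPolynomial.coe_basisMonomials, smul_monomial, smul_eq_mul, mul_one]
  rw [h, map_smul, quantize, Module.Basis.constr_basis]

lemma isSymbol_of_eq_quantize {A : Op ι} {f : PhasePoly ι} (h : A = quantize f) :
    IsSymbol A f := by
  rw [IsSymbol, h]
  conv_lhs => rw [f.as_sum]
  rw [map_sum]
  exact Finset.sum_congr rfl fun d _ => quantize_monomial d _

lemma quantize_one : quantize (1 : PhasePoly ι) = 1 := by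
  have h : (1 : PhasePoly ι) = monomial 0 1 := rfl
  rw [h, quantize_monomial, one_smul]
  simp [monomialOp]

lemma quantize_mul_position (f : PhasePoly ι) (i : ι) :
    quantize (f * X (Sum.inl i)) = xOp i * quantize f := by
  induction f using MvPolynomial.induction_on' with
  | monomial d a =>
    have h : monomial d a * X (Sum.inl i) = monomial (d + Finsupp.single (Sum.inl i) 1) a := by
      rw [X, monomial_mul, mul_one]
    rw [h, quantize_monomial, quantize_monomial, mul_smul_comm, monomialOp, monomialOp,
      ← mul_assoc]
    congr 2
    · exact list_prod_map_pow_succ (fun j k => xOp_mul_comm j k) i (by simp)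
        (fun j hj => by simp [Ne.symm hj]) _ (Finset.nodup_toList _) (by simp)
    · simp
  | add p q hp hq => rw [add_mul, map_add, map_add, mul_add, hp, hq]

lemma quantize_mul_momentum (f : PhasePoly ι) (i : ι) :
    quantize (f * X (Sum.inr i)) = quantize f * pOp i := by
  induction f using MvPolynomial.induction_on' with
  | monomial d a =>
    have h : monomial d a * X (Sum.inr i) = monomial (d + Finsupp.single (Sum.inr i) 1) a := by
      rw [X, monomial_mul, mul_one]
    rw [h, quantize_monomial, quantize_monomial, smul_mul_assoc, monomialOp, monomialOp,
      mul_assoc]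
    congr 2
    · simp
    · rw [list_prod_map_pow_succ (d := fun j => d (Sum.inr j)) (fun j k => pOp_mul_comm j k) i
        (by simp) (fun j hj => by simp [Ne.symm hj]) _ (Finset.nodup_toList _) (by simp)]
      -- The list lemma extracts the new momentum on the left of the momenta; it has to be moved to
      -- their right end.
      refine (Commute.list_prod_right _ _ fun y hy => ?_).eq
      obtain ⟨j, -, rfl⟩ := List.mem_map.mp hy
      exact Commute.pow_right (pOp_mul_comm i j) _
  | add p q hp hq => rw [add_mul, map_add, map_add, add_mul, hp, hq]

/-- The symbol calculus used everywhere below: moving p_i through the positions produces the single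
correction -i ∂f/∂x_i. -/
lemma pOp_mul_quantize (i : ι) (f : PhasePoly ι) :
    pOp i * quantize f =
      quantize (X (Sum.inr i) * f - Complex.I • pderiv (Sum.inl i) f) := by
  induction f using MvPolynomial.induction_on with
  | C a =>
    rw [pderiv_C, smul_zero, sub_zero, mul_comm, quantize_mul_momentum, ← mul_one (C a), C_mul',
      map_smul, quantize_one, mul_smul_comm, smul_mul_assoc, one_mul, mul_one]
  | add p q hp hq =>
    rw [map_add, mul_add, hp, hq, ← map_add]
    congr 1
    rw [map_add, smul_add]
    ring
  | mul_X p n hp =>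
    rcases n with j | j
    · rw [quantize_mul_position, ← mul_assoc, pOp_mul_xOp, sub_mul, mul_assoc, hp,
        ← quantize_mul_position]
      have h : (if i = j then Complex.I • (1 : Op ι) else 0) * quantize p =
          quantize (if i = j then Complex.I • p else 0) := by
        split_ifs
        · rw [smul_mul_assoc, one_mul, map_smul]
        · rw [zero_mul, map_zero]
      rw [h, ← map_sub]
      congr 1
      rw [pderiv_mul, pderiv_X]
      by_cases hij : i = j
      · subst hij
        simp only [if_true, Pi.single_eq_same, smul_eq_C_mul]
        ring
      · simp only [hij, if_false, Pi.single_apply, Sum.inl.injEq, Ne.symm hij, smul_eq_C_mul]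
        ring
    · rw [quantize_mul_momentum, ← mul_assoc, hp, ← quantize_mul_momentum]
      congr 1
      rw [pderiv_mul, pderiv_X_of_ne (by simp)]
      simp only [smul_eq_C_mul]
      ring

/-- The symbol of the product of `wOp ε i` and an operator. -/
def wSymbol (ε : ι → ℤˣ) (i : ι) (f : PhasePoly ι) : PhasePoly ι :=
  C (1 / (Real.sqrt 2 : ℂ)) * ((X (Sum.inl i) + C (Complex.I * ((ε i : ℤ) : ℂ)) * X (Sum.inr i)) * f
    + C (((ε i : ℤ) : ℂ)) * pderiv (Sum.inl i) f)

lemma wOp_mul_quantize (ε : ι → ℤˣ) (i : ι) (f : PhasePoly ι) :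
    wOp ε i * quantize f = quantize (wSymbol ε i f) := by
  rw [wOp_eq, smul_mul_assoc, add_mul, smul_mul_assoc, pOp_mul_quantize, ← quantize_mul_position,
    ← map_smul, ← map_add, ← map_smul]
  congr 1
  have h : (C Complex.I * C Complex.I : PhasePoly ι) = -1 := by
    rw [← C_mul, Complex.I_mul_I]
    simp
  simp only [wSymbol, smul_eq_C_mul, C_mul]
  linear_combination (-C (1 / (Real.sqrt 2 : ℂ)) * C (((ε i : ℤ) : ℂ)) *
    pderiv (Sum.inl i) f) * h

lemma wStarOp_eq_wOp_neg (ε : ι → ℤˣ) (i : ι) : wStarOp ε i = wOp (-ε) i := by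
  rw [wStarOp_eq, wOp_eq]
  simp

end Quantize

/-! ### The filtration by the degree in the momenta -/

section Filtration

variable {ι : Type}

/-- The polynomials all of whose monomials have a degree in the momenta that belongs to `S`. -/
def momentumDegreeIn (S : Set ℤ) : Submodule ℂ (PhasePoly ι) :=
  restrictSupport ℂ {d | ((Finsupp.weight momentumWeight d : ℕ) : ℤ) ∈ S}

lemma mem_momentumDegreeIn {S : Set ℤ} {f : PhasePoly ι} : f ∈ momentumDegreeIn S ↔
    ∀ d, f.coeff d ≠ 0 → ((Finsupp.weight momentumWeight d : ℕ) : ℤ) ∈ S := by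
  rw [momentumDegreeIn, mem_restrictSupport_iff]
  exact forall_congr' fun d => by simp

lemma momentumDegreeIn_mono {S T : Set ℤ} (h : S ⊆ T) {f : PhasePoly ι}
    (hf : f ∈ momentumDegreeIn S) : f ∈ momentumDegreeIn T := by
  rw [mem_momentumDegreeIn] at hf ⊢
  exact fun d hd => h (hf d hd)

lemma mul_mem_momentumDegreeIn {S T U : Set ℤ} (h : ∀ a ∈ S, ∀ b ∈ T, a + b ∈ U)
    {f g : PhasePoly ι} (hf : f ∈ momentumDegreeIn S) (hg : g ∈ momentumDegreeIn T) :
    f * g ∈ momentumDegreeIn U := by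
  classical
  rw [mem_momentumDegreeIn] at *
  intro d hd
  have hd' := support_mul f g (mem_support_iff.mpr hd)
  obtain ⟨a, ha, b, hb, rfl⟩ := Finset.mem_add.mp hd'
  rw [map_add, Nat.cast_add]
  exact h _ (hf a (mem_support_iff.mp ha)) _ (hg b (mem_support_iff.mp hb))

/-- The polynomials of degree at most `N` in the momenta. -/
abbrev momentumDegreeLE (N : ℤ) : Submodule ℂ (PhasePoly ι) := momentumDegreeIn (Set.Iic N)

/-- The polynomials that are homogeneous of degree `N` in the momenta. -/
abbrev momentumHomogeneous (N : ℤ) : Submodule ℂ (PhasePoly ι) := momentumDegreeIn {N}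

lemma momentumDegreeLE_mono {M N : ℤ} (h : M ≤ N) {f : PhasePoly ι}
    (hf : f ∈ momentumDegreeLE M) : f ∈ momentumDegreeLE N :=
  momentumDegreeIn_mono (Set.Iic_subset_Iic.mpr h) hf

lemma momentumDegreeLE_of_homogeneous {M N : ℤ} (h : M ≤ N) {f : PhasePoly ι}
    (hf : f ∈ momentumHomogeneous M) : f ∈ momentumDegreeLE N :=
  momentumDegreeIn_mono (by simpa using h) hf

lemma mul_mem_momentumDegreeLE {M N K : ℤ} (h : M + N ≤ K) {f g : PhasePoly ι}
    (hf : f ∈ momentumDegreeLE M) (hg : g ∈ momentumDegreeLE N) :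
    f * g ∈ momentumDegreeLE K :=
  mul_mem_momentumDegreeIn (fun _ ha _ hb => (add_le_add ha hb).trans h) hf hg

lemma mul_mem_momentumHomogeneous {M N K : ℤ} (h : M + N = K) {f g : PhasePoly ι}
    (hf : f ∈ momentumHomogeneous M) (hg : g ∈ momentumHomogeneous N) :
    f * g ∈ momentumHomogeneous K := by
  refine mul_mem_momentumDegreeIn (fun a ha b hb => ?_) hf hg
  rw [Set.mem_singleton_iff] at ha hb ⊢
  rw [ha, hb, h]

lemma C_mem_momentumHomogeneous (c : ℂ) : (C c : PhasePoly ι) ∈ momentumHomogeneous 0 := by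
  classical
  rw [mem_momentumDegreeIn]
  intro d hd
  rw [coeff_C] at hd
  have : d = 0 := by
    by_contra h
    exact hd (if_neg (Ne.symm h))
  simp [this]

lemma position_mem_momentumHomogeneous (i : ι) :
    (X (Sum.inl i) : PhasePoly ι) ∈ momentumHomogeneous 0 := by
  classical
  rw [mem_momentumDegreeIn]
  intro d hd
  rw [coeff_X] at hd
  have : Finsupp.single (Sum.inl i) 1 = d := by
    by_contra h
    exact hd (if_neg h)
  simp [← this, Finsupp.weight_single, momentumWeight]

lemma momentum_mem_momentumHomogeneous (i : ι) :
    (X (Sum.inr i) : PhasePoly ι) ∈ momentumHomogeneous 1 := by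
  classical
  rw [mem_momentumDegreeIn]
  intro d hd
  rw [coeff_X] at hd
  have : Finsupp.single (Sum.inr i) 1 = d := by
    by_contra h
    exact hd (if_neg h)
  simp [← this, Finsupp.weight_single, momentumWeight]

lemma pderiv_position_mem {S : Set ℤ} (i : ι) {f : PhasePoly ι} (hf : f ∈ momentumDegreeIn S) :
    pderiv (Sum.inl i) f ∈ momentumDegreeIn S := by
  rw [mem_momentumDegreeIn] at *
  intro d hd
  rw [coeff_pderiv] at hd
  have h := hf _ (left_ne_zero_of_mul hd)
  simpa [Finsupp.weight_single, momentumWeight] using h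

lemma C_mul_mem_momentumDegreeIn {S : Set ℤ} (c : ℂ) {f : PhasePoly ι}
    (hf : f ∈ momentumDegreeIn S) : C c * f ∈ momentumDegreeIn S := by
  rw [C_mul']
  exact Submodule.smul_mem _ _ hf

/-- The condition T ≠ 0 is essential: it ensures that the degree of f in the momenta is M rather
than smaller. -/
lemma mainPart_eq {f T : PhasePoly ι} {M : ℤ} (hT : T ∈ momentumHomogeneous M) (hT0 : T ≠ 0)
    (h : f - T ∈ momentumDegreeLE (M - 1)) : mainPart f = T := by
  classical
  rw [mem_momentumDegreeIn] at hT h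
  have hc : ∀ d, M ≤ ((Finsupp.weight momentumWeight d : ℕ) : ℤ) → f.coeff d = T.coeff d := by
    intro d hd
    by_contra hne
    have := h d (by rwa [coeff_sub, sub_ne_zero])
    rw [Set.mem_Iic] at this
    omega
  obtain ⟨d₀, hd₀⟩ := MvPolynomial.ne_zero_iff.mp hT0
  have hw₀ : ((Finsupp.weight momentumWeight d₀ : ℕ) : ℤ) = M := hT d₀ hd₀
  have hdeg : weightedTotalDegree momentumWeight f = Finsupp.weight momentumWeight d₀ := by
    refine le_antisymm ?_ ?_
    · refine Finset.sup_le fun d hd => ?_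
      by_contra hlt
      rw [mem_support_iff] at hd
      have h1 : M ≤ ((Finsupp.weight momentumWeight d : ℕ) : ℤ) := by omega
      rw [hc d h1] at hd
      have h2 : ((Finsupp.weight momentumWeight d : ℕ) : ℤ) = M := hT d hd
      omega
    · exact le_weightedTotalDegree _ (mem_support_iff.mpr (by rwa [hc d₀ hw₀.ge]))
  ext d
  rw [mainPart, hdeg, coeff_weightedHomogeneousComponent]
  split_ifs with hd
  · exact hc d (by omega)
  · by_contra hne
    have h2 : ((Finsupp.weight momentumWeight d : ℕ) : ℤ) = M := hT d (Ne.symm hne)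
    omega

end Filtration

/-! ### The symbols of the resonance operators -/

lemma mkDerivation_eq_sum {σ : Type*} [Fintype σ] (V : σ → MvPolynomial σ ℂ)
    (f : MvPolynomial σ ℂ) : mkDerivation ℂ V f = ∑ v, V v * pderiv v f := by
  classical
  induction f using MvPolynomial.induction_on with
  | C a => simp [derivation_C]
  | add p r hp hr => simp only [map_add, hp, hr, mul_add, Finset.sum_add_distrib]
  | mul_X p i hp =>
    simp only [Derivation.leibniz, hp, mkDerivation_X, smul_eq_mul, mul_add, pderiv_X,
      Finset.sum_add_distrib, Finset.mul_sum]
    congr 1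
    · rw [Finset.sum_eq_single i]
      · simp [mul_comm]
      · intro v _ hv
        simp [Ne.symm hv]
      · simp
    · exact Finset.sum_congr rfl fun v _ => by ring

section Leading

variable {u : ℕ} {q : Fin u → ℕ} (ε : Osc q → ℤˣ)

/-- `∑ ε_i p_i² / 2`, the sum being over the group `g`. -/
def kineticCl (g : Fin u) : PhasePoly (Osc q) :=
  ∑ i : Fin (q g), C (1 / 2 * ((ε ⟨g, i⟩ : ℤ) : ℂ)) * X (Sum.inr (⟨g, i⟩ : Osc q)) ^ 2

/-- `∑ x_i p_i`, the sum being over the group `g`. -/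
def dilationCl (g : Fin u) : PhasePoly (Osc q) :=
  ∑ i : Fin (q g), X (Sum.inl (⟨g, i⟩ : Osc q)) * X (Sum.inr (⟨g, i⟩ : Osc q))

/-- The vector field `∑ ε_i p_i ∂/∂x_i`, the sum being over the group `g`. -/
def shearField (g : Fin u) : Derivation ℂ (PhasePoly (Osc q)) (PhasePoly (Osc q)) :=
  mkDerivation ℂ (Sum.elim
    (fun i : Osc q => if i.1 = g then C ((ε i : ℤ) : ℂ) * X (Sum.inr i) else 0) 0)

/-- The vector field `∑ (x_i ∂/∂x_i - p_i ∂/∂p_i)`, the sum being over the group `g`. -/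
def squeezeField (g : Fin u) : Derivation ℂ (PhasePoly (Osc q)) (PhasePoly (Osc q)) :=
  mkDerivation ℂ (Sum.elim (fun i : Osc q => if i.1 = g then X (Sum.inl i) else 0)
    (fun i : Osc q => if i.1 = g then -X (Sum.inr i) else 0))

/-- The shear field differentiates only in the positions, on which the kinetic form does not depend.
-/
lemma shearField_kineticCl (g g' : Fin u) : shearField ε g (kineticCl ε g') = 0 := by
  simp [shearField, kineticCl, Derivation.leibniz, Derivation.leibniz_pow, derivation_C]

lemma shearField_dilationCl (g g' : Fin u) :
    shearField ε g (dilationCl g') = if g' = g then 2 * kineticCl ε g' else 0 := by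
  have h2 : (2 : PhasePoly (Osc q)) = C 2 := rfl
  simp only [shearField, dilationCl, kineticCl, map_sum, Derivation.leibniz, mkDerivation_X,
    Sum.elim_inr, Sum.elim_inl, Pi.zero_apply, smul_eq_mul]
  split_ifs
  · rw [Finset.mul_sum]
    refine Finset.sum_congr rfl fun i _ => ?_
    have h3 : (2 : ℂ) * (1 / 2 * ((ε ⟨g', i⟩ : ℤ) : ℂ)) = ((ε ⟨g', i⟩ : ℤ) : ℂ) := by ring
    rw [h2, ← mul_assoc (C 2), ← C_mul, h3]
    ring
  · simp

lemma squeezeField_kineticCl (g g' : Fin u) :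
    squeezeField g (kineticCl ε g') = if g' = g then -2 * kineticCl ε g' else 0 := by
  simp only [squeezeField, kineticCl, map_sum, Derivation.leibniz, mkDerivation_X,
    Derivation.leibniz_pow, derivation_C, Sum.elim_inr, smul_eq_mul]
  split_ifs
  · rw [Finset.mul_sum]
    refine Finset.sum_congr rfl fun i _ => ?_
    simp only [nsmul_eq_mul]
    push_cast
    ring
  · simp

lemma kineticCl_mem (g : Fin u) : kineticCl ε g ∈ momentumHomogeneous 2 :=
  sum_mem fun i _ => C_mul_mem_momentumDegreeIn _ (by
    rw [pow_two]
    exact mul_mem_momentumHomogeneous (by norm_num) (momentum_mem_momentumHomogeneous _)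
      (momentum_mem_momentumHomogeneous _))

lemma dilationCl_mem (g : Fin u) : (dilationCl g : PhasePoly (Osc q)) ∈ momentumHomogeneous 1 :=
  sum_mem fun i _ => mul_mem_momentumHomogeneous (by norm_num)
    (position_mem_momentumHomogeneous _) (momentum_mem_momentumHomogeneous _)

lemma pderiv_position_kineticCl (i : Osc q) (g : Fin u) :
    pderiv (Sum.inl i) (kineticCl ε g) = 0 := by
  simp [kineticCl, Derivation.leibniz, Derivation.leibniz_pow, derivation_C, pderiv_X]

/-- `bigWOp ε g` if `τ = 1`, and its hermitian conjugate if `τ = -1`. -/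
def signedBigWOp (τ : ℤˣ) (g : Fin u) : Op (Osc q) :=
  ∑ i : Fin (q g), ((ε ⟨g, i⟩ : ℤ) : ℂ) • wOp (fun j => τ * ε j) (⟨g, i⟩ : Osc q) ^ 2

lemma signedBigWOp_one (g : Fin u) : signedBigWOp ε 1 g = bigWOp ε g := by
  simp [signedBigWOp, bigWOp]

lemma signedBigWOp_neg_one (g : Fin u) : signedBigWOp ε (-1) g = bigWStarOp ε g := by
  have h : (fun j => -1 * ε j) = -ε := funext fun j => by simp
  simp only [signedBigWOp, bigWStarOp, wStarOp_eq_wOp_neg, h]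

/-- The terms of the symbol of the product of `signedBigWOp ε τ g` and an operator that do not
contribute to the two highest orders. -/
def remainderSymbol (τ : ℤˣ) (g : Fin u) (f : PhasePoly (Osc q)) : PhasePoly (Osc q) :=
  ∑ i : Fin (q g), (C (1 / 2 * ((ε ⟨g, i⟩ : ℤ) : ℂ)) * (X (Sum.inl ⟨g, i⟩) ^ 2 * f)
    + C ((τ : ℤ) : ℂ) * (X (Sum.inl ⟨g, i⟩) * pderiv (Sum.inl ⟨g, i⟩) f)
    + C (Complex.I * ((ε ⟨g, i⟩ : ℤ) : ℂ)) * (X (Sum.inr ⟨g, i⟩) * pderiv (Sum.inl ⟨g, i⟩) f)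
    + C (1 / 2 * ((τ : ℤ) : ℂ)) * f
    + C (1 / 2 * ((ε ⟨g, i⟩ : ℤ) : ℂ)) *
      pderiv (Sum.inl ⟨g, i⟩) (pderiv (Sum.inl ⟨g, i⟩) f))

lemma wSymbol_wSymbol {ι : Type} [Fintype ι] [DecidableEq ι] (σ : ι → ℤˣ) (i : ι)
    (f : PhasePoly ι) : wSymbol σ i (wSymbol σ i f) =
      C (1 / 2) * ((X (Sum.inl i) + C Complex.I * C ((σ i : ℤ) : ℂ) * X (Sum.inr i)) ^ 2 * f
        + 2 * C ((σ i : ℤ) : ℂ) * (X (Sum.inl i) + C Complex.I * C ((σ i : ℤ) : ℂ) *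
          X (Sum.inr i)) * pderiv (Sum.inl i) f
        + C ((σ i : ℤ) : ℂ) * f + pderiv (Sum.inl i) (pderiv (Sum.inl i) f)) := by
  have h1 : (C ((σ i : ℤ) : ℂ) * C ((σ i : ℤ) : ℂ) : PhasePoly ι) = 1 := by
    rw [← C_mul, sign_mul_self, C_1]
  have h2 : (C (1 / (Real.sqrt 2 : ℂ)) * C (1 / (Real.sqrt 2 : ℂ)) : PhasePoly ι) =
      C (1 / 2) := by
    rw [← C_mul, one_div_sqrt_two_mul_self]
  rw [← h2]
  simp only [wSymbol, map_add, pderiv_mul, pderiv_C, C_mul, pderiv_X_self,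
    pderiv_X_of_ne (show Sum.inr i ≠ Sum.inl i by simp)]
  linear_combination (C (1 / (Real.sqrt 2 : ℂ)) * C (1 / (Real.sqrt 2 : ℂ)) *
    pderiv (Sum.inl i) (pderiv (Sum.inl i) f)) * h1

/-- Only the term iτ times `dilationCl` sees, at the second highest order, whether W_g or its
conjugate is applied. This is the source of the nonzero main part of Im R_m. -/
lemma signedBigWOp_mul_quantize (τ : ℤˣ) (g : Fin u) (f : PhasePoly (Osc q)) :
    signedBigWOp ε τ g * quantize f = quantize ((-kineticCl ε g
      + C Complex.I * C ((τ : ℤ) : ℂ) * dilationCl g) * f + remainderSymbol ε τ g f) := by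
  rw [signedBigWOp, Finset.sum_mul, kineticCl, dilationCl, remainderSymbol,
    ← Finset.sum_neg_distrib, Finset.mul_sum, ← Finset.sum_add_distrib, Finset.sum_mul,
    ← Finset.sum_add_distrib, map_sum]
  refine Finset.sum_congr rfl fun i _ => ?_
  rw [smul_mul_assoc, pow_two, mul_assoc, wOp_mul_quantize, wOp_mul_quantize, wSymbol_wSymbol,
    ← map_smul]
  congr 1
  have he : (C ((ε ⟨g, i⟩ : ℤ) : ℂ) * C ((ε ⟨g, i⟩ : ℤ) : ℂ) : PhasePoly (Osc q)) = 1 := by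
    rw [← C_mul, sign_mul_self, C_1]
  have ht : (C ((τ : ℤ) : ℂ) * C ((τ : ℤ) : ℂ) : PhasePoly (Osc q)) = 1 := by
    rw [← C_mul, sign_mul_self, C_1]
  have hI : (C Complex.I * C Complex.I : PhasePoly (Osc q)) = -1 := by
    rw [← C_mul, Complex.I_mul_I]
    simp
  have h2 : (C (1 / 2) * 2 : PhasePoly (Osc q)) = 1 := by
    have h : (2 : PhasePoly (Osc q)) = C 2 := rfl
    rw [h, ← C_mul]
    norm_num
  simp only [smul_eq_C_mul, Units.val_mul, Int.cast_mul, C_mul]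
  set e : PhasePoly (Osc q) := C ((ε ⟨g, i⟩ : ℤ) : ℂ)
  set t : PhasePoly (Osc q) := C ((τ : ℤ) : ℂ)
  set c : PhasePoly (Osc q) := C (1 / 2)
  set J : PhasePoly (Osc q) := C Complex.I
  set x : PhasePoly (Osc q) := X (Sum.inl ⟨g, i⟩)
  set p : PhasePoly (Osc q) := X (Sum.inr ⟨g, i⟩)
  set f' := pderiv (Sum.inl ⟨g, i⟩) f
  linear_combination ((J * t * x * p * f + t * x * f' + J * e * p * f') * (2 * c) + c * t * f
      - c * e * p ^ 2 * f) * he + (J * t * x * p * f + t * x * f' + J * e * p * f') * h2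
    + (c * e * p ^ 2 * f * t ^ 2 * e ^ 2) * hI
    + (J * e * p * f' * (2 * c * e ^ 2) - c * e * p ^ 2 * f * e ^ 2) * ht

/-- `f` is, up to terms of degree at most `N - 2` in the momenta, the sum of the homogeneous part
`A` of degree `N`, which does not depend on the positions, and of the homogeneous part `i B` of
degree `N - 1`. -/
structure IsLeading (f A B : PhasePoly (Osc q)) (N : ℤ) (t : Fin u → ℤ) : Prop where
  top : A ∈ momentumHomogeneous N
  pderiv_top : ∀ i, pderiv (Sum.inl i) A = 0
  next : B ∈ momentumHomogeneous (N - 1)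
  rest : f - (A + C Complex.I * B) ∈ momentumDegreeLE (N - 2)
  shear : ∀ g, shearField ε g B = -2 * C ((t g : ℤ) : ℂ) * A

lemma isLeading_one : IsLeading ε (1 : PhasePoly (Osc q)) 1 0 0 0 where
  top := by simpa using C_mem_momentumHomogeneous (ι := Osc q) 1
  pderiv_top i := pderiv_one
  next := zero_mem _
  rest := by simp
  shear g := by simp

variable {ε} in
lemma IsLeading.mem {f A B : PhasePoly (Osc q)} {N : ℤ} {t : Fin u → ℤ}
    (h : IsLeading ε f A B N t) : f ∈ momentumDegreeLE N := by
  have h1 := add_mem (momentumDegreeLE_mono (by omega : N - 2 ≤ N) h.rest)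
    (add_mem (momentumDegreeLE_of_homogeneous le_rfl h.top) (C_mul_mem_momentumDegreeIn Complex.I
      (momentumDegreeLE_of_homogeneous (by omega : N - 1 ≤ N) h.next)))
  simpa using h1

variable {ε} in
lemma IsLeading.pderiv_mem {f A B : PhasePoly (Osc q)} {N : ℤ} {t : Fin u → ℤ}
    (h : IsLeading ε f A B N t) (i : Osc q) :
    pderiv (Sum.inl i) f ∈ momentumDegreeLE (N - 1) := by
  have h1 := pderiv_position_mem i
    (add_mem (momentumDegreeLE_mono (by omega : N - 2 ≤ N - 1) h.rest)
      (C_mul_mem_momentumDegreeIn Complex.I (momentumDegreeLE_of_homogeneous le_rfl h.next)))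
  have h2 : f - (A + C Complex.I * B) + C Complex.I * B = f - A := by ring
  rwa [h2, map_sub, h.pderiv_top, sub_zero] at h1

/-- The dangerous term p ∂f/∂x has order N and not N + 1, since the derivative lowers the order by
one: the top part of a leading symbol is free of positions. -/
lemma remainderSymbol_mem (τ : ℤˣ) (g : Fin u) {f : PhasePoly (Osc q)} {N : ℤ}
    (h : f ∈ momentumDegreeLE N)
    (h' : ∀ i, pderiv (Sum.inl i) f ∈ momentumDegreeLE (N - 1)) :
    remainderSymbol ε τ g f ∈ momentumDegreeLE N := by
  have hx : ∀ i, (X (Sum.inl i) : PhasePoly (Osc q)) ∈ momentumDegreeLE 0 := fun i =>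
    momentumDegreeLE_of_homogeneous le_rfl (position_mem_momentumHomogeneous i)
  have hp : ∀ i, (X (Sum.inr i) : PhasePoly (Osc q)) ∈ momentumDegreeLE 1 := fun i =>
    momentumDegreeLE_of_homogeneous le_rfl (momentum_mem_momentumHomogeneous i)
  refine sum_mem fun i _ => add_mem (add_mem (add_mem (add_mem ?_ ?_) ?_) ?_) ?_ <;>
    refine C_mul_mem_momentumDegreeIn _ ?_
  · rw [pow_two, mul_assoc]
    exact mul_mem_momentumDegreeLE (zero_add N).le (hx _)
      (mul_mem_momentumDegreeLE (zero_add N).le (hx _) h)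
  · exact mul_mem_momentumDegreeLE (by omega) (hx _) (h' _)
  · exact mul_mem_momentumDegreeLE (by omega) (hp _) (h' _)
  · exact h
  · exact pderiv_position_mem _ (momentumDegreeLE_mono (by omega : N - 1 ≤ N) (h' _))

variable {ε} in
lemma IsLeading.step {f A B : PhasePoly (Osc q)} {N : ℤ} {t : Fin u → ℤ}
    (h : IsLeading ε f A B N t) (τ : ℤˣ) (g : Fin u) :
    IsLeading ε ((-kineticCl ε g + C Complex.I * C ((τ : ℤ) : ℂ) * dilationCl g) * f
        + remainderSymbol ε τ g f)
      (-kineticCl ε g * A) (-kineticCl ε g * B + C ((τ : ℤ) : ℂ) * (dilationCl g * A))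
      (N + 2) (t + Pi.single g (τ : ℤ)) where
  top := mul_mem_momentumHomogeneous (by omega) (neg_mem (kineticCl_mem ε g)) h.top
  pderiv_top i := by
    rw [pderiv_mul, h.pderiv_top, map_neg, pderiv_position_kineticCl]
    simp
  next := add_mem (mul_mem_momentumHomogeneous (by omega) (neg_mem (kineticCl_mem ε g)) h.next)
    (C_mul_mem_momentumDegreeIn _
      (mul_mem_momentumHomogeneous (by omega) (dilationCl_mem g) h.top))
  rest := by
    have hd : (dilationCl g : PhasePoly (Osc q)) ∈ momentumDegreeLE 1 :=
      momentumDegreeLE_of_homogeneous le_rfl (dilationCl_mem g)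
    have hW : -kineticCl ε g + C Complex.I * C ((τ : ℤ) : ℂ) * dilationCl g ∈
        momentumDegreeLE 2 := by
      refine add_mem (neg_mem (momentumDegreeLE_of_homogeneous le_rfl (kineticCl_mem ε g))) ?_
      rw [mul_assoc]
      exact C_mul_mem_momentumDegreeIn _ (C_mul_mem_momentumDegreeIn _
        (momentumDegreeLE_mono (by norm_num) hd))
    -- The product of iτ `dilationCl` and iB equals -τ `dilationCl` B. It has order N, two below the
    -- new top order, and so goes to the remainder.
    have h1 : C (-((τ : ℤ) : ℂ)) * (dilationCl g * B) ∈ momentumDegreeLE (N + 2 - 2) :=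
      C_mul_mem_momentumDegreeIn _ (mul_mem_momentumDegreeLE (by omega) hd
        (momentumDegreeLE_of_homogeneous le_rfl h.next))
    have h2 := mul_mem_momentumDegreeLE (by omega : 2 + (N - 2) ≤ N + 2 - 2) hW h.rest
    have h3 := momentumDegreeLE_mono (by omega : N ≤ N + 2 - 2)
      (remainderSymbol_mem ε τ g h.mem h.pderiv_mem)
    have hI : (C Complex.I * C Complex.I : PhasePoly (Osc q)) = -1 := by
      rw [← C_mul, Complex.I_mul_I]
      simp
    convert add_mem (add_mem h1 h2) h3 using 1
    rw [C_neg]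
    linear_combination (C ((τ : ℤ) : ℂ) * dilationCl g * B) * hI
  shear g' := by
    rw [map_add, Derivation.leibniz, Derivation.leibniz, Derivation.leibniz, derivation_C,
      map_neg, shearField_kineticCl, h.shear, shearField_dilationCl]
    -- The top part does not depend on the positions, hence the shear field sees only the factor
    -- `dilationCl g`, which contributes 2τ times the kinetic form: this is how t counts the
    -- exponents with sign.
    have hA : shearField ε g' A = 0 := by
      simp [shearField, mkDerivation_eq_sum, h.pderiv_top]
    rw [hA]
    by_cases hg : g = g'
    · subst hg
      simp only [smul_eq_mul, if_true, Pi.add_apply, Pi.single_eq_same, Int.cast_add, C_add]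
      ring
    · simp only [smul_eq_mul, hg, if_false, Pi.add_apply, Pi.single_eq_of_ne (Ne.symm hg),
        add_zero]
      ring


/-- The operator `T` has a symbol with highest part `A`, see `IsLeading`. -/
def HasLeading (T : Op (Osc q)) (A : PhasePoly (Osc q)) (N : ℤ) (t : Fin u → ℤ) : Prop :=
  ∃ f B, T = quantize f ∧ IsLeading ε f A B N t

lemma hasLeading_one : HasLeading ε 1 1 0 0 :=
  ⟨1, 0, quantize_one.symm, isLeading_one ε⟩

variable {ε} in
lemma HasLeading.signedBigWOp_pow_mul {T : Op (Osc q)} {A : PhasePoly (Osc q)} {N : ℤ}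
    {t : Fin u → ℤ} (h : HasLeading ε T A N t) (τ : ℤˣ) (g : Fin u) (n : ℕ) :
    HasLeading ε (signedBigWOp ε τ g ^ n * T) ((-kineticCl ε g) ^ n * A) (2 * n + N)
      (Pi.single g (n * (τ : ℤ)) + t) := by
  induction n with
  | zero => simpa using h
  | succ n ih =>
    obtain ⟨f, B, hT, hf⟩ := ih
    have key := hf.step τ g
    rw [← mul_assoc, ← pow_succ', add_right_comm, add_right_comm (Pi.single g _), ← Pi.single_add,
      show 2 * (n : ℤ) + 2 = 2 * ((n + 1 : ℕ) : ℤ) by push_cast; ring,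
      show (n : ℤ) * (τ : ℤ) + (τ : ℤ) = ((n + 1 : ℕ) : ℤ) * (τ : ℤ) by push_cast; ring] at key
    refine ⟨_, _, ?_, key⟩
    rw [pow_succ', mul_assoc, hT]
    exact signedBigWOp_mul_quantize ε τ g f

variable {ε} in
lemma HasLeading.omegaOp_mul {T : Op (Osc q)} {A : PhasePoly (Osc q)} {N : ℤ}
    {t : Fin u → ℤ} (h : HasLeading ε T A N t) (g : Fin u) (s : ℤ) :
    HasLeading ε (omegaOp ε g s * T) ((-kineticCl ε g) ^ s.natAbs * A) (2 * s.natAbs + N)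
      (Pi.single g s + t) := by
  unfold omegaOp
  split_ifs with hs
  · have h1 := h.signedBigWOp_pow_mul 1 g s.toNat
    have h2 : s.toNat = s.natAbs := by omega
    have h3 : (s.natAbs : ℤ) * ((1 : ℤˣ) : ℤ) = s := by
      rw [Units.val_one, mul_one]
      omega
    rw [signedBigWOp_one, h2, h3] at h1
    rwa [h2]
  · have h1 := h.signedBigWOp_pow_mul (-1) g (-s).toNat
    have h2 : (-s).toNat = s.natAbs := by omega
    have h3 : (s.natAbs : ℤ) * ((-1 : ℤˣ) : ℤ) = s := by
      rw [Units.val_neg, Units.val_one]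
      omega
    rw [signedBigWOp_neg_one, h2, h3] at h1
    rwa [h2]

lemma hasLeading_list (s : Fin u → ℤ) (l : List (Fin u)) :
    HasLeading ε (l.map fun g => omegaOp ε g (s g)).prod
      (l.map fun g => (-kineticCl ε g) ^ (s g).natAbs).prod
      (l.map fun g => 2 * ((s g).natAbs : ℤ)).sum (l.map fun g => Pi.single g (s g)).sum := by
  induction l with
  | nil => simpa using hasLeading_one ε
  | cons g l ih =>
    simp only [List.map_cons, List.prod_cons, List.sum_cons]
    exact ih.omegaOp_mul g (s g)

/-- The top part and the exponent vector do not depend on the order of the groups, which covers both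
R_m and its conjugate with the factors reversed. -/
lemma hasLeading_of_perm (s : Fin u → ℤ) {l : List (Fin u)} (hl : l.Perm (List.finRange u)) :
    HasLeading ε (l.map fun g => omegaOp ε g (s g)).prod
      (∏ g, (-kineticCl ε g) ^ (s g).natAbs) (∑ g, 2 * ((s g).natAbs : ℤ)) s := by
  have h := hasLeading_list ε s l
  rw [(hl.map _).prod_eq, (hl.map fun g => 2 * ((s g).natAbs : ℤ)).sum_eq,
    (hl.map fun g => (Pi.single g (s g) : Fin u → ℤ)).sum_eq, ← List.ofFn_eq_map,
    ← List.ofFn_eq_map, ← List.ofFn_eq_map, List.prod_ofFn, List.sum_ofFn, List.sum_ofFn,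
    Finset.univ_sum_single] at h
  exact h

lemma hasLeading_rOp (m : Fin u → ℤ) :
    HasLeading ε (rOp ε m) (∏ g, (-kineticCl ε g) ^ (m g).natAbs)
      (∑ g, 2 * ((m g).natAbs : ℤ)) m := by
  rw [rOp, List.ofFn_eq_map]
  exact hasLeading_of_perm ε m (List.Perm.refl _)

/-- The absolute values make the top part the same as for `rOp ε m`, while the exponent vector
changes sign: the top parts cancel in the difference and the shear derivatives of the next parts add
up. -/
lemma hasLeading_rStarOp (m : Fin u → ℤ) :
    HasLeading ε (rStarOp ε m) (∏ g, (-kineticCl ε g) ^ (m g).natAbs)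
      (∑ g, 2 * ((m g).natAbs : ℤ)) (-m) := by
  rw [rStarOp, List.ofFn_eq_map, ← List.map_reverse]
  simpa using hasLeading_of_perm ε (-m) (List.reverse_perm _)

/-- The second derivative in the momentum of the first oscillator of the group is its sign. -/
lemma kineticCl_ne_zero {g : Fin u} (hg : 1 ≤ q g) : kineticCl ε g ≠ 0 := by
  intro h
  have h1 := congr_arg (fun f => pderiv (Sum.inr (⟨g, ⟨0, hg⟩⟩ : Osc q))
    (pderiv (Sum.inr (⟨g, ⟨0, hg⟩⟩ : Osc q)) f)) h
  have h2 : ∀ v : Osc q ⊕ Osc q, ∀ c : ℂ, ∀ i : Osc q, pderiv v (C c * X (Sum.inr i) ^ 2) =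
      if Sum.inr i = v then C (2 * c) * X (Sum.inr i) else 0 := by
    intro v c i
    rw [pderiv_C_mul, pderiv_pow]
    by_cases hv : Sum.inr i = v
    · subst hv
      rw [if_pos rfl, pderiv_X_self, C_mul]
      have : (2 : PhasePoly (Osc q)) = C 2 := rfl
      push_cast
      rw [this]
      ring
    · rw [if_neg hv, pderiv_X_of_ne hv]
      ring
  simp only [kineticCl, map_sum, h2, map_zero] at h1
  rw [Finset.sum_eq_single ⟨0, hg⟩] at h1
  · rw [if_pos rfl, pderiv_C_mul, pderiv_X_self, mul_one, C_eq_zero] at h1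
    have := sign_mul_self (ε ⟨g, ⟨0, hg⟩⟩)
    have h3 : ((ε ⟨g, ⟨0, hg⟩⟩ : ℤ) : ℂ) = 0 := by linear_combination h1
    rw [h3] at this
    simp at this
  · intro i _ hi
    rw [if_neg, map_zero]
    simpa using hi
  · simp

theorem exists_symbol_imROp (hq : ∀ g, 1 ≤ q g) {m : Fin u → ℤ} (hm : m ≠ 0) :
    ∃ f, IsSymbol (imROp ε m) f ∧ ∀ g, shearField ε g (mainPart f) =
      -2 * C ((m g : ℤ) : ℂ) * ∏ g, (-kineticCl ε g) ^ (m g).natAbs := by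
  obtain ⟨f, B, hf, hB⟩ := hasLeading_rOp ε m
  obtain ⟨f', B', hf', hB'⟩ := hasLeading_rStarOp ε m
  set A := ∏ g, (-kineticCl ε g) ^ (m g).natAbs
  set N := ∑ g, 2 * ((m g).natAbs : ℤ)
  have hA : A ≠ 0 := Finset.prod_ne_zero_iff.mpr fun g _ =>
    pow_ne_zero _ (neg_ne_zero.mpr (kineticCl_ne_zero ε (hq g)))
  have hsh : ∀ g, shearField ε g (C (1 / 2) * (B - B')) = -2 * C ((m g : ℤ) : ℂ) * A := by
    intro g
    have h2 : (C (1 / 2) * 2 : PhasePoly (Osc q)) = 1 := by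
      have h : (2 : PhasePoly (Osc q)) = C 2 := rfl
      rw [h, ← C_mul]
      norm_num
    rw [C_mul', Derivation.map_smul, map_sub, hB.shear, hB'.shear, smul_eq_C_mul, Pi.neg_apply,
      Int.cast_neg, C_neg]
    linear_combination (-2 * C ((m g : ℤ) : ℂ) * A) * h2
  have hmain : mainPart ((1 / (2 * Complex.I)) • (f - f')) = C (1 / 2) * (B - B') := by
    refine mainPart_eq (M := N - 1) ?_ ?_ ?_
    · exact C_mul_mem_momentumDegreeIn _ (sub_mem hB.next hB'.next)
    -- If the candidate main part were zero, its shear derivatives -2 m_g A would be zero for every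
    -- g, which forces m = 0.
    · intro h0
      refine hm (funext fun g => ?_)
      have h := hsh g
      rw [h0, map_zero] at h
      have h2 : (C ((m g : ℤ) : ℂ) : PhasePoly (Osc q)) = 0 := by
        refine (mul_eq_zero.mp h.symm).resolve_right hA |> mul_eq_zero.mp |>.resolve_left ?_
        exact neg_ne_zero.mpr two_ne_zero
      rw [C_eq_zero] at h2
      exact_mod_cast h2
    · have h := C_mul_mem_momentumDegreeIn (1 / (2 * Complex.I)) (sub_mem hB.rest hB'.rest)
      rw [show N - 2 = N - 1 - 1 by ring] at h
      convert h using 1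
      have hI : (C (1 / (2 * Complex.I)) * C Complex.I : PhasePoly (Osc q)) = C (1 / 2) := by
        rw [← C_mul]
        congr 1
        field_simp
      rw [← hI, smul_eq_C_mul]
      ring
  refine ⟨(1 / (2 * Complex.I)) • (f - f'), isSymbol_of_eq_quantize ?_, fun g => ?_⟩
  · rw [imROp, hf, hf', map_smul, map_sub]
  · rw [hmain, hsh]

end Leading

/-! ### The classical momenta -/

section MomentumCl

variable {ι : Type}

lemma wCl_eq (ε : ι → ℤˣ) (i : ι) : wCl ε i = C (1 / (Real.sqrt 2 : ℂ)) *
    (X (Sum.inl i) + C Complex.I * C ((ε i : ℤ) : ℂ) * X (Sum.inr i)) := by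
  rcases Int.units_eq_one_or (ε i) with h | h
  · simp [wCl, zCl, h]
  · simp [wCl, zBarCl, h, sub_eq_add_neg]

lemma wBarCl_eq (ε : ι → ℤˣ) (i : ι) : wBarCl ε i = C (1 / (Real.sqrt 2 : ℂ)) *
    (X (Sum.inl i) - C Complex.I * C ((ε i : ℤ) : ℂ) * X (Sum.inr i)) := by
  rcases Int.units_eq_one_or (ε i) with h | h
  · simp [wBarCl, zBarCl, h]
  · simp [wBarCl, zCl, h]

lemma C_I_mul_C_I : (C Complex.I * C Complex.I : PhasePoly ι) = -1 := by
  rw [← C_mul, Complex.I_mul_I]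
  simp

lemma C_sqrt_mul_C_sqrt :
    (2 * (C (1 / (Real.sqrt 2 : ℂ)) * C (1 / (Real.sqrt 2 : ℂ))) : PhasePoly ι) = 1 := by
  have h : (2 : PhasePoly ι) = C 2 := rfl
  rw [← C_mul, one_div_sqrt_two_mul_self, h, ← C_mul]
  norm_num

lemma C_sign_mul_C_sign (e : ℤˣ) :
    (C ((e : ℤ) : ℂ) * C ((e : ℤ) : ℂ) : PhasePoly ι) = 1 := by
  rw [← C_mul, sign_mul_self, C_1]

/-- Up to signs this is an angular momentum: a bilinear form of degree one in the momenta, so that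
the main parts below can be read off. -/
lemma momentumCl_eq (ε : ι → ℤˣ) (i j : ι) : momentumCl ε i j =
    C ((ε j : ℤ) : ℂ) * (X (Sum.inl i) * X (Sum.inr j)) -
      C ((ε i : ℤ) : ℂ) * (X (Sum.inl j) * X (Sum.inr i)) := by
  rw [momentumCl, wCl_eq, wCl_eq, wBarCl_eq, wBarCl_eq]
  have h1 := C_I_mul_C_I (ι := ι)
  have h2 := C_sqrt_mul_C_sqrt (ι := ι)
  set J : PhasePoly ι := C Complex.I
  set c : PhasePoly ι := C (1 / (Real.sqrt 2 : ℂ))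
  set ei : PhasePoly ι := C ((ε i : ℤ) : ℂ)
  set ej : PhasePoly ι := C ((ε j : ℤ) : ℂ)
  linear_combination (2 * c * c * (ei * X (Sum.inr i) * X (Sum.inl j) -
      ej * X (Sum.inl i) * X (Sum.inr j))) * h1 - (ei * X (Sum.inr i) * X (Sum.inl j) -
      ej * X (Sum.inl i) * X (Sum.inr j)) * h2

lemma momentumCl_mem (ε : ι → ℤˣ) (i j : ι) : momentumCl ε i j ∈ momentumHomogeneous 1 := by
  rw [momentumCl_eq]
  exact sub_mem
    (C_mul_mem_momentumDegreeIn _ (mul_mem_momentumHomogeneous (zero_add 1)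
      (position_mem_momentumHomogeneous _) (momentum_mem_momentumHomogeneous _)))
    (C_mul_mem_momentumDegreeIn _ (mul_mem_momentumHomogeneous (zero_add 1)
      (position_mem_momentumHomogeneous _) (momentum_mem_momentumHomogeneous _)))

/-- The terms of lower order of the symbol of the product of `momentumOp ε i j` and an operator. -/
def momentumRemainder (ε : ι → ℤˣ) (i j : ι) (f : PhasePoly ι) : PhasePoly ι :=
  C Complex.I * (C ((ε i : ℤ) : ℂ) * (X (Sum.inl j) * pderiv (Sum.inl i) f)
    - C ((ε j : ℤ) : ℂ) * (X (Sum.inl i) * pderiv (Sum.inl j) f))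

lemma momentumRemainder_mem (ε : ι → ℤˣ) (i j : ι) {f : PhasePoly ι} {N : ℤ}
    (hf : f ∈ momentumDegreeLE N) : momentumRemainder ε i j f ∈ momentumDegreeLE N := by
  have hx : ∀ i, (X (Sum.inl i) : PhasePoly ι) ∈ momentumDegreeLE 0 := fun i =>
    momentumDegreeLE_of_homogeneous le_rfl (position_mem_momentumHomogeneous i)
  exact C_mul_mem_momentumDegreeIn _ (sub_mem
    (C_mul_mem_momentumDegreeIn _ (mul_mem_momentumDegreeLE (zero_add N).le (hx _)
      (pderiv_position_mem _ hf)))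
    (C_mul_mem_momentumDegreeIn _ (mul_mem_momentumDegreeLE (zero_add N).le (hx _)
      (pderiv_position_mem _ hf))))

variable [Fintype ι] [DecidableEq ι]

lemma momentumOp_mul_quantize (ε : ι → ℤˣ) {i j : ι} (hij : i ≠ j) (f : PhasePoly ι) :
    momentumOp ε i j * quantize f =
      quantize (momentumCl ε i j * f + momentumRemainder ε i j f) := by
  rw [momentumOp, wStarOp_eq_wOp_neg, wStarOp_eq_wOp_neg, smul_mul_assoc, sub_mul, mul_assoc,
    mul_assoc, wOp_mul_quantize, wOp_mul_quantize, wOp_mul_quantize, wOp_mul_quantize,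
    ← map_sub, ← map_smul]
  congr 1
  rw [momentumCl_eq, momentumRemainder]
  have h1 := C_I_mul_C_I (ι := ι)
  have h2 := C_sqrt_mul_C_sqrt (ι := ι)
  have hX : ∀ v w : ι ⊕ ι, v ≠ w → pderiv w (X v : PhasePoly ι) = 0 :=
    fun v w h => pderiv_X_of_ne h
  have hi : (Sum.inl i : ι ⊕ ι) ≠ Sum.inl j := by simpa using hij
  simp only [wSymbol, map_add, pderiv_mul, pderiv_C, C_mul, smul_eq_C_mul, hX _ _ hi,
    hX _ _ hi.symm, hX (Sum.inr j) (Sum.inl i) (by simp), hX (Sum.inr i) (Sum.inl j) (by simp),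
    Pi.neg_apply, Units.val_neg, Int.cast_neg, map_neg, neg_zero]
  -- The second derivatives of f occur with opposite signs in the two products and cancel once the
  -- mixed derivatives are identified.
  have hcomm : pderiv (Sum.inl i) (pderiv (Sum.inl j) f) =
      pderiv (Sum.inl j) (pderiv (Sum.inl i) f) := by
    ext d
    simp only [coeff_pderiv, Finsupp.add_apply, Finsupp.single_apply, hi, hi.symm, if_false,
      add_zero, add_right_comm d (Finsupp.single (Sum.inl i) 1)]
    ring
  rw [hcomm]
  set J : PhasePoly ι := C Complex.I
  set c : PhasePoly ι := C (1 / (Real.sqrt 2 : ℂ))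
  set ei : PhasePoly ι := C ((ε i : ℤ) : ℂ)
  set ej : PhasePoly ι := C ((ε j : ℤ) : ℂ)
  set fi := pderiv (Sum.inl i) f
  set fj := pderiv (Sum.inl j) f
  linear_combination (2 * c * c * (ei * X (Sum.inr i) * X (Sum.inl j) -
      ej * X (Sum.inl i) * X (Sum.inr j)) * f) * h1 - (ei * X (Sum.inr i) * X (Sum.inl j) -
      ej * X (Sum.inl i) * X (Sum.inr j)) * f * h2
      + J * (ei * X (Sum.inl j) * fi - ej * X (Sum.inl i) * fj) * h2

end MomentumCl

/-! ### The symbols of the quadratic operators and of the momentum operators -/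

lemma eq_sum_monomial_of_support {σ κ R : Type*} [CommSemiring R] [Fintype κ]
    {e : κ → σ →₀ ℕ} (he : Function.Injective e) {f : MvPolynomial σ R}
    (h : ∀ d ∈ f.support, ∃ a, d = e a) : f = ∑ a, monomial (e a) (f.coeff (e a)) := by
  classical
  ext d
  rw [coeff_sum]
  simp only [coeff_monomial]
  by_cases hd : ∃ a, d = e a
  · obtain ⟨a, rfl⟩ := hd
    simp [he.eq_iff]
  · rw [Finset.sum_eq_zero fun a _ => if_neg fun h => hd ⟨a, h.symm⟩]
    by_contra hne
    exact hd (h d (mem_support_iff.mpr hne))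

lemma exists_eq_single_of_degree_eq_one {σ : Type*} [Fintype σ] {d : σ →₀ ℕ}
    (h : d.degree = 1) : ∃ a, d = Finsupp.single a 1 := by
  classical
  have h0 : d ≠ 0 := by
    rintro rfl
    simp at h
  obtain ⟨a, ha⟩ := Finsupp.ne_iff.mp h0
  rw [Finsupp.coe_zero, Pi.zero_apply] at ha
  rw [Finsupp.degree_eq_sum, ← Finset.add_sum_erase _ _ (Finset.mem_univ a)] at h
  have hz : ∑ b ∈ Finset.univ.erase a, d b = 0 := by omega
  refine ⟨a, Finsupp.ext fun b => ?_⟩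
  by_cases hb : a = b
  · subst hb
    rw [Finsupp.single_eq_same]
    omega
  · rw [Finsupp.single_eq_of_ne (Ne.symm hb)]
    exact Finset.sum_eq_zero_iff.mp hz b (by simp [Ne.symm hb])

/-- Explicit coefficients for the two admissible shapes. The vanishing of the other coefficients
makes `polyOp` reduce to one of its sums. -/
lemma IsLinearOrSquares.cases {σ : Type} [Fintype σ] {f : MvPolynomial σ ℝ}
    (h : IsLinearOrSquares f) :
    (f.coeff 0 = 0 ∧ (∀ a, f.coeff (Finsupp.single a 2) = 0) ∧
      f = ∑ a, C (f.coeff (Finsupp.single a 1)) * X a) ∨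
    (f.coeff 0 = 0 ∧ (∀ a, f.coeff (Finsupp.single a 1) = 0) ∧
      f = ∑ a, C (f.coeff (Finsupp.single a 2)) * X a ^ 2) := by
  rcases h with h | ⟨h, h'⟩
  · refine Or.inl ⟨h.coeff_eq_zero (by simp), fun a => h.coeff_eq_zero (by simp), ?_⟩
    have h1 := eq_sum_monomial_of_support (e := fun a : σ => Finsupp.single a 1)
      (Finsupp.single_left_injective one_ne_zero) (f := f) (fun d hd => by
        have hdeg : d.degree = 1 := by
          by_contra hne
          exact (mem_support_iff.mp hd) (h.coeff_eq_zero hne)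
        exact exists_eq_single_of_degree_eq_one hdeg)
    simpa only [← C_mul_X_eq_monomial] using h1
  · refine Or.inr ⟨h.coeff_eq_zero (by simp), fun a => h.coeff_eq_zero (by simp), ?_⟩
    have h1 := eq_sum_monomial_of_support (e := fun a : σ => Finsupp.single a 2)
      (Finsupp.single_left_injective two_ne_zero) h'
    simpa only [C_mul_X_pow_eq_monomial] using h1

section Symbols

variable {u : ℕ} {q : Fin u → ℕ} (ε : Osc q → ℤˣ)

lemma quantize_momentumCl {i j : Osc q} (hij : i ≠ j) :
    momentumOp ε i j = quantize (momentumCl ε i j) := by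
  have h := momentumOp_mul_quantize ε hij 1
  rw [quantize_one, mul_one, mul_one] at h
  simpa [momentumRemainder] using h

lemma quantize_momentumCl_sq {i j : Osc q} (hij : i ≠ j) : momentumOp ε i j ^ 2 =
    quantize (momentumCl ε i j ^ 2 + momentumRemainder ε i j (momentumCl ε i j)) := by
  rw [pow_two, pow_two]
  nth_rw 2 [quantize_momentumCl ε hij]
  exact momentumOp_mul_quantize ε hij _

/-- The inclusion of the functions on the phase space of a group. -/
def groupInclusion (g : Fin u) : PhasePoly (Fin (q g)) →ₐ[ℂ] PhasePoly (Osc q) :=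
  rename (Sum.map (fun i => (⟨g, i⟩ : Osc q)) (fun i => (⟨g, i⟩ : Osc q)))

lemma groupInclusion_momentumCl (g : Fin u) (i j : Fin (q g)) :
    groupInclusion g (momentumCl (fun i => ε ⟨g, i⟩) i j) = momentumCl ε ⟨g, i⟩ ⟨g, j⟩ := by
  simp [groupInclusion, momentumCl_eq]

lemma groupInclusion_substMomenta (g : Fin u) (f : MvPolynomial (Pair (q g)) ℝ) :
    groupInclusion g (substMomenta (fun i => ε ⟨g, i⟩) f) =
      aeval (fun a : Pair (q g) => momentumCl ε (⟨g, a.1.1⟩ : Osc q) ⟨g, a.1.2⟩) f := by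
  induction f using MvPolynomial.induction_on with
  | C a => simp [substMomenta, groupInclusion, MvPolynomial.algebraMap_eq,
      MvPolynomial.algebraMap_apply]
  | add p r hp hr => simp only [substMomenta, map_add] at *; rw [hp, hr]
  | mul_X p i hp =>
    simp only [substMomenta, map_mul, aeval_X] at *
    rw [hp, groupInclusion_momentumCl]

lemma groupInclusion_injective (g : Fin u) :
    Function.Injective (groupInclusion g : PhasePoly (Fin (q g)) →ₐ[ℂ] PhasePoly (Osc q)) :=
  rename_injective _ (Sum.map_injective.mpr
    ⟨sigma_mk_injective (β := fun g => Fin (q g)), sigma_mk_injective (β := fun g => Fin (q g))⟩)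

lemma pair_ne {g : Fin u} (a : Pair (q g)) : (⟨g, a.1.1⟩ : Osc q) ≠ ⟨g, a.1.2⟩ := by
  intro h
  exact a.2.ne (sigma_mk_injective (β := fun g => Fin (q g)) h)

/-- Linear combinations are their own symbols. For squares, reordering adds only terms of order one,
which do not affect the main part of order two, provided that it does not vanish. -/
theorem exists_symbol_polyOp (g : Fin u) {f : MvPolynomial (Pair (q g)) ℝ}
    (hf : IsLinearOrSquares f) (h0 : substMomenta (fun i => ε ⟨g, i⟩) f ≠ 0) :
    ∃ F, IsSymbol (polyOp ε g f) F ∧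
      mainPart F = groupInclusion g (substMomenta (fun i => ε ⟨g, i⟩) f) := by
  have hT0 : groupInclusion g (substMomenta (fun i => ε ⟨g, i⟩) f) ≠ 0 := by
    rw [Ne, map_eq_zero_iff _ (groupInclusion_injective g)]
    exact h0
  rw [groupInclusion_substMomenta] at hT0 ⊢
  set P : Pair (q g) → PhasePoly (Osc q) := fun a => momentumCl ε ⟨g, a.1.1⟩ ⟨g, a.1.2⟩ with hP
  rcases hf.cases with ⟨hc, hs, he⟩ | ⟨hc, hs, he⟩
  · have he' : aeval P f = ∑ a, C ((f.coeff (Finsupp.single a 1) : ℝ) : ℂ) * P a := by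
      conv_lhs => rw [he]
      simp [MvPolynomial.algebraMap_apply]
    rw [he'] at hT0 ⊢
    refine ⟨∑ a, C ((f.coeff (Finsupp.single a 1) : ℝ) : ℂ) * P a,
      isSymbol_of_eq_quantize ?_, mainPart_eq (M := 1) ?_ hT0
      (by simp)⟩
    · simp only [polyOp, hc, hs, Complex.ofReal_zero, zero_smul, Finset.sum_const_zero, zero_add,
        add_zero, map_sum]
      refine Finset.sum_congr rfl fun a _ => ?_
      rw [C_mul', map_smul, hP, quantize_momentumCl ε (pair_ne a)]
    · exact sum_mem fun a _ => C_mul_mem_momentumDegreeIn _ (momentumCl_mem _ _ _)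
  · have he' : aeval P f = ∑ a, C ((f.coeff (Finsupp.single a 2) : ℝ) : ℂ) * P a ^ 2 := by
      conv_lhs => rw [he]
      simp [MvPolynomial.algebraMap_apply]
    rw [he'] at hT0 ⊢
    refine ⟨∑ a, C ((f.coeff (Finsupp.single a 2) : ℝ) : ℂ) * (P a ^ 2 +
      momentumRemainder ε (⟨g, a.1.1⟩ : Osc q) ⟨g, a.1.2⟩ (P a)),
      isSymbol_of_eq_quantize ?_, mainPart_eq (M := 2) ?_ hT0 ?_⟩
    · simp only [polyOp, hc, hs, Complex.ofReal_zero, zero_smul, Finset.sum_const_zero, zero_add,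
        add_zero, map_sum]
      refine Finset.sum_congr rfl fun a _ => ?_
      rw [C_mul', map_smul, hP, quantize_momentumCl_sq ε (pair_ne a)]
    · refine sum_mem fun a _ => C_mul_mem_momentumDegreeIn _ ?_
      rw [pow_two]
      exact mul_mem_momentumHomogeneous one_add_one_eq_two (momentumCl_mem _ _ _)
        (momentumCl_mem _ _ _)
    · rw [← Finset.sum_sub_distrib]
      refine sum_mem fun a _ => ?_
      rw [← mul_sub, add_sub_cancel_left]
      exact C_mul_mem_momentumDegreeIn _ (momentumRemainder_mem _ _ _
        (momentumDegreeLE_of_homogeneous (by norm_num) (momentumCl_mem _ _ _)))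

lemma squeezeField_sum_kineticCl (r : Fin u → ℂ) (g : Fin u) :
    squeezeField g (∑ g', C (r g') * kineticCl ε g') = -2 * C (r g) * kineticCl ε g := by
  rw [map_sum, Finset.sum_eq_single g]
  · rw [C_mul', Derivation.map_smul, squeezeField_kineticCl, if_pos rfl, smul_eq_C_mul]
    ring
  · intro g' _ hg
    rw [C_mul', Derivation.map_smul, squeezeField_kineticCl, if_neg hg, smul_zero]
  · simp

theorem exists_symbol_jOp (hq : ∀ g, 1 ≤ q g) {r : Fin u → ℤ} (hr : r ≠ 0) :
    ∃ F, IsSymbol (jOp ε r) F ∧ mainPart F = ∑ g, C ((r g : ℤ) : ℂ) * kineticCl ε g := by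
  have h1 : ∀ i : Osc q, iOp i = quantize (C (1 / 2) * (X (Sum.inl i) ^ 2 + X (Sum.inr i) ^ 2)) :=
    by
    intro i
    have hx : xOp i ^ 2 = quantize (X (Sum.inl i) ^ 2) := by
      rw [pow_two, pow_two, quantize_mul_position, ← one_mul (X (Sum.inl i)),
        quantize_mul_position, quantize_one, mul_one]
    have hp : pOp i ^ 2 = quantize (X (Sum.inr i) ^ 2) := by
      rw [pow_two, pow_two, quantize_mul_momentum, ← one_mul (X (Sum.inr i)),
        quantize_mul_momentum, quantize_one, one_mul]
    rw [iOp, C_mul', map_smul, map_add, hx, hp]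
  refine ⟨∑ g, C ((r g : ℤ) : ℂ) * ∑ i : Fin (q g), C ((ε ⟨g, i⟩ : ℤ) : ℂ) *
    (C (1 / 2) * (X (Sum.inl (⟨g, i⟩ : Osc q)) ^ 2 + X (Sum.inr (⟨g, i⟩ : Osc q)) ^ 2)),
    isSymbol_of_eq_quantize ?_, mainPart_eq (M := 2) ?_ ?_ ?_⟩
  · simp only [jOp, kOp, map_sum, C_mul', map_smul, h1]
  · exact sum_mem fun g _ => C_mul_mem_momentumDegreeIn _ (kineticCl_mem ε g)
  · intro h0
    refine hr (funext fun g => ?_)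
    have h := squeezeField_sum_kineticCl ε (fun g => ((r g : ℤ) : ℂ)) g
    rw [h0, map_zero] at h
    have h2 : (C ((r g : ℤ) : ℂ) : PhasePoly (Osc q)) = 0 :=
      ((mul_eq_zero.mp ((mul_eq_zero.mp h.symm).resolve_right
        (kineticCl_ne_zero ε (hq g))))).resolve_left (neg_ne_zero.mpr two_ne_zero)
    rw [C_eq_zero] at h2
    exact_mod_cast h2
  · rw [← Finset.sum_sub_distrib]
    refine sum_mem fun g _ => ?_
    rw [← mul_sub, kineticCl, ← Finset.sum_sub_distrib]
    refine C_mul_mem_momentumDegreeIn _ (sum_mem fun i _ => ?_)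
    have h3 : C ((ε ⟨g, i⟩ : ℤ) : ℂ) * (C (1 / 2) * (X (Sum.inl (⟨g, i⟩ : Osc q)) ^ 2 +
        X (Sum.inr (⟨g, i⟩ : Osc q)) ^ 2)) - C (1 / 2 * ((ε ⟨g, i⟩ : ℤ) : ℂ)) *
        X (Sum.inr (⟨g, i⟩ : Osc q)) ^ 2 =
        C (1 / 2 * ((ε ⟨g, i⟩ : ℤ) : ℂ)) * (X (Sum.inl (⟨g, i⟩ : Osc q)) *
          X (Sum.inl (⟨g, i⟩ : Osc q))) := by
      rw [C_mul]
      ring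
    rw [h3]
    exact C_mul_mem_momentumDegreeIn _ (momentumDegreeLE_of_homogeneous (by norm_num)
      (mul_mem_momentumHomogeneous (zero_add 0) (position_mem_momentumHomogeneous _)
        (position_mem_momentumHomogeneous _)))

lemma derivation_aeval_eq_zero {R σ τ : Type*} [CommRing R] [Algebra R ℂ]
    (D : Derivation ℂ (MvPolynomial τ ℂ) (MvPolynomial τ ℂ)) {P : σ → MvPolynomial τ ℂ}
    (h : ∀ a, D (P a) = 0) (f : MvPolynomial σ R) : D (aeval P f) = 0 := by
  induction f using MvPolynomial.induction_on with
  | C a => simp [MvPolynomial.algebraMap_apply, derivation_C]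
  | add p r hp hr => rw [map_add, map_add, hp, hr, add_zero]
  | mul_X p i hp => rw [map_mul, aeval_X, Derivation.leibniz, hp, h, smul_zero, smul_zero, add_zero]

/-- A derivation that kills the momenta kills every polynomial in them. On P_ij the two terms ε_i
ε_j p_i p_j cancel. -/
lemma shearField_substMomenta (g g' : Fin u) (f : MvPolynomial (Pair (q g')) ℝ) :
    shearField ε g (groupInclusion g' (substMomenta (fun i => ε ⟨g', i⟩) f)) = 0 := by
  rw [groupInclusion_substMomenta]
  refine derivation_aeval_eq_zero _ (fun a => ?_) f
  have h1 := C_sign_mul_C_sign (ι := Osc q) (ε ⟨g', a.1.1⟩)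
  simp only [momentumCl_eq, shearField, map_sub, Derivation.leibniz, derivation_C, mkDerivation_X,
    Sum.elim_inl, Sum.elim_inr, smul_eq_mul, Pi.zero_apply]
  split_ifs <;> ring

/-- Each monomial x_i p_j with both oscillators in one group has weight 1 - 1 = 0 under the squeeze.
-/
lemma squeezeField_substMomenta (g g' : Fin u) (f : MvPolynomial (Pair (q g')) ℝ) :
    squeezeField g (groupInclusion g' (substMomenta (fun i => ε ⟨g', i⟩) f)) = 0 := by
  rw [groupInclusion_substMomenta]
  refine derivation_aeval_eq_zero _ (fun a => ?_) f
  simp only [momentumCl_eq, squeezeField, map_sub, Derivation.leibniz, derivation_C,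
    mkDerivation_X, Sum.elim_inl, Sum.elim_inr, smul_eq_mul]
  split_ifs <;> ring

end Symbols

open TensorProduct

/-! ### Functional independence -/

/-- An open set contains a product of infinite sets of real numbers, and a complex polynomial that
vanishes on such a product is zero. -/
lemma dense_eval_ne_zero {σ : Type*} [Fintype σ] {p : MvPolynomial σ ℂ} (hp : p ≠ 0) :
    Dense {y : σ → ℝ | eval (fun t => (y t : ℂ)) p ≠ 0} := by
  rw [dense_iff_inter_open]
  rintro U hU ⟨x, hx⟩
  obtain ⟨V, hV, hVU⟩ := isOpen_pi_iff'.mp hU x hx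
  by_contra hne
  refine hp (funext_set (fun t => ((↑) : ℝ → ℂ) '' V t) (fun t =>
    (infinite_of_mem_nhds (x t) ((hV t).1.mem_nhds (hV t).2)).image
      Complex.ofReal_injective.injOn) fun y hy => ?_)
  choose w hw hwy using fun t => hy t trivial
  obtain rfl : (fun t => (w t : ℂ)) = y := _root_.funext hwy
  rw [map_zero]
  by_contra h0
  exact hne ⟨w, hVU fun t _ => hw t, h0⟩

lemma isOpen_eval_ne_zero {σ : Type*} [Finite σ] (p : MvPolynomial σ ℂ) :
    IsOpen {y : σ → ℝ | eval (fun t => (y t : ℂ)) p ≠ 0} := by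
  refine isOpen_ne_fun ?_ continuous_const
  have h := MvPolynomial.continuous_eval p
  exact h.comp (continuous_pi fun t => Complex.continuous_ofReal.comp (continuous_apply t))

lemma FunctionallyIndependent.comp {ι α β : Type} {f : α → PhasePoly ι}
    (h : FunctionallyIndependent f) {e : β → α} (he : Function.Injective e) :
    FunctionallyIndependent (f ∘ e) := by
  obtain ⟨U, hU, hd, hy⟩ := h
  exact ⟨U, hU, hd, fun y hyU => (hy y hyU).comp e he⟩

lemma FunctionallyIndependent.ne_zero {ι α : Type} {f : α → PhasePoly ι}
    (h : FunctionallyIndependent f) (a : α) : f a ≠ 0 := by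
  obtain ⟨U, -, hd, hy⟩ := h
  obtain ⟨y, hyU⟩ := hd.nonempty
  intro h0
  refine (hy y hyU).ne_zero a (funext fun v => ?_)
  simp [h0]

lemma QuasiIndependent.comp {ι α β : Type} [Fintype ι] [DecidableEq ι] {F : α → Op ι}
    (h : QuasiIndependent F) {e : β → α} (he : Function.Injective e) :
    QuasiIndependent (F ∘ e) := by
  obtain ⟨f, hf, hi⟩ := h
  exact ⟨f ∘ e, fun b => hf (e b), hi.comp he⟩

/-- A linear relation between differentials at a point survives contraction with any vector field.
The independence proofs rest on choosing fields that isolate a few coefficients. -/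
lemma sum_eval_mkDerivation {σ α : Type*} [Fintype σ] [Fintype α] {f : α → MvPolynomial σ ℂ}
    {c : α → ℂ} {y : σ → ℂ} (h : ∀ v, ∑ a, c a * eval y (pderiv v (f a)) = 0)
    (V : σ → MvPolynomial σ ℂ) : ∑ a, c a * eval y (mkDerivation ℂ V (f a)) = 0 := by
  simp only [mkDerivation_eq_sum, map_sum, map_mul, Finset.mul_sum]
  rw [Finset.sum_comm]
  refine Finset.sum_eq_zero fun v _ => ?_
  rw [← mul_zero (eval y (V v)), ← h v, Finset.mul_sum]
  exact Finset.sum_congr rfl fun a _ => by ring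

/-- Base change from ℤ to ℂ, which preserves linear independence by flatness. -/
lemma linearIndependent_intCast {α : Type} {u : ℕ} {m : α → Fin u → ℤ}
    (h : LinearIndependent ℤ m) :
    LinearIndependent ℂ (fun a g => ((m a g : ℤ) : ℂ)) := by
  have h1 := Module.Flat.linearIndependent_one_tmul (S := ℂ) h
  have h2 := h1.map' (TensorProduct.piScalarRight ℤ ℂ ℂ (Fin u)).toLinearMap
    (LinearEquiv.ker _)
  have h3 : (fun a g => ((m a g : ℤ) : ℂ)) = (TensorProduct.piScalarRight ℤ ℂ ℂ
      (Fin u)).toLinearMap ∘ fun a => (1 : ℂ) ⊗ₜ[ℤ] m a := by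
    funext a g
    simp
  rw [h3]
  exact h2

section Independence

variable {u : ℕ} {q : Fin u → ℕ} (ε : Osc q → ℤˣ)

/-- The projection to the phase space of a group. -/
def groupProjection (g : Fin u) (y : Osc q ⊕ Osc q → ℝ) : Fin (q g) ⊕ Fin (q g) → ℝ :=
  fun t => y (Sum.map (fun i => (⟨g, i⟩ : Osc q)) (fun i => (⟨g, i⟩ : Osc q)) t)

lemma groupMap_injective (g : Fin u) : Function.Injective
    (Sum.map (fun i => (⟨g, i⟩ : Osc q)) (fun i => (⟨g, i⟩ : Osc q))) :=
  Sum.map_injective.mpr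
    ⟨sigma_mk_injective (β := fun g => Fin (q g)), sigma_mk_injective (β := fun g => Fin (q g))⟩

lemma continuous_groupProjection (g : Fin u) :
    Continuous (groupProjection g : (Osc q ⊕ Osc q → ℝ) → _) :=
  continuous_pi fun _ => continuous_apply _

lemma isOpenMap_groupProjection (g : Fin u) :
    IsOpenMap (groupProjection g : (Osc q ⊕ Osc q → ℝ) → _) :=
  LinearMap.isOpenMap_of_finiteDimensional
    (LinearMap.funLeft ℝ ℝ (Sum.map (fun i => (⟨g, i⟩ : Osc q)) (fun i => (⟨g, i⟩ : Osc q))))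
    (LinearMap.funLeft_surjective_of_injective _ _ _ (groupMap_injective g))

lemma eval_pderiv_groupInclusion (g : Fin u) (t : Fin (q g) ⊕ Fin (q g)) (f : PhasePoly (Fin (q g)))
    (y : Osc q ⊕ Osc q → ℝ) :
    eval (fun t => (y t : ℂ)) (pderiv
      (Sum.map (fun i => (⟨g, i⟩ : Osc q)) (fun i => (⟨g, i⟩ : Osc q)) t) (groupInclusion g f)) =
      eval (fun t => ((groupProjection g y t : ℝ) : ℂ)) (pderiv t f) := by
  rw [groupInclusion, pderiv_rename (groupMap_injective g), eval_rename]
  rfl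

lemma pderiv_groupInclusion_of_ne {g g' : Fin u} (h : g' ≠ g) (t : Fin (q g) ⊕ Fin (q g))
    (f : PhasePoly (Fin (q g'))) :
    pderiv (Sum.map (fun i => (⟨g, i⟩ : Osc q)) (fun i => (⟨g, i⟩ : Osc q)) t)
      (groupInclusion g' f) = 0 := by
  induction f using MvPolynomial.induction_on with
  | C a => simp [groupInclusion]
  | add p r hp hr => rw [map_add, map_add, hp, hr, add_zero]
  | mul_X p a hp =>
    rw [map_mul, pderiv_mul, hp, zero_mul, zero_add, groupInclusion, rename_X, pderiv_X_of_ne,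
      mul_zero]
    rcases a with a | a <;> rcases t with t | t <;> simp [h]

theorem functionallyIndependent_of_groups (hq : ∀ g, 1 ≤ q g) {α β : Type} [Fintype α] [Fintype β]
    {κ : Fin u → Type} [∀ g, Fintype (κ g)] {r : α → Fin u → ℂ} (hr : LinearIndependent ℂ r)
    {m : β → Fin u → ℂ} (hm : LinearIndependent ℂ m) (n : β → Fin u → ℕ)
    {S : β → PhasePoly (Osc q)}
    (hS : ∀ j g, shearField ε g (S j) = -2 * C (m j g) * ∏ g, (-kineticCl ε g) ^ n j g)
    {f : (g : Fin u) → κ g → PhasePoly (Fin (q g))} (hf : ∀ g, FunctionallyIndependent (f g))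
    (hshear : ∀ g g' k, shearField ε g (groupInclusion g' (f g' k)) = 0)
    (hsqueeze : ∀ g g' k, squeezeField g (groupInclusion g' (f g' k)) = 0) :
    FunctionallyIndependent (Sum.elim
      (Sum.elim (fun i => ∑ g, C (r i g) * kineticCl ε g) S)
      (fun a : (g : Fin u) × κ g => groupInclusion a.1 (f a.1 a.2))) := by
  choose U hUo hUd hU using hf
  have ho1 : ∀ g, IsOpen {y : Osc q ⊕ Osc q → ℝ | eval (fun t => (y t : ℂ)) (kineticCl ε g) ≠ 0} :=
    fun g => isOpen_eval_ne_zero _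
  have ho2 : ∀ g, IsOpen (groupProjection g ⁻¹' U g : Set (Osc q ⊕ Osc q → ℝ)) :=
    fun g => (hUo g).preimage (continuous_groupProjection g)
  refine ⟨(⋂ g, {y | eval (fun t => (y t : ℂ)) (kineticCl ε g) ≠ 0}) ∩
    ⋂ g, groupProjection g ⁻¹' U g, (isOpen_iInter_of_finite ho1).inter
      (isOpen_iInter_of_finite ho2), ?_, ?_⟩
  · refine Dense.inter_of_isOpen_left ?_ ?_ (isOpen_iInter_of_finite ho1)
    · exact dense_iInter_of_isOpen ho1 fun g => dense_eval_ne_zero (kineticCl_ne_zero ε (hq g))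
    · exact dense_iInter_of_isOpen ho2 fun g => (hUd g).preimage (isOpenMap_groupProjection g)
  rintro y ⟨hy1, hy2⟩
  rw [Set.mem_iInter] at hy1 hy2
  rw [Fintype.linearIndependent_iff]
  intro c hc
  have hc' : ∀ v, _ = (0 : ℂ) := fun v => by
    have := congr_fun hc v
    simpa only [Finset.sum_apply, Pi.smul_apply, smul_eq_mul, Pi.zero_apply] using this
  -- Contraction with the shear fields, one for each g, leaves only the resonance terms c_j m_j A_j.
  -- Independence of the vectors m gives c_j A_j(y) = 0, and A_j(y) ≠ 0 since no kinetic form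
  -- vanishes at y.
  have hb : ∀ j, c (Sum.inl (Sum.inr j)) = 0 := by
    have hA : ∀ j, eval (fun t => (y t : ℂ)) (∏ g, (-kineticCl ε g) ^ n j g) ≠ 0 := by
      intro j
      rw [map_prod]
      refine Finset.prod_ne_zero_iff.mpr fun g _ => ?_
      rw [map_pow, map_neg]
      exact pow_ne_zero _ (neg_ne_zero.mpr (hy1 g))
    have h := Fintype.linearIndependent_iff.mp hm (fun j => c (Sum.inl (Sum.inr j)) *
      eval (fun t => (y t : ℂ)) (∏ g, (-kineticCl ε g) ^ n j g)) (funext fun g => by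
        have h1 := sum_eval_mkDerivation hc' (Sum.elim
          (fun i : Osc q => if i.1 = g then C ((ε i : ℤ) : ℂ) * X (Sum.inr i) else 0) 0)
        change ∑ a, c a * eval _ (shearField ε g _) = 0 at h1
        simp only [Fintype.sum_sum_type, Sum.elim_inl, Sum.elim_inr, hshear, map_zero, mul_zero,
          Finset.sum_const_zero, add_zero, hS, map_sum, C_mul', Derivation.map_smul,
          shearField_kineticCl, smul_zero, zero_add] at h1
        simp only [Finset.sum_apply, Pi.smul_apply, smul_eq_mul, Pi.zero_apply]
        have h2 : (-2 : ℂ) ≠ 0 := by norm_num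
        refine (mul_eq_zero.mp ?_).resolve_left h2
        rw [← h1, Finset.mul_sum]
        refine Finset.sum_congr rfl fun j _ => ?_
        simp only [map_mul, map_neg, eval_C, map_ofNat]
        ring)
    exact fun j => (mul_eq_zero.mp (h j)).resolve_right (hA j)
  -- The action of the squeeze fields on the resonance symbols is unknown, but their coefficients
  -- are already zero; what remains is the sum of the c_i r_i times a nonzero value of a kinetic
  -- form.
  have ha : ∀ i, c (Sum.inl (Sum.inl i)) = 0 := by
    refine Fintype.linearIndependent_iff.mp hr (fun i => c (Sum.inl (Sum.inl i)))
      (funext fun g => ?_)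
    have h1 := sum_eval_mkDerivation hc' (Sum.elim
      (fun i : Osc q => if i.1 = g then X (Sum.inl i) else 0)
      (fun i : Osc q => if i.1 = g then -X (Sum.inr i) else 0))
    change ∑ a, c a * eval _ (squeezeField g _) = 0 at h1
    simp only [Fintype.sum_sum_type, Sum.elim_inl, Sum.elim_inr, hsqueeze, map_zero, mul_zero,
      Finset.sum_const_zero, add_zero, hb, zero_mul, squeezeField_sum_kineticCl] at h1
    simp only [Finset.sum_apply, Pi.smul_apply, smul_eq_mul, Pi.zero_apply]
    refine (mul_eq_zero.mp ?_).resolve_left (mul_ne_zero (show (-2 : ℂ) ≠ 0 by norm_num) (hy1 g))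
    rw [← h1, Finset.mul_sum]
    refine Finset.sum_congr rfl fun i _ => ?_
    simp only [map_mul, map_neg, eval_C, map_ofNat]
    ring
  -- Only momentum terms are left, and the partial derivatives in the variables of one group
  -- annihilate those of the other groups.
  have hk : ∀ g k, c (Sum.inr ⟨g, k⟩) = 0 := by
    intro g
    refine Fintype.linearIndependent_iff.mp (hU g _ (hy2 g)) (fun k => c (Sum.inr ⟨g, k⟩))
      (funext fun t => ?_)
    have h1 := hc' (Sum.map (fun i => (⟨g, i⟩ : Osc q)) (fun i => (⟨g, i⟩ : Osc q)) t)
    simp only [Fintype.sum_sum_type, Sum.elim_inl, Sum.elim_inr, ha, hb, zero_mul,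
      Finset.sum_const_zero, zero_add, Fintype.sum_sigma] at h1
    rw [Finset.sum_eq_single g] at h1
    · simpa only [Finset.sum_apply, Pi.smul_apply, smul_eq_mul, Pi.zero_apply,
        eval_pderiv_groupInclusion] using h1
    · intro g' _ hg
      refine Finset.sum_eq_zero fun k _ => ?_
      rw [pderiv_groupInclusion_of_ne hg, map_zero, mul_zero]
    · simp
  rintro ((i | j) | ⟨g, k⟩)
  exacts [ha i, hb j, hk g k]

end Independence



/-! ### Brackets of linear combinations of momenta and of squares of momenta -/

/-- The bilinear skew-symmetric biderivations. -/
structure IsBiderivation {A : Type*} [Ring A] [Module ℂ A] (br : A → A → A) : Prop where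
  add_right : ∀ a b c, br a (b + c) = br a b + br a c
  smul_right : ∀ (a : A) (t : ℂ) (b : A), br a (t • b) = t • br a b
  skew : ∀ a b, br a b = -br b a
  leibniz_right : ∀ a b c, br a (b * c) = br a b * c + b * br a c

namespace IsBiderivation

variable {A : Type*} [Ring A] [Module ℂ A] {br : A → A → A} (h : IsBiderivation br)

include h

lemma smul_left (t : ℂ) (a b : A) : br (t • a) b = t • br a b := by
  rw [h.skew, h.smul_right, h.skew a, smul_neg]

lemma sub_right (a b c : A) : br a (b - c) = br a b - br a c := by
  have h1 := h.add_right a (b - c) c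
  rw [sub_add_cancel] at h1
  rw [h1, add_sub_cancel_right]

lemma sub_left (a b c : A) : br (a - b) c = br a c - br b c := by
  rw [h.skew, h.sub_right, h.skew a, h.skew b]
  abel

lemma zero_right (a : A) : br a 0 = 0 := by
  simpa using h.sub_right a 0 0

lemma sum_right {κ : Type*} (s : Finset κ) (a : A) (f : κ → A) :
    br a (∑ k ∈ s, f k) = ∑ k ∈ s, br a (f k) := by
  classical
  induction s using Finset.induction_on with
  | empty => simp [h.zero_right]
  | insert k s hk ih => rw [Finset.sum_insert hk, Finset.sum_insert hk, h.add_right, ih]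

lemma sum_left {κ : Type*} (s : Finset κ) (f : κ → A) (a : A) :
    br (∑ k ∈ s, f k) a = ∑ k ∈ s, br (f k) a := by
  rw [h.skew, h.sum_right, ← Finset.sum_neg_distrib]
  exact Finset.sum_congr rfl fun k _ => (h.skew _ _).symm

lemma leibniz_left (a b c : A) : br (a * b) c = br a c * b + a * br b c := by
  rw [h.skew, h.leibniz_right, h.skew a, h.skew b]
  noncomm_ring

end IsBiderivation

/-- The indicator of `i = j`. -/
def kronecker {q : ℕ} (i j : Fin q) : ℂ := if i = j then 1 else 0

/-- The commutation relations of the momenta, with respect to a bracket. -/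
structure IsMomentumAlgebra {A : Type*} [Ring A] [Module ℂ A] {q : ℕ} (ε : Fin q → ℤˣ)
    (br : A → A → A) (P : Fin q → Fin q → A) (κ : ℂ) : Prop extends IsBiderivation br where
  anti : ∀ i j, P j i = -P i j
  rel : ∀ i j k l, br (P i j) (P k l) = κ • (
    -((((ε j : ℤ) : ℂ) * kronecker j k) • P i l) + (((ε i : ℤ) : ℂ) * kronecker i l) • P k j
    + (((ε j : ℤ) : ℂ) * kronecker j l) • P i k + (((ε i : ℤ) : ℂ) * kronecker i k) • P j l)

/-- Only the canonical relations with scalar brackets enter. The bracket of two products w w^* is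
again a combination of such products in the same order, so no ordering corrections arise and one
computation serves both algebras. -/
lemma IsBiderivation.isMomentumAlgebra {A : Type*} [Ring A] [Module ℂ A] [IsScalarTower ℂ A A]
    [SMulCommClass ℂ A A] {br : A → A → A}
    (h : IsBiderivation br) {q : ℕ} {ε : Fin q → ℤˣ} {w ws : Fin q → A} {κ : ℂ}
    (h1 : ∀ i j, br (w i) (w j) = 0) (h2 : ∀ i j, br (ws i) (ws j) = 0)
    (h3 : ∀ i j, br (w i) (ws j) = (κ * (((ε i : ℤ) : ℂ) * kronecker i j)) • (1 : A)) :
    IsMomentumAlgebra ε br (fun i j => Complex.I • (w i * ws j - w j * ws i))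
      (Complex.I * κ) where
  toIsBiderivation := h
  anti i j := by rw [← smul_neg, neg_sub]
  rel i j k l := by
    have h4 : ∀ i j, br (ws j) (w i) = -((κ * (((ε i : ℤ) : ℂ) * kronecker i j)) • (1 : A)) :=
      fun i j => by rw [h.skew, h3]
    have h5 : ∀ i j k l, br (w i * ws j) (w k * ws l) =
        κ • (-((((ε k : ℤ) : ℂ) * kronecker k j) • (w i * ws l)) +
          (((ε i : ℤ) : ℂ) * kronecker i l) • (w k * ws j)) := by
      intro i j k l
      simp only [h.leibniz_left, h.leibniz_right, h1, h2, h3, h4, mul_neg, neg_mul, zero_mul,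
        mul_zero, smul_mul_assoc, mul_smul_comm, one_mul, mul_one, zero_add, add_zero]
      module
    have hδ : ∀ i j, ((ε i : ℤ) : ℂ) * kronecker i j = ((ε j : ℤ) : ℂ) * kronecker j i := by
      intro i j
      by_cases hij : i = j
      · rw [hij]
      · simp [kronecker, hij, Ne.symm hij]
    simp only [h.smul_left, h.smul_right, h.sub_left, h.sub_right, h5, hδ k j, hδ l j, hδ k i,
      hδ l i]
    module

lemma sum_kronecker_left {A : Type*} [AddCommGroup A] [Module ℂ A] {q : ℕ} (f : Fin q → A)
    (c : Fin q → ℂ) (k : Fin q) : ∑ i, (c i * kronecker i k) • f i = c k • f k := by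
  simp [kronecker]

lemma eq_zero_of_eq_neg_self {A : Type*} [AddCommGroup A] [Module ℂ A] {a : A} (ha : a = -a) :
    a = 0 := by
  have h1 : (2 : ℂ) • a = 0 := by
    rw [two_smul]
    nth_rw 1 [ha]
    exact neg_add_cancel a
  exact (smul_eq_zero.mp h1).resolve_left two_ne_zero

namespace IsMomentumAlgebra

variable {A : Type*} [Ring A] [Module ℂ A] [IsScalarTower ℂ A A] [SMulCommClass ℂ A A] {q : ℕ}
  {ε : Fin q → ℤˣ} {br : A → A → A} {P : Fin q → Fin q → A} {κ : ℂ}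
  (h : IsMomentumAlgebra ε br P κ)

include h

omit [IsScalarTower ℂ A A] [SMulCommClass ℂ A A] in
lemma self_eq_zero (i : Fin q) : P i i = 0 :=
  eq_zero_of_eq_neg_self (h.anti i i)

omit [IsScalarTower ℂ A A] [SMulCommClass ℂ A A] in
-- By skew-symmetry the four Kronecker terms coincide in pairs. The result has the shape ε_l V_lk -
-- ε_k V_kl, with V_kl the sum over i of c_ik P_il; this shape is the input of `bracket_of_linear`
-- and `bracket_of_squares`.
lemma bracket_linear {c : Fin q → Fin q → ℂ} (hc : ∀ i j, c j i = -c i j) (k l : Fin q) :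
    br (∑ i, ∑ j, c i j • P i j) (P k l) = (2 * κ) • (
      ((ε l : ℤ) : ℂ) • (∑ i, c i l • P i k) - ((ε k : ℤ) : ℂ) • ∑ i, c i k • P i l) := by
  have e1 : ∀ i j, c i j • br (P i j) (P k l) = κ • (
      -((c i j * ((ε j : ℤ) : ℂ) * kronecker j k) • P i l)
      + (c i j * ((ε i : ℤ) : ℂ) * kronecker i l) • P k j
      + (c i j * ((ε j : ℤ) : ℂ) * kronecker j l) • P i k
      + (c i j * ((ε i : ℤ) : ℂ) * kronecker i k) • P j l) := by
    intro i j
    rw [h.rel]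
    module
  simp only [h.sum_left, h.smul_left, e1, ← Finset.smul_sum, Finset.sum_add_distrib,
    Finset.sum_neg_distrib]
  rw [Finset.sum_comm (f := fun i j => (c i j * ((ε i : ℤ) : ℂ) * kronecker i l) • P k j),
    Finset.sum_comm (f := fun i j => (c i j * ((ε i : ℤ) : ℂ) * kronecker i k) • P j l)]
  have e2 : ∀ j, ∑ i, (c i j * ((ε i : ℤ) : ℂ) * kronecker i l) • P k j =
      ((ε l : ℤ) : ℂ) • c j l • P j k := by
    intro j
    rw [sum_kronecker_left (fun _ => P k j), hc, h.anti j k]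
    module
  have e3 : ∀ j, ∑ i, (c i j * ((ε i : ℤ) : ℂ) * kronecker i k) • P j l =
      -(((ε k : ℤ) : ℂ) • c j k • P j l) := by
    intro j
    rw [sum_kronecker_left (fun _ => P j l), hc]
    module
  have e4 : ∀ i k l, ∑ j, (c i j * ((ε j : ℤ) : ℂ) * kronecker j k) • P i l =
      ((ε k : ℤ) : ℂ) • c i k • P i l := by
    intro i k l
    rw [sum_kronecker_left (fun _ => P i l)]
    module
  simp only [e2, e3, e4, ← Finset.smul_sum, Finset.sum_neg_distrib]
  module

/-- The same shape arises as in `bracket_linear`, now with V_kl the sum of c_ik (P_ik P_il + P_il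
P_ik). The symmetrized products keep the statement valid without commutativity. -/
lemma bracket_squares {c : Fin q → Fin q → ℂ} (hc : ∀ i j, c j i = c i j) (k l : Fin q) :
    br (∑ i, ∑ j, c i j • (P i j * P i j)) (P k l) = (2 * κ) • (
      ((ε l : ℤ) : ℂ) • (∑ i, c i l • (P i l * P i k + P i k * P i l))
        - ((ε k : ℤ) : ℂ) • ∑ i, c i k • (P i k * P i l + P i l * P i k)) := by
  have e1 : ∀ i j, c i j • br (P i j * P i j) (P k l) = κ • (
      -((c i j * ((ε j : ℤ) : ℂ) * kronecker j k) • (P i j * P i l + P i l * P i j))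
      + (c i j * ((ε i : ℤ) : ℂ) * kronecker i l) • (P i j * P k j + P k j * P i j)
      + (c i j * ((ε j : ℤ) : ℂ) * kronecker j l) • (P i j * P i k + P i k * P i j)
      + (c i j * ((ε i : ℤ) : ℂ) * kronecker i k) • (P i j * P j l + P j l * P i j)) := by
    intro i j
    rw [h.leibniz_left, h.rel]
    simp only [smul_mul_assoc, mul_smul_comm, mul_add, add_mul, mul_neg, neg_mul]
    module
  simp only [h.sum_left, h.smul_left, e1, ← Finset.smul_sum, Finset.sum_add_distrib,
    Finset.sum_neg_distrib]
  rw [Finset.sum_comm (f := fun i j => (c i j * ((ε i : ℤ) : ℂ) * kronecker i l) •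
      (P i j * P k j + P k j * P i j)),
    Finset.sum_comm (f := fun i j => (c i j * ((ε i : ℤ) : ℂ) * kronecker i k) •
      (P i j * P j l + P j l * P i j))]
  have e2 : ∀ j, ∑ i, (c i j * ((ε i : ℤ) : ℂ) * kronecker i l) • (P i j * P k j + P k j * P i j) =
      ((ε l : ℤ) : ℂ) • c j l • (P j l * P j k + P j k * P j l) := by
    intro j
    rw [sum_kronecker_left (fun i => P i j * P k j + P k j * P i j), hc, h.anti j k, h.anti j l]
    simp only [mul_neg, neg_mul, neg_neg]
    module
  have e3 : ∀ j, ∑ i, (c i j * ((ε i : ℤ) : ℂ) * kronecker i k) • (P i j * P j l + P j l * P i j) =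
      -(((ε k : ℤ) : ℂ) • c j k • (P j k * P j l + P j l * P j k)) := by
    intro j
    rw [sum_kronecker_left (fun i => P i j * P j l + P j l * P i j), hc, h.anti j k]
    simp only [mul_neg, neg_mul]
    module
  have e4 : ∀ i k l, ∑ j, (c i j * ((ε j : ℤ) : ℂ) * kronecker j k) •
      (P i j * P i l + P i l * P i j) =
      ((ε k : ℤ) : ℂ) • c i k • (P i k * P i l + P i l * P i k) := by
    intro i k l
    rw [sum_kronecker_left (fun j => P i j * P i l + P i l * P i j)]
    module
  simp only [e2, e3, e4, ← Finset.smul_sum, Finset.sum_neg_distrib]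
  module

variable {a : A} {V : Fin q → Fin q → A}

omit [IsScalarTower ℂ A A] [SMulCommClass ℂ A A] in
lemma bracket_of_linear
    (ha : ∀ k l, br a (P k l) = (2 * κ) • (((ε l : ℤ) : ℂ) • V l k - ((ε k : ℤ) : ℂ) • V k l))
    {d : Fin q → Fin q → ℂ} (hd : ∀ i j, d j i = -d i j) :
    br a (∑ k, ∑ l, d k l • P k l) =
      (-4 * κ) • ∑ k, ∑ l, (((ε k : ℤ) : ℂ) * d k l) • V k l := by
  have e1 : ∀ k l, d k l • br a (P k l) = -((2 * κ) • ((((ε l : ℤ) : ℂ) * d l k) • V l k))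
      - (2 * κ) • ((((ε k : ℤ) : ℂ) * d k l) • V k l) := by
    intro k l
    rw [ha, hd k l]
    module
  simp only [h.sum_right, h.smul_right, e1, Finset.sum_sub_distrib, Finset.sum_neg_distrib]
  rw [Finset.sum_comm (f := fun k l => (2 * κ) • ((((ε l : ℤ) : ℂ) * d l k) • V l k))]
  simp only [← Finset.smul_sum]
  module

lemma bracket_of_squares
    (ha : ∀ k l, br a (P k l) = (2 * κ) • (((ε l : ℤ) : ℂ) • V l k - ((ε k : ℤ) : ℂ) • V k l))
    {d : Fin q → Fin q → ℂ} (hd : ∀ i j, d j i = d i j) :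
    br a (∑ k, ∑ l, d k l • (P k l * P k l)) =
      (-4 * κ) • ∑ k, ∑ l, (((ε k : ℤ) : ℂ) * d k l) • (V k l * P k l + P k l * V k l) := by
  have e1 : ∀ k l, d k l • br a (P k l * P k l) =
      -((2 * κ) • ((((ε l : ℤ) : ℂ) * d l k) • (V l k * P l k + P l k * V l k)))
      - (2 * κ) • ((((ε k : ℤ) : ℂ) * d k l) • (V k l * P k l + P k l * V k l)) := by
    intro k l
    rw [h.leibniz_right, ha, hd k l, h.anti k l]
    simp only [smul_mul_assoc, mul_smul_comm, mul_sub, sub_mul, mul_neg, neg_mul]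
    module
  simp only [h.sum_right, h.smul_right, e1, Finset.sum_sub_distrib, Finset.sum_neg_distrib]
  rw [Finset.sum_comm (f := fun k l => (2 * κ) • ((((ε l : ℤ) : ℂ) * d l k) •
    (V l k * P l k + P l k * V l k)))]
  simp only [← Finset.smul_sum]
  module

end IsMomentumAlgebra

/-! ### The classical and the quantum momentum algebra -/

lemma isBiderivation_poisson {ι : Type} [Fintype ι] :
    IsBiderivation (poisson : PhasePoly ι → PhasePoly ι → PhasePoly ι) where
  add_right a b c := by
    simp only [poisson, map_add, ← Finset.sum_add_distrib]
    exact Finset.sum_congr rfl fun i _ => by ring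
  smul_right a t b := by
    simp only [poisson, smul_eq_C_mul, pderiv_C_mul, Finset.mul_sum]
    exact Finset.sum_congr rfl fun i _ => by ring
  skew a b := by
    simp only [poisson, ← Finset.sum_neg_distrib]
    exact Finset.sum_congr rfl fun i _ => by ring
  leibniz_right a b c := by
    simp only [poisson, pderiv_mul, Finset.sum_mul, Finset.mul_sum, ← Finset.sum_add_distrib]
    exact Finset.sum_congr rfl fun i _ => by ring

lemma poisson_linear {ι : Type} [Fintype ι] [DecidableEq ι] (i j : ι) (a b c d : ℂ) :
    poisson (C a * (X (Sum.inl i) + C b * X (Sum.inr i)))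
      (C c * (X (Sum.inl j) + C d * X (Sum.inr j))) =
      if i = j then C (a * c * (b - d)) else 0 := by
  rw [poisson, Finset.sum_eq_single i]
  · by_cases hij : i = j
    · subst hij
      simp [pderiv_X]
      ring
    · simp [pderiv_X, hij, Ne.symm hij]
  · intro k _ hk
    simp [pderiv_X, Ne.symm hk]
  · simp

lemma isMomentumAlgebra_poisson {q : ℕ} (ε : Fin q → ℤˣ) :
    IsMomentumAlgebra ε (poisson : PhasePoly (Fin q) → PhasePoly (Fin q) → PhasePoly (Fin q))
      (momentumCl ε) (-1) := by
  have hw : ∀ i, wCl ε i = C (1 / (Real.sqrt 2 : ℂ)) *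
      (X (Sum.inl i) + C (Complex.I * ((ε i : ℤ) : ℂ)) * X (Sum.inr i)) := fun i => by
    rw [wCl_eq, C_mul]
  have hws : ∀ i, wBarCl ε i = C (1 / (Real.sqrt 2 : ℂ)) *
      (X (Sum.inl i) + C (-(Complex.I * ((ε i : ℤ) : ℂ))) * X (Sum.inr i)) := fun i => by
    rw [wBarCl_eq, C_neg, C_mul]
    ring
  have key := isBiderivation_poisson.isMomentumAlgebra (ε := ε) (w := wCl ε) (ws := wBarCl ε)
    (κ := Complex.I) (fun i j => ?_) (fun i j => ?_) (fun i j => ?_)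
  · rw [Complex.I_mul_I] at key
    convert key using 1
    funext i j
    rw [momentumCl, C_mul']
  · rw [hw, hw, poisson_linear]
    split_ifs with hij
    · rw [hij]
      simp
    · rfl
  · rw [hws, hws, poisson_linear]
    split_ifs with hij
    · rw [hij]
      simp
    · rfl
  · rw [hw, hws, poisson_linear, smul_eq_C_mul, mul_one]
    by_cases hij : i = j
    · subst hij
      rw [if_pos rfl, one_div_sqrt_two_mul_self, kronecker, if_pos rfl]
      congr 1
      ring
    · rw [if_neg hij, kronecker, if_neg hij]
      simp

lemma isBiderivation_bracket {A : Type*} [Ring A] [Module ℂ A] [IsScalarTower ℂ A A]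
    [SMulCommClass ℂ A A] : IsBiderivation (fun a b : A => ⁅a, b⁆) where
  add_right a b c := by
    simp only [Ring.lie_def]
    noncomm_ring
  smul_right a t b := bracket_smul_right t a b
  skew a b := (neg_bracket a b).symm
  leibniz_right a b c := bracket_mul_right a b c

lemma isMomentumAlgebra_bracket {u : ℕ} {q : Fin u → ℕ} (ε : Osc q → ℤˣ) (g : Fin u) :
    IsMomentumAlgebra (fun i => ε ⟨g, i⟩) (fun a b : Op (Osc q) => ⁅a, b⁆)
      (fun i j => momentumOp ε (⟨g, i⟩ : Osc q) ⟨g, j⟩) Complex.I := by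
  have key := isBiderivation_bracket.isMomentumAlgebra (ε := fun i => ε ⟨g, i⟩)
    (w := fun i : Fin (q g) => wOp ε (⟨g, i⟩ : Osc q)) (ws := fun i => wStarOp ε ⟨g, i⟩)
    (κ := 1) (fun i j => wOp_lie_wOp ε _ _) (fun i j => wStarOp_lie_wStarOp ε _ _)
    (fun i j => ?_)
  · rw [mul_one] at key
    exact key
  · rw [wOp_lie_wStarOp, one_mul]
    by_cases hij : i = j
    · subst hij
      rw [if_pos rfl, kronecker, if_pos rfl, mul_one]
    · rw [if_neg (by simpa using hij), kronecker, if_neg hij, mul_zero, zero_smul]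

/-! ### Relations between products of momenta -/

section Evaluation

variable {q : ℕ} (ε : Fin q → ℤˣ)

/-- Substituting x_i = ε_i y_i turns the momenta, up to signs, into the 2 by 2 minors of the pair
(y, p). Unit vectors then make chosen momenta nonzero and the others zero. -/
lemma exists_eval_momentumCl (y p : Fin q → ℝ) : ∃ φ : PhasePoly (Fin q) →ₐ[ℂ] ℂ,
    ∀ i j, φ (momentumCl ε i j) =
      ((ε i : ℤ) : ℂ) * ((ε j : ℤ) : ℂ) * ((y i : ℂ) * (p j : ℂ) - (y j : ℂ) * (p i : ℂ)) := by
  refine ⟨aeval (Sum.elim (fun i => ((ε i : ℤ) : ℂ) * (y i : ℂ)) fun i => (p i : ℂ)),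
    fun i j => ?_⟩
  rw [momentumCl_eq]
  simp only [map_sub, map_mul, aeval_X, algHom_C, Sum.elim_inl, Sum.elim_inr]
  simp only [Algebra.algebraMap_self, RingHom.id_apply]
  ring

lemma triple_sum_eq {f : Fin q → Fin q → Fin q → ℂ} (s : Finset (Fin q))
    (h1 : ∀ a b c, a ∉ s → f a b c = 0) (h2 : ∀ a b c, b ∉ s → f a b c = 0)
    (h3 : ∀ a b c, c ∉ s → f a b c = 0) :
    ∑ a, ∑ b, ∑ c, f a b c = ∑ a ∈ s, ∑ b ∈ s, ∑ c ∈ s, f a b c := by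
  rw [← Finset.sum_subset (Finset.subset_univ s) fun a _ ha => Finset.sum_eq_zero fun b _ =>
    Finset.sum_eq_zero fun c _ => h1 a b c ha]
  refine Finset.sum_congr rfl fun a _ => ?_
  rw [← Finset.sum_subset (Finset.subset_univ s) fun b _ hb => Finset.sum_eq_zero fun c _ =>
    h2 a b c hb]
  refine Finset.sum_congr rfl fun b _ => ?_
  rw [← Finset.sum_subset (Finset.subset_univ s) fun c _ hc => h3 a b c hc]

lemma sign_ne_zero (e : ℤˣ) : ((e : ℤ) : ℂ) ≠ 0 := fun h => by
  have h1 := sign_mul_self e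
  rw [h, mul_zero] at h1
  exact zero_ne_one h1

/-- At y = e_i, p = e_l only P_il and P_li survive, with opposite values. -/
lemma coeff_of_sum_momentumCl_eq_zero {e : Fin q → Fin q → ℂ}
    (h : ∑ i, ∑ l, e i l • momentumCl ε i l = 0) {i l : Fin q} (hil : i ≠ l) :
    e i l = e l i := by
  obtain ⟨φ, hφ⟩ := exists_eval_momentumCl ε (Pi.single i 1) (Pi.single l 1)
  have h1 := congr_arg φ h
  have hφ0 : ∀ a b, (a ∉ ({i, l} : Finset (Fin q)) → φ (momentumCl ε a b) = 0) ∧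
      (b ∉ ({i, l} : Finset (Fin q)) → φ (momentumCl ε a b) = 0) := by
    intro a b
    constructor <;>
    · intro ha
      simp only [Finset.mem_insert, Finset.mem_singleton, not_or] at ha
      simp [hφ, Pi.single_apply, ha]
  simp only [map_sum, map_smul, map_zero, smul_eq_mul] at h1
  rw [← Finset.sum_subset (Finset.subset_univ {i, l}) fun a _ ha => Finset.sum_eq_zero
    fun b _ => by rw [(hφ0 a b).1 ha, mul_zero], Finset.sum_congr rfl fun a _ =>
    (Finset.sum_subset (Finset.subset_univ {i, l}) fun b _ hb => by
      rw [(hφ0 a b).2 hb, mul_zero]).symm] at h1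
  simp only [Finset.sum_insert, Finset.mem_singleton, hil, not_false_eq_true,
    Finset.sum_singleton, hφ, Pi.single_apply, hil.symm, if_true, if_false] at h1
  push_cast at h1
  have h2 : (((ε i : ℤ) : ℂ) * ((ε l : ℤ) : ℂ)) * (e i l - e l i) = 0 := by
    linear_combination h1
  exact sub_eq_zero.mp ((mul_eq_zero.mp h2).resolve_left
    (mul_ne_zero (sign_ne_zero _) (sign_ne_zero _)))

/-- At y = e_i + e_k, p = e_l the momenta P_il and P_kl are nonzero and P_ik vanishes. The squares
carry coefficients t i i l = 0, so only the mixed product is left. -/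
lemma coeff_of_sum_momentumCl_mul_eq_zero {t : Fin q → Fin q → Fin q → ℂ}
    (ht : ∀ i l, t i i l = 0)
    (h : ∑ i, ∑ k, ∑ l, t i k l • (momentumCl ε i l * momentumCl ε k l
      + momentumCl ε k l * momentumCl ε i l) = 0) {i k l : Fin q} (hik : i ≠ k) (hil : i ≠ l)
    (hkl : k ≠ l) : t i k l + t k i l = 0 := by
  obtain ⟨φ, hφ⟩ := exists_eval_momentumCl ε (Pi.single i 1 + Pi.single k 1) (Pi.single l 1)
  have h1 := congr_arg φ h
  have hφ0 : ∀ a b, (a ∉ ({i, k, l} : Finset (Fin q)) → φ (momentumCl ε a b) = 0) ∧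
      (b ∉ ({i, k, l} : Finset (Fin q)) → φ (momentumCl ε a b) = 0) := by
    intro a b
    constructor <;>
    · intro ha
      simp only [Finset.mem_insert, Finset.mem_singleton, not_or] at ha
      simp [hφ, Pi.single_apply, ha]
  simp only [map_sum, map_smul, map_add, map_mul, map_zero, smul_eq_mul] at h1
  rw [triple_sum_eq {i, k, l} (fun a b c ha => by simp [(hφ0 a c).1 ha])
    (fun a b c hb => by simp [(hφ0 b c).1 hb]) (fun a b c hc => by simp [(hφ0 a c).2 hc])] at h1
  simp only [Finset.sum_insert, Finset.mem_insert, Finset.mem_singleton, hik, hil, hkl,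
    not_false_eq_true, or_self,
    Finset.sum_singleton, hφ, Pi.add_apply, Pi.single_apply, hik.symm, hil.symm, hkl.symm, if_true,
    if_false, ht] at h1
  push_cast at h1
  have h2 : (2 * (((ε i : ℤ) : ℂ) * ((ε k : ℤ) : ℂ)) * ((ε l : ℤ) : ℂ) ^ 2) *
      (t i k l + t k i l) = 0 := by
    linear_combination h1
  exact (mul_eq_zero.mp h2).resolve_left (mul_ne_zero (mul_ne_zero two_ne_zero
    (mul_ne_zero (sign_ne_zero _) (sign_ne_zero _))) (pow_ne_zero _ (sign_ne_zero _)))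

/-- The classical cubic product P_ik P_il P_kl is alternating in i, k, l, so only the alternating
part of t can be detected. The chosen point makes all three factors nonzero. -/
lemma coeff_of_sum_momentumCl_mul_mul_eq_zero {t : Fin q → Fin q → Fin q → ℂ}
    (h : ∑ i, ∑ k, ∑ l, t i k l • ((momentumCl ε i k * momentumCl ε i l +
        momentumCl ε i l * momentumCl ε i k) * momentumCl ε k l
      + momentumCl ε k l * (momentumCl ε i k * momentumCl ε i l +
        momentumCl ε i l * momentumCl ε i k)) = 0) {i k l : Fin q} (hik : i ≠ k) (hil : i ≠ l)
    (hkl : k ≠ l) : t i k l - t i l k - t k i l + t k l i + t l i k - t l k i = 0 := by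
  obtain ⟨φ, hφ⟩ := exists_eval_momentumCl ε (Pi.single i 1 + Pi.single l 1)
    (Pi.single k 1 + Pi.single l 1)
  have h1 := congr_arg φ h
  have hφ0 : ∀ a b, (a ∉ ({i, k, l} : Finset (Fin q)) → φ (momentumCl ε a b) = 0) ∧
      (b ∉ ({i, k, l} : Finset (Fin q)) → φ (momentumCl ε a b) = 0) := by
    intro a b
    constructor <;>
    · intro ha
      simp only [Finset.mem_insert, Finset.mem_singleton, not_or] at ha
      simp [hφ, Pi.single_apply, ha]
  simp only [map_sum, map_smul, map_add, map_mul, map_zero, smul_eq_mul] at h1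
  rw [triple_sum_eq {i, k, l} (fun a b c ha => by simp [(hφ0 a c).1 ha])
    (fun a b c hb => by simp [(hφ0 b c).1 hb]) (fun a b c hc => by simp [(hφ0 a c).2 hc])] at h1
  simp only [Finset.sum_insert, Finset.mem_insert, Finset.mem_singleton, hik, hil, hkl,
    not_false_eq_true, or_self,
    Finset.sum_singleton, hφ, Pi.add_apply, Pi.single_apply, hik.symm, hil.symm, hkl.symm, if_true,
    if_false] at h1
  push_cast at h1
  have h2 : (-4 * (((ε i : ℤ) : ℂ) * ((ε k : ℤ) : ℂ) * ((ε l : ℤ) : ℂ)) ^ 2) *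
      (t i k l - t i l k - t k i l + t k l i + t l i k - t l k i) = 0 := by
    linear_combination h1
  exact (mul_eq_zero.mp h2).resolve_left (mul_ne_zero (by norm_num) (pow_ne_zero _ (mul_ne_zero
    (mul_ne_zero (sign_ne_zero _) (sign_ne_zero _)) (sign_ne_zero _))))

end Evaluation

/-! ### Sums over pairs -/

lemma sum_sum_eq_sum_pair {A : Type*} [AddCommGroup A] [Module ℂ A] {q : ℕ}
    {H : Fin q → Fin q → A} (hH : ∀ i j, H j i = H i j) (h0 : ∀ i, H i i = 0) :
    ∑ i, ∑ j, H i j = (2 : ℂ) • ∑ a : Pair q, H a.1.1 a.1.2 := by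
  have h1 : ∀ i j, H i j = (if i < j then H i j else 0) + (if j < i then H j i else 0) := by
    intro i j
    rcases lt_trichotomy i j with hij | hij | hij
    · simp [hij, hij.not_gt]
    · simp [hij, h0]
    · simp [hij, hij.not_gt, hH]
  have h2 : ∑ a : Pair q, H a.1.1 a.1.2 = ∑ i, ∑ j, if i < j then H i j else 0 := by
    rw [← Fintype.sum_prod_type' (f := fun i j => if i < j then H i j else 0),
      ← Finset.sum_filter]
    exact (Finset.sum_subtype _ (by simp) fun x : Fin q × Fin q => H x.1 x.2).symm
  rw [Finset.sum_congr rfl fun i _ => Finset.sum_congr rfl fun j _ => h1 i j]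
  simp only [Finset.sum_add_distrib]
  rw [Finset.sum_comm (f := fun i j => if j < i then H j i else 0), h2, two_smul]

/-- The skew-symmetric matrix with given entries above the diagonal. -/
def skewExt {q : ℕ} (v : Pair q → ℂ) (i j : Fin q) : ℂ :=
  if h : i < j then v ⟨(i, j), h⟩ else if h : j < i then -v ⟨(j, i), h⟩ else 0

/-- The symmetric matrix with given entries above the diagonal and vanishing diagonal. -/
def symExt {q : ℕ} (v : Pair q → ℂ) (i j : Fin q) : ℂ :=
  if h : i < j then v ⟨(i, j), h⟩ else if h : j < i then v ⟨(j, i), h⟩ else 0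

lemma skewExt_swap {q : ℕ} (v : Pair q → ℂ) (i j : Fin q) : skewExt v j i = -skewExt v i j := by
  unfold skewExt
  rcases lt_trichotomy i j with hij | hij | hij
  · simp [hij, hij.not_gt]
  · simp [hij]
  · simp [hij, hij.not_gt]

lemma symExt_swap {q : ℕ} (v : Pair q → ℂ) (i j : Fin q) : symExt v j i = symExt v i j := by
  unfold symExt
  rcases lt_trichotomy i j with hij | hij | hij
  · simp [hij, hij.not_gt]
  · simp [hij]
  · simp [hij, hij.not_gt]

lemma skewExt_pair {q : ℕ} (v : Pair q → ℂ) (a : Pair q) : skewExt v a.1.1 a.1.2 = v a := by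
  simp [skewExt, a.2]

lemma symExt_pair {q : ℕ} (v : Pair q → ℂ) (a : Pair q) : symExt v a.1.1 a.1.2 = v a := by
  simp [symExt, a.2]

/-- The linear combination of the momenta with coefficients `v`. -/
def linearEl {A : Type*} [Ring A] [Module ℂ A] {q : ℕ} (P : Fin q → Fin q → A)
    (v : Pair q → ℂ) : A := ∑ a : Pair q, v a • P a.1.1 a.1.2

/-- The linear combination of the squares of the momenta with coefficients `v`. -/
def squareEl {A : Type*} [Ring A] [Module ℂ A] {q : ℕ} (P : Fin q → Fin q → A)
    (v : Pair q → ℂ) : A := ∑ a : Pair q, v a • (P a.1.1 a.1.2 * P a.1.1 a.1.2)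

/-- The sum over all triples of indices. -/
def tripleSum {A : Type*} [AddCommGroup A] {q : ℕ} (F : Fin q → Fin q → Fin q → A) : A :=
  ∑ i, ∑ k, ∑ l, F i k l

section TripleSum

variable {A : Type*} [AddCommGroup A] {q : ℕ} (F : Fin q → Fin q → Fin q → A)

lemma tripleSum_swap_left : tripleSum (fun i k l => F k i l) = tripleSum F :=
  Finset.sum_comm

lemma tripleSum_swap_right : tripleSum (fun i k l => F i l k) = tripleSum F :=
  Finset.sum_congr rfl fun _ _ => Finset.sum_comm

lemma tripleSum_add (G : Fin q → Fin q → Fin q → A) :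
    tripleSum F + tripleSum G = tripleSum (fun i k l => F i k l + G i k l) := by
  simp only [tripleSum, Finset.sum_add_distrib]

lemma tripleSum_eq_zero (h : ∀ i k l, F i k l = 0) : tripleSum F = 0 :=
  Finset.sum_eq_zero fun i _ => Finset.sum_eq_zero fun k _ => Finset.sum_eq_zero fun l _ => h i k l

end TripleSum

namespace IsMomentumAlgebra

variable {A : Type*} [Ring A] [Module ℂ A] [IsScalarTower ℂ A A] [SMulCommClass ℂ A A] {q : ℕ}
  {ε : Fin q → ℤˣ} {br : A → A → A} {P : Fin q → Fin q → A} {κ : ℂ}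
  (h : IsMomentumAlgebra ε br P κ)

include h

omit [IsScalarTower ℂ A A] [SMulCommClass ℂ A A] in
-- Sums over all ordered pairs are easier to bracket than sums over i < j. Each momentum is counted
-- twice, its coefficient changing sign along with it.
lemma sum_skewExt (v : Pair q → ℂ) :
    ∑ i, ∑ j, skewExt v i j • P i j = (2 : ℂ) • linearEl P v := by
  rw [sum_sum_eq_sum_pair (fun i j => by rw [skewExt_swap, h.anti i j, neg_smul_neg])
    fun i => by rw [h.self_eq_zero, smul_zero]]
  simp only [skewExt_pair, linearEl]

omit [IsScalarTower ℂ A A] [SMulCommClass ℂ A A] in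
lemma sum_symExt (v : Pair q → ℂ) :
    ∑ i, ∑ j, symExt v i j • (P i j * P i j) = (2 : ℂ) • squareEl P v := by
  rw [sum_sum_eq_sum_pair (fun i j => by rw [symExt_swap, h.anti i j, neg_mul_neg])
    fun i => by rw [h.self_eq_zero, zero_mul, smul_zero]]
  simp only [symExt_pair, squareEl]

omit [IsScalarTower ℂ A A] [SMulCommClass ℂ A A] in
lemma two_smul_two_smul (a b : A) : br ((2 : ℂ) • a) ((2 : ℂ) • b) = (4 : ℂ) • br a b := by
  rw [h.smul_left, h.smul_right, smul_smul]
  norm_num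

/-- This and the next two criteria have the same right-hand side in every momentum algebra, up to
the interpretation of P; they are the bridge from the classical to the quantum bracket. -/
lemma linear_linear_eq_zero_iff (hκ : κ ≠ 0) (v v' : Pair q → ℂ) :
    br (linearEl P v) (linearEl P v') = 0 ↔
      ∑ i, ∑ l, (∑ k, ((ε k : ℤ) : ℂ) * skewExt v' k l * skewExt v i k) • P i l = 0 := by
  have h1 := h.bracket_of_linear (h.bracket_linear (skewExt_swap v)) (skewExt_swap v')
  rw [h.sum_skewExt, h.sum_skewExt, h.two_smul_two_smul] at h1
  have h2 : ∑ k, ∑ l, (((ε k : ℤ) : ℂ) * skewExt v' k l) • ∑ i, skewExt v i k • P i l =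
      ∑ i, ∑ l, (∑ k, ((ε k : ℤ) : ℂ) * skewExt v' k l * skewExt v i k) • P i l := by
    simp only [Finset.smul_sum, Finset.sum_smul, smul_smul]
    exact (Finset.sum_congr rfl fun _ _ => Finset.sum_comm).trans
      (Finset.sum_comm.trans (Finset.sum_congr rfl fun _ _ => Finset.sum_comm))
  rw [h2] at h1
  rw [← smul_eq_zero_iff_right (by norm_num : (4 : ℂ) ≠ 0), h1,
    smul_eq_zero_iff_right (mul_ne_zero (by norm_num) hκ)]

lemma linear_square_eq_zero_iff (hκ : κ ≠ 0) (v v' : Pair q → ℂ) :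
    br (linearEl P v) (squareEl P v') = 0 ↔
      tripleSum (fun i k l => (((ε k : ℤ) : ℂ) * symExt v' k l * skewExt v i k) •
        (P i l * P k l + P k l * P i l)) = 0 := by
  have h1 := h.bracket_of_squares (h.bracket_linear (skewExt_swap v)) (symExt_swap v')
  rw [h.sum_skewExt, h.sum_symExt, h.two_smul_two_smul] at h1
  have h2 : ∑ k, ∑ l, (((ε k : ℤ) : ℂ) * symExt v' k l) •
        ((∑ i, skewExt v i k • P i l) * P k l + P k l * ∑ i, skewExt v i k • P i l) =
      tripleSum (fun i k l => (((ε k : ℤ) : ℂ) * symExt v' k l * skewExt v i k) •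
        (P i l * P k l + P k l * P i l)) := by
    simp only [Finset.sum_mul, Finset.mul_sum, ← Finset.sum_add_distrib, smul_mul_assoc,
      mul_smul_comm, ← smul_add, Finset.smul_sum, smul_smul]
    exact (Finset.sum_congr rfl fun _ _ => Finset.sum_comm).trans Finset.sum_comm
  rw [h2] at h1
  rw [← smul_eq_zero_iff_right (by norm_num : (4 : ℂ) ≠ 0), h1,
    smul_eq_zero_iff_right (mul_ne_zero (by norm_num) hκ)]

lemma square_square_eq_zero_iff (hκ : κ ≠ 0) (v v' : Pair q → ℂ) :
    br (squareEl P v) (squareEl P v') = 0 ↔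
      tripleSum (fun i k l => (((ε k : ℤ) : ℂ) * symExt v' k l * symExt v i k) •
        ((P i k * P i l + P i l * P i k) * P k l
          + P k l * (P i k * P i l + P i l * P i k))) = 0 := by
  have h1 := h.bracket_of_squares (h.bracket_squares (symExt_swap v)) (symExt_swap v')
  rw [h.sum_symExt, h.sum_symExt, h.two_smul_two_smul] at h1
  have h2 : ∑ k, ∑ l, (((ε k : ℤ) : ℂ) * symExt v' k l) •
        ((∑ i, symExt v i k • (P i k * P i l + P i l * P i k)) * P k l
          + P k l * ∑ i, symExt v i k • (P i k * P i l + P i l * P i k)) =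
      tripleSum (fun i k l => (((ε k : ℤ) : ℂ) * symExt v' k l * symExt v i k) •
        ((P i k * P i l + P i l * P i k) * P k l
          + P k l * (P i k * P i l + P i l * P i k))) := by
    simp only [Finset.sum_mul, Finset.mul_sum, ← Finset.sum_add_distrib, smul_mul_assoc,
      mul_smul_comm, ← smul_add, Finset.smul_sum, smul_smul]
    exact (Finset.sum_congr rfl fun _ _ => Finset.sum_comm).trans Finset.sum_comm
  rw [h2] at h1
  rw [← smul_eq_zero_iff_right (by norm_num : (4 : ℂ) ≠ 0), h1,
    smul_eq_zero_iff_right (mul_ne_zero (by norm_num) hκ)]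

omit [IsScalarTower ℂ A A] [SMulCommClass ℂ A A] in
lemma sum_eq_zero {e : Fin q → Fin q → ℂ} (he : ∀ i l, i ≠ l → e i l = e l i) :
    ∑ i, ∑ l, e i l • P i l = 0 := by
  refine eq_zero_of_eq_neg_self ?_
  conv_lhs => rw [Finset.sum_comm]
  simp only [← Finset.sum_neg_distrib]
  refine Finset.sum_congr rfl fun l _ => Finset.sum_congr rfl fun i _ => ?_
  by_cases hil : i = l
  · rw [hil, h.self_eq_zero, smul_zero, neg_zero]
  · rw [he i l hil, h.anti l i, smul_neg]

omit [IsScalarTower ℂ A A] [SMulCommClass ℂ A A] in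
lemma tripleSum_mul_eq_zero {t : Fin q → Fin q → Fin q → ℂ} (ht0 : ∀ i l, t i i l = 0)
    (ht : ∀ i k l, i ≠ k → i ≠ l → k ≠ l → t i k l + t k i l = 0) :
    tripleSum (fun i k l => t i k l • (P i l * P k l + P k l * P i l)) = 0 := by
  set F : Fin q → Fin q → Fin q → A :=
    fun i k l => t i k l • (P i l * P k l + P k l * P i l) with hF
  -- Symmetrize in i and k: the anticommutator is symmetric under this exchange, so the coefficients
  -- combine to t i k l + t k i l.
  have h1 : tripleSum F + tripleSum (fun i k l => F k i l) = 0 := by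
    rw [tripleSum_add]
    refine tripleSum_eq_zero _ fun i k l => ?_
    by_cases hik : i = k
    · simp [hF, hik, ht0]
    by_cases hil : i = l
    · simp [hF, hil, h.self_eq_zero]
    by_cases hkl : k = l
    · simp [hF, hkl, h.self_eq_zero]
    simp only [hF]
    rw [add_comm (P k l * P i l), ← add_smul, ht i k l hik hil hkl, zero_smul]
  rw [tripleSum_swap_left F] at h1
  exact eq_zero_of_eq_neg_self (eq_neg_of_add_eq_zero_left h1)

omit [IsScalarTower ℂ A A] [SMulCommClass ℂ A A] in
lemma tripleSum_mul_mul_eq_zero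
    (hP : ∀ i k l, i ≠ k → i ≠ l → k ≠ l →
      P i k * (P i l * P k l - P k l * P i l) = (P i l * P k l - P k l * P i l) * P i k)
    {t : Fin q → Fin q → Fin q → ℂ}
    (ht : ∀ i k l, i ≠ k → i ≠ l → k ≠ l →
      t i k l - t i l k - t k i l + t k l i + t l i k - t l k i = 0) :
    tripleSum (fun i k l => t i k l • ((P i k * P i l + P i l * P i k) * P k l
          + P k l * (P i k * P i l + P i l * P i k))) = 0 := by
  set T : Fin q → Fin q → Fin q → A := fun i k l => (P i k * P i l + P i l * P i k) * P k l
          + P k l * (P i k * P i l + P i l * P i k) with hT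
  set F : Fin q → Fin q → Fin q → A := fun i k l => t i k l • T i k l with hF
  have T0 : ∀ i k l, ¬ (i ≠ k ∧ i ≠ l ∧ k ≠ l) → T i k l = 0 := by
    intro i k l hikl
    by_cases hik : i = k
    · simp [hT, hik, h.self_eq_zero]
    by_cases hil : i = l
    · simp [hT, hil, h.self_eq_zero]
    by_cases hkl : k = l
    · simp [hT, hkl, h.self_eq_zero]
    exact absurd ⟨hik, hil, hkl⟩ hikl
  have T1 : ∀ i k l, T i l k = -T i k l := by
    intro i k l
    simp only [hT]
    rw [h.anti k l]
    noncomm_ring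
  have T2 : ∀ i k l, T k i l = -T i k l := by
    -- In the exchange of i and k the two sides differ exactly by the commutator of P_ik with [P_il,
    -- P_kl]; this is the only place where the hypothesis on that commutator enters.
    intro i k l
    by_cases hikl : i ≠ k ∧ i ≠ l ∧ k ≠ l
    · have h1 := hP i k l hikl.1 hikl.2.1 hikl.2.2
      rw [← sub_eq_zero] at h1
      simp only [hT]
      rw [h.anti i k, ← sub_eq_zero, ← h1]
      noncomm_ring
    · rw [T0 i k l hikl, T0 k i l (fun h' => hikl ⟨h'.1.symm, h'.2.2, h'.2.1⟩), neg_zero]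
  have s1 : tripleSum (fun i k l => F i l k) = tripleSum F := tripleSum_swap_right F
  have s2 : tripleSum (fun i k l => F k i l) = tripleSum F := tripleSum_swap_left F
  have s3 : tripleSum (fun i k l => F k l i) = tripleSum F :=
    (tripleSum_swap_left fun i k l => F i l k).trans s1
  have s4 : tripleSum (fun i k l => F l i k) = tripleSum F :=
    (tripleSum_swap_right fun i k l => F k i l).trans s2
  have s5 : tripleSum (fun i k l => F l k i) = tripleSum F :=
    (tripleSum_swap_left fun i k l => F l i k).trans s4
  -- Summing over the six permutations of the indices replaces t by its alternating part, which
  -- vanishes by assumption.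
  have h6 : tripleSum F + tripleSum (fun i k l => F i l k) + tripleSum (fun i k l => F k i l)
      + tripleSum (fun i k l => F k l i) + tripleSum (fun i k l => F l i k)
      + tripleSum (fun i k l => F l k i) = 0 := by
    simp only [tripleSum_add]
    refine tripleSum_eq_zero _ fun i k l => ?_
    have e3 : T k l i = T i k l := by rw [T1, T2, neg_neg]
    have e4 : T l i k = T i k l := by rw [T2, T1, neg_neg]
    have e5 : T l k i = -T i k l := by rw [T1, e4]
    simp only [hF]
    rw [e3, e4, e5, T1 i k l, T2 i k l]
    by_cases hikl : i ≠ k ∧ i ≠ l ∧ k ≠ l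
    · have := ht i k l hikl.1 hikl.2.1 hikl.2.2
      rw [← zero_smul ℂ (T i k l), ← this]
      module
    · simp [T0 i k l hikl]
  rw [s1, s2, s3, s4, s5] at h6
  have h7 : (6 : ℂ) • tripleSum F = 0 := by
    rw [← h6]
    module
  exact (smul_eq_zero.mp h7).resolve_left (by norm_num)

end IsMomentumAlgebra

/-! ### Momentum polynomials in involution yield commuting operators -/

section Transfer

variable {u : ℕ} {q : Fin u → ℕ} (ε : Osc q → ℤˣ) (g : Fin u)

lemma IsLinearOrSquares.exists_eq {f : MvPolynomial (Pair (q g)) ℝ} (hf : IsLinearOrSquares f) :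
    ∃ v : Pair (q g) → ℂ,
      (substMomenta (fun i => ε ⟨g, i⟩) f = linearEl (momentumCl fun i => ε ⟨g, i⟩) v ∧
        polyOp ε g f = linearEl (fun i j => momentumOp ε (⟨g, i⟩ : Osc q) ⟨g, j⟩) v) ∨
      (substMomenta (fun i => ε ⟨g, i⟩) f = squareEl (momentumCl fun i => ε ⟨g, i⟩) v ∧
        polyOp ε g f = squareEl (fun i j => momentumOp ε (⟨g, i⟩ : Osc q) ⟨g, j⟩) v) := by
  rcases hf.cases with ⟨h0, h2, h1⟩ | ⟨h0, h1, h2⟩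
  · refine ⟨fun a => ((f.coeff (Finsupp.single a 1) : ℝ) : ℂ), Or.inl ⟨?_, ?_⟩⟩
    · conv_lhs => rw [h1]
      simp only [substMomenta, linearEl, map_sum, map_mul, algHom_C, aeval_X]
      refine Finset.sum_congr rfl fun a _ => ?_
      rw [Algebra.smul_def]
      rfl
    · simp only [polyOp, h0, h2, linearEl, Complex.ofReal_zero, zero_smul, Finset.sum_const_zero,
        zero_add, add_zero]
  · refine ⟨fun a => ((f.coeff (Finsupp.single a 2) : ℝ) : ℂ), Or.inr ⟨?_, ?_⟩⟩
    · conv_lhs => rw [h2]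
      simp only [substMomenta, squareEl, map_sum, map_mul, map_pow, algHom_C, aeval_X]
      refine Finset.sum_congr rfl fun a _ => ?_
      rw [Algebra.smul_def, ← pow_two]
      rfl
    · simp only [polyOp, h0, h1, squareEl, Complex.ofReal_zero, zero_smul, Finset.sum_const_zero,
        zero_add, pow_two]

/-- For distinct indices [P_il, P_kl] is a scalar multiple of P_ik. -/
lemma momentumOp_mul_commutator {i k l : Fin (q g)} (hik : i ≠ k) (hil : i ≠ l) (hkl : k ≠ l) :
    momentumOp ε (⟨g, i⟩ : Osc q) ⟨g, k⟩ *
        (momentumOp ε (⟨g, i⟩ : Osc q) ⟨g, l⟩ * momentumOp ε (⟨g, k⟩ : Osc q) ⟨g, l⟩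
          - momentumOp ε (⟨g, k⟩ : Osc q) ⟨g, l⟩ * momentumOp ε (⟨g, i⟩ : Osc q) ⟨g, l⟩) =
      (momentumOp ε (⟨g, i⟩ : Osc q) ⟨g, l⟩ * momentumOp ε (⟨g, k⟩ : Osc q) ⟨g, l⟩
          - momentumOp ε (⟨g, k⟩ : Osc q) ⟨g, l⟩ * momentumOp ε (⟨g, i⟩ : Osc q) ⟨g, l⟩) *
        momentumOp ε (⟨g, i⟩ : Osc q) ⟨g, k⟩ := by
  have h1 := (isMomentumAlgebra_bracket ε g).rel i l k l
  simp only [Ring.lie_def, kronecker, hik, hil, hkl.symm, if_true, if_false, mul_zero, zero_smul,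
    neg_zero, zero_add, add_zero] at h1
  rw [h1]
  simp only [mul_smul_comm, smul_mul_assoc]

/-- In each of the linear and square cases the vanishing Poisson bracket gives a condition on the
coefficients, which is sufficient for the commutator to vanish. The classical constant is -1 and the
quantum one is i; only their being nonzero matters. -/
theorem commute_polyOp_of_poisson_eq_zero {f f' : MvPolynomial (Pair (q g)) ℝ}
    (hf : IsLinearOrSquares f) (hf' : IsLinearOrSquares f')
    (h : poisson (substMomenta (fun i => ε ⟨g, i⟩) f) (substMomenta (fun i => ε ⟨g, i⟩) f') = 0) :
    Commute (polyOp ε g f) (polyOp ε g f') := by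
  have hC := isMomentumAlgebra_poisson fun i => ε ⟨g, i⟩
  have hQ := isMomentumAlgebra_bracket ε g
  have hκ : (-1 : ℂ) ≠ 0 := by norm_num
  rw [commute_iff_lie_eq]
  have hmixed : ∀ v v',
      poisson (linearEl (momentumCl fun i => ε ⟨g, i⟩) v)
        (squareEl (momentumCl fun i => ε ⟨g, i⟩) v') = 0 →
      ⁅linearEl (fun i j => momentumOp ε (⟨g, i⟩ : Osc q) ⟨g, j⟩) v,
        squareEl (fun i j => momentumOp ε (⟨g, i⟩ : Osc q) ⟨g, j⟩) v'⁆ = 0 := by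
    intro v v' hvv
    refine (hQ.linear_square_eq_zero_iff Complex.I_ne_zero v v').mpr ?_
    have h1 := (hC.linear_square_eq_zero_iff hκ v v').mp hvv
    have ht0 : ∀ i l, ((ε ⟨g, i⟩ : ℤ) : ℂ) * symExt v' i l * skewExt v i i = 0 := fun i l => by
      simp [skewExt]
    exact hQ.tripleSum_mul_eq_zero ht0 fun i k l hik hil hkl =>
      coeff_of_sum_momentumCl_mul_eq_zero (fun i => ε ⟨g, i⟩) ht0 h1 hik hil hkl
  obtain ⟨v, ⟨hv1, hv2⟩ | ⟨hv1, hv2⟩⟩ := hf.exists_eq ε g <;>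
  obtain ⟨v', ⟨hv1', hv2'⟩ | ⟨hv1', hv2'⟩⟩ := hf'.exists_eq ε g <;>
  rw [hv1, hv1'] at h <;> rw [hv2, hv2']
  · refine (hQ.linear_linear_eq_zero_iff Complex.I_ne_zero v v').mpr ?_
    have h1 := (hC.linear_linear_eq_zero_iff hκ v v').mp h
    exact hQ.sum_eq_zero fun i l hil =>
      coeff_of_sum_momentumCl_eq_zero (fun i => ε ⟨g, i⟩) h1 hil
  · exact hmixed v v' h
  · rw [hC.skew, neg_eq_zero] at h
    rw [← neg_bracket, hmixed v' v h, neg_zero]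
  · refine (hQ.square_square_eq_zero_iff Complex.I_ne_zero v v').mpr ?_
    have h1 := (hC.square_square_eq_zero_iff hκ v v').mp h
    exact hQ.tripleSum_mul_mul_eq_zero
      (fun i k l hik hil hkl => momentumOp_mul_commutator ε g hik hil hkl)
      fun i k l hik hil hkl =>
        coeff_of_sum_momentumCl_mul_mul_eq_zero (fun i => ε ⟨g, i⟩) h1 hik hil hkl

end Transfer

/-! ### Quasi-integrability of the set of operators -/

section QuasiIntegrability

variable {u : ℕ} {q : Fin u → ℕ} (ε : Osc q → ℤˣ)

theorem quasiIndependent_operators (hq : ∀ g, 1 ≤ q g) {α β : Type} [Fintype α] [Fintype β]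
    {κ : Fin u → Type} [∀ g, Fintype (κ g)] {r : α → Fin u → ℤ} (hr : LinearIndependent ℤ r)
    {m : β → Fin u → ℤ} (hm : LinearIndependent ℤ m)
    {f : (g : Fin u) → κ g → MvPolynomial (Pair (q g)) ℝ} (hform : ∀ g k, IsLinearOrSquares (f g k))
    (hf : ∀ g, FunctionallyIndependent fun k => substMomenta (fun i => ε ⟨g, i⟩) (f g k)) :
    QuasiIndependent (Sum.elim
      (Sum.elim (fun i => jOp ε (r i)) (fun j => imROp ε (m j)))
      (fun a : (g : Fin u) × κ g => polyOp ε a.1 (f a.1 a.2))) := by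
  choose J hJ hJ' using fun i => exists_symbol_jOp ε hq (hr.ne_zero i)
  choose S hS hS' using fun j => exists_symbol_imROp ε hq (hm.ne_zero j)
  choose T hT hT' using fun a : (g : Fin u) × κ g =>
    exists_symbol_polyOp ε a.1 (hform a.1 a.2) ((hf a.1).ne_zero a.2)
  refine ⟨Sum.elim (Sum.elim J S) T, ?_, ?_⟩
  · rintro ((i | j) | a)
    exacts [hJ i, hS j, hT a]
  · have h := functionallyIndependent_of_groups ε hq (linearIndependent_intCast hr)
      (linearIndependent_intCast hm) (fun j g => (m j g).natAbs) hS' hf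
      (fun g g' k => shearField_substMomenta ε g g' (f g' k))
      (fun g g' k => squeezeField_substMomenta ε g g' (f g' k))
    convert h using 1
    funext a
    rcases a with (i | j) | a
    exacts [hJ' i, rfl, hT' a]

lemma commute_imROp_imROp_of_ne {h : ℕ} {m : Fin h → Fin u → ℤ} {i j : Fin h}
    (hmm : i ≠ j → ∀ g, m i g * m j g = 0) : Commute (imROp ε (m i)) (imROp ε (m j)) := by
  by_cases hij : i = j
  · rw [hij]
  · exact commute_imROp_imROp ε (hmm hij)

lemma commute_polyOp_polyOp {κ κ' : Fin u → Type} {f : (g : Fin u) → κ g → MvPolynomial (Pair (q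
    g)) ℝ}
    {f' : (g : Fin u) → κ' g → MvPolynomial (Pair (q g)) ℝ}
    (hf : ∀ g k, IsLinearOrSquares (f g k)) (hf' : ∀ g k, IsLinearOrSquares (f' g k))
    (h : ∀ g k k', poisson (substMomenta (fun i => ε ⟨g, i⟩) (f g k))
      (substMomenta (fun i => ε ⟨g, i⟩) (f' g k')) = 0)
    (a : (g : Fin u) × κ g) (b : (g : Fin u) × κ' g) :
    Commute (polyOp ε a.1 (f a.1 a.2)) (polyOp ε b.1 (f' b.1 b.2)) := by
  obtain ⟨g, k⟩ := a
  obtain ⟨g', k'⟩ := b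
  by_cases hg : g = g'
  · subst hg
    exact commute_polyOp_of_poisson_eq_zero ε g (hf g k) (hf' g k') (h g k k')
  · exact commute_polyOp_polyOp_of_ne ε hg _ _

lemma card_subtype_val_lt {a b : ℕ} (h : b ≤ a) : Fintype.card {i : Fin a // (i : ℕ) < b} = b := by
  rw [Fintype.card_subtype, Fin.card_filter_val_lt, min_eq_right h]

lemma card_subtype_le_val {a b : ℕ} (h : b ≤ a) :
    Fintype.card {i : Fin a // b ≤ (i : ℕ)} = a - b := by
  have h1 := Fintype.card_subtype_compl fun i : Fin a => (i : ℕ) < b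
  rw [card_subtype_val_lt h, Fintype.card_fin] at h1
  rw [← h1]
  exact Fintype.card_congr (Equiv.subtypeEquivRight fun i => not_lt.symm)

theorem isQuasiIntegrable_operators (hq : ∀ g, 1 ≤ q g) {z : Fin u → ℕ}
    (hz : ∀ g, z g + 1 ≤ q g) {k' h : ℕ} (hk'h : k' ≤ h)
    {m : Fin h → Fin u → ℤ} (hm : LinearIndependent ℤ m)
    (hmm : ∀ i j : Fin h, (j : ℕ) < k' → i ≠ j → ∀ g, m i g * m j g = 0)
    {r : Fin (u - k') → Fin u → ℤ} (hr : LinearIndependent ℤ r)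
    (hrm1 : ∀ (i : Fin (u - k')) (j : Fin h), (j : ℕ) < k' → ∑ g, r i g * m j g = 0)
    (hrm2 : ∀ (i : Fin (u - k')) (j : Fin h), (i : ℕ) < u - h → k' ≤ (j : ℕ) →
      ∑ g, r i g * m j g = 0)
    {Z : (g : Fin u) → Fin (z g) → MvPolynomial (Pair (q g)) ℝ}
    {L : (g : Fin u) → Fin (2 * (q g - z g - 1)) → MvPolynomial (Pair (q g)) ℝ}
    (hZL : ∀ g, IsMomentumSystem (fun i => ε ⟨g, i⟩) (Z g) (L g)) :
    IsQuasiIntegrable (u - h + k' + ∑ g, z g) (centralSet ε m r Z) (otherSet ε m r L) := by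
  -- Independent vectors in ℤ^u number at most u, so the subtraction u - h is not truncated.
  have hhu : h ≤ u := by
    have := hm.fintype_card_le_finrank
    simpa using this
  have hJR : ∀ (i : Fin (u - k')) (j : Fin h), ((i : ℕ) < u - h ∨ (j : ℕ) < k') →
      Commute (jOp ε (r i)) (imROp ε (m j)) := by
    intro i j hij
    rw [commute_iff_lie_eq]
    refine jOp_lie_imROp ε ?_
    by_cases hj : (j : ℕ) < k'
    · exact hrm1 i j hj
    · exact hrm2 i j (hij.resolve_right hj) (not_lt.mp hj)
  have hRR : ∀ i j : Fin h, (j : ℕ) < k' → Commute (imROp ε (m j)) (imROp ε (m i)) :=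
    fun i j hj => commute_imROp_imROp_of_ne ε fun hij g => by
      rw [mul_comm]
      exact hmm i j hj (Ne.symm hij) g
  refine ⟨?_, ?_, ?_, ?_, ?_⟩
  · simp only [Fintype.card_sum, Fintype.card_sigma, Fintype.card_fin]
    rw [card_subtype_val_lt (by omega), card_subtype_val_lt hk'h]
  · simp only [Fintype.card_sum, Fintype.card_sigma, Fintype.card_fin]
    rw [card_subtype_val_lt (by omega), card_subtype_val_lt hk'h, card_subtype_le_val (by omega),
      card_subtype_le_val hk'h]
    -- In each group 2(q - z - 1) + 2z + 2 = 2q, the subtraction being exact because z + 1 ≤ q.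
    have h1 : ∑ g, 2 * (q g - z g - 1) + 2 * ∑ g, z g + 2 * u = 2 * ∑ g, q g := by
      have h2 : 2 * u = ∑ _g : Fin u, 2 := by simp [mul_comm]
      rw [h2, Finset.mul_sum, Finset.mul_sum, ← Finset.sum_add_distrib, ← Finset.sum_add_distrib]
      refine Finset.sum_congr rfl fun g _ => ?_
      have := hz g
      omega
    omega
  · rintro ((⟨i, hi⟩ | ⟨j, hj⟩) | a) ((⟨i', hi'⟩ | ⟨j', hj'⟩) | b)
    · exact commute_jOp_jOp ε _ _
    · exact hJR i j' (Or.inl hi)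
    · exact commute_jOp_polyOp ε _ _ _
    · exact (hJR i' j (Or.inr hj)).symm
    · exact hRR j' j hj
    · exact commute_imROp_polyOp ε _ _ _
    · exact (commute_jOp_polyOp ε _ _ _).symm
    · exact (commute_imROp_polyOp ε _ _ _).symm
    · exact commute_polyOp_polyOp ε (fun g => (hZL g).form_Z) (fun g => (hZL g).form_Z)
        (fun g => (hZL g).involution_Z) a b
  · rintro ((⟨i, hi⟩ | ⟨j, hj⟩) | a) ((⟨i', hi'⟩ | ⟨j', hj'⟩) | b)
    · exact commute_jOp_jOp ε _ _
    · exact hJR i j' (Or.inl hi)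
    · exact commute_jOp_polyOp ε _ _ _
    · exact (hJR i' j (Or.inr hj)).symm
    · exact hRR j' j hj
    · exact commute_imROp_polyOp ε _ _ _
    · exact (commute_jOp_polyOp ε _ _ _).symm
    · exact (commute_imROp_polyOp ε _ _ _).symm
    · exact commute_polyOp_polyOp ε (fun g => (hZL g).form_Z) (fun g => (hZL g).form_L)
        (fun g => (hZL g).involution_L) a b
  · have hI := quasiIndependent_operators ε hq hr hm
      (f := fun g => Sum.elim (Z g) (L g))
      (fun g k => by
        rcases k with k | k
        exacts [(hZL g).form_Z k, (hZL g).form_L k])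
      (fun g => by
        convert (hZL g).independent using 1
        funext k
        rcases k with k | k <;> rfl)
    -- The central and the other operators are disjoint subfamilies of the family of all J, all Im R
    -- and all (Z, L), so independence is inherited along an injection of index sets.
    have he : Function.Injective (Sum.elim
        (Sum.map (Sum.map Subtype.val Subtype.val) (Sigma.map id fun _ => Sum.inl))
        (Sum.map (Sum.map Subtype.val Subtype.val) (Sigma.map id fun _ => Sum.inr)) :
        (({i : Fin (u - k') // (i : ℕ) < u - h} ⊕ {j : Fin h // (j : ℕ) < k'}) ⊕
          ((g : Fin u) × Fin (z g))) ⊕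
        (({i : Fin (u - k') // u - h ≤ (i : ℕ)} ⊕ {j : Fin h // k' ≤ (j : ℕ)}) ⊕
          ((g : Fin u) × Fin (2 * (q g - z g - 1)))) →
        (Fin (u - k') ⊕ Fin h) ⊕ ((g : Fin u) × (Fin (z g) ⊕ Fin (2 * (q g - z g - 1))))) := by
      refine Function.Injective.sumElim
        (Function.Injective.sumMap (Function.Injective.sumMap Subtype.val_injective
          Subtype.val_injective) (Function.injective_id.sigma_map fun _ => Sum.inl_injective))
        (Function.Injective.sumMap (Function.Injective.sumMap Subtype.val_injective
          Subtype.val_injective) (Function.injective_id.sigma_map fun _ => Sum.inr_injective)) ?_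
      rintro ((⟨i, hi⟩ | ⟨j, hj⟩) | ⟨g, k⟩) ((⟨i', hi'⟩ | ⟨j', hj'⟩) | ⟨g', k'⟩) heq
      all_goals simp [Sigma.map] at heq
      · subst heq
        omega
      · subst heq
        omega
      · obtain ⟨rfl, heq⟩ := heq
        simp at heq
    convert hI.comp he using 1
    funext a
    rcases a with ((i | j) | a) | ((i | j) | a) <;> rfl

end QuasiIntegrability

/-! ### Existence of momentum systems -/

section Existence

variable {q : ℕ} (ε : Fin q → ℤˣ)

/-- The coefficients of the Casimir element of the first `K` oscillators. -/
def casimirCoeff (K : ℕ) (a : Pair q) : ℤ :=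
  if (a.1.2 : ℕ) < K then (ε a.1.1 : ℤ) * (ε a.1.2 : ℤ) else 0

/-- The Casimir element of the momentum algebra of the first `K` oscillators. -/
def casimir (K : ℕ) : MvPolynomial (Pair q) ℝ :=
  ∑ a, C ((casimirCoeff ε K a : ℤ) : ℝ) * X a ^ 2

lemma isLinearOrSquares_casimir (K : ℕ) : IsLinearOrSquares (casimir ε K) := by
  classical
  refine Or.inr ⟨IsHomogeneous.sum _ _ _ fun a _ => ?_, fun d hd => ?_⟩
  · exact (isHomogeneous_X_pow (R := ℝ) a 2).C_mul _
  · obtain ⟨a, -, ha⟩ := Finset.mem_biUnion.mp (support_sum hd)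
    rw [C_mul_X_pow_eq_monomial] at ha
    exact ⟨a, Finset.mem_singleton.mp (support_monomial_subset ha)⟩

lemma substMomenta_casimir (K : ℕ) : substMomenta ε (casimir ε K) =
    squareEl (momentumCl ε) fun a => ((casimirCoeff ε K a : ℤ) : ℂ) := by
  simp only [substMomenta, casimir, squareEl, map_sum, map_mul, map_pow, algHom_C, aeval_X]
  refine Finset.sum_congr rfl fun a _ => ?_
  rw [Algebra.smul_def, ← pow_two, MvPolynomial.algebraMap_apply, MvPolynomial.algebraMap_apply]
  simp

lemma substMomenta_X (a : Pair q) : substMomenta ε (X a) = momentumCl ε a.1.1 a.1.2 := by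
  rw [substMomenta, aeval_X]

lemma symExt_casimirCoeff (K : ℕ) (i j : Fin q) (hj : (j : ℕ) < K) :
    symExt (fun a => ((casimirCoeff ε K a : ℤ) : ℂ)) i j =
      if i ≠ j ∧ (i : ℕ) < K then ((ε i : ℤ) : ℂ) * ((ε j : ℤ) : ℂ) else 0 := by
  unfold symExt casimirCoeff
  rcases lt_trichotomy i j with hij | hij | hij
  · have h1 : (i : ℕ) < K := lt_trans hij hj
    simp [hij, hij.ne, hj, h1]
  · simp [hij]
  · by_cases hi : (i : ℕ) < K
    · simp [hij, hij.not_gt, hij.ne', hi, mul_comm]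
    · simp [hij, hij.not_gt, hi]

/-- With coefficients ε_i ε_j the two sums of `bracket_squares` agree term by term: ε_l (ε_i ε_l) =
ε_i = ε_k (ε_i ε_k), and the anticommutators are equal. -/
lemma poisson_casimir_momentumCl (K : ℕ) {k l : Fin q} (hk : (k : ℕ) < K) (hl : (l : ℕ) < K) :
    poisson (substMomenta ε (casimir ε K)) (momentumCl ε k l) = 0 := by
  have hC := isMomentumAlgebra_poisson ε
  have h1 := hC.bracket_squares
    (symExt_swap fun a => ((casimirCoeff ε K a : ℤ) : ℂ)) k l
  rw [hC.sum_symExt, hC.smul_left, ← substMomenta_casimir, Finset.smul_sum, Finset.smul_sum,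
    ← Finset.sum_sub_distrib, Finset.sum_eq_zero, smul_zero] at h1
  · exact (smul_eq_zero.mp h1).resolve_left two_ne_zero
  · intro i _
    rw [symExt_casimirCoeff ε K i l hl, symExt_casimirCoeff ε K i k hk]
    by_cases hil : i = l
    · simp [hil, hC.self_eq_zero]
    by_cases hik : i = k
    · simp [hik, hC.self_eq_zero]
    by_cases hi : (i : ℕ) < K
    · simp only [hil, hik, hi, Ne, not_false_eq_true, and_self, if_true, smul_smul]
      rw [mul_left_comm, mul_left_comm ((ε k : ℤ) : ℂ), sign_mul_self, sign_mul_self,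
        add_comm (momentumCl ε i k * _), sub_self]
    · simp [hi]

/-- The smaller Casimir is a polynomial in momenta that all commute with the larger one. -/
lemma poisson_casimir_casimir {K K' : ℕ} (hK : K' ≤ K) :
    poisson (substMomenta ε (casimir ε K)) (substMomenta ε (casimir ε K')) = 0 := by
  have hP := isBiderivation_poisson (ι := Fin q)
  rw [substMomenta_casimir ε K', squareEl, hP.sum_right]
  refine Finset.sum_eq_zero fun a _ => ?_
  rw [hP.smul_right]
  by_cases ha : (a.1.2 : ℕ) < K'
  · have h2 : (a.1.1 : ℕ) < K := lt_trans a.2 (ha.trans_le hK)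
    rw [hP.leibniz_right, poisson_casimir_momentumCl ε K h2 (ha.trans_le hK), zero_mul, mul_zero,
      add_zero, smul_zero]
  · rw [casimirCoeff, if_neg ha, Int.cast_zero, zero_smul]

/-- The point with `x_i = p_j = 1` at which all other coordinates vanish. -/
def unitPoint (i j : Fin q) : Fin q ⊕ Fin q → ℂ := Sum.elim (Pi.single i 1) (Pi.single j 1)

lemma eval_momentumCl (y : Fin q ⊕ Fin q → ℂ) (i j : Fin q) : eval y (momentumCl ε i j) =
    ((ε j : ℤ) : ℂ) * (y (Sum.inl i) * y (Sum.inr j)) -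
      ((ε i : ℤ) : ℂ) * (y (Sum.inl j) * y (Sum.inr i)) := by
  simp [momentumCl_eq]

lemma derivation_casimir (D : Derivation ℂ (PhasePoly (Fin q)) (PhasePoly (Fin q))) (K : ℕ) :
    D (substMomenta ε (casimir ε K)) = ∑ a : Pair q, ((casimirCoeff ε K a : ℤ) : ℂ) •
      (2 * momentumCl ε a.1.1 a.1.2 * D (momentumCl ε a.1.1 a.1.2)) := by
  rw [substMomenta_casimir, squareEl, map_sum]
  refine Finset.sum_congr rfl fun a _ => ?_
  rw [Derivation.map_smul, Derivation.leibniz, smul_eq_mul]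
  congr 1
  ring

/-- At x_i = p_m = 1 the only nonzero momentum is P_im, with value ε_m, so one term of the sum
survives. As i is the first index, no pair has i as its second entry. -/
lemma eval_derivation_casimir (D : Derivation ℂ (PhasePoly (Fin q)) (PhasePoly (Fin q)))
    {K : ℕ} {i m : Fin q} (hi : (i : ℕ) = 0) (him : i < m) (hm : (m : ℕ) < K) :
    eval (unitPoint i m) (D (substMomenta ε (casimir ε K))) =
      2 * ((ε i : ℤ) : ℂ) * eval (unitPoint i m) (D (momentumCl ε i m)) := by
  rw [derivation_casimir, map_sum, Finset.sum_eq_single ⟨(i, m), him⟩]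
  · have h1 := sign_mul_self (ε m)
    simp only [smul_eval, map_mul, eval_momentumCl, casimirCoeff, hm, if_true, unitPoint,
      Sum.elim_inl, Sum.elim_inr, Pi.single_apply, him.ne, him.ne', if_false, map_ofNat]
    push_cast
    linear_combination (2 * ((ε i : ℤ) : ℂ) * eval (Sum.elim (Pi.single i 1) (Pi.single m 1))
      (D (momentumCl ε i m))) * h1
  · rintro ⟨⟨a, b⟩, hab⟩ - hne
    have hbi : b ≠ i := by
      rintro rfl
      have : (a : ℕ) < b := hab
      omega
    have h2 : ¬ (a = i ∧ b = m) := by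
      rintro ⟨rfl, rfl⟩
      exact hne rfl
    have h3 : eval (unitPoint i m) (momentumCl ε a b) = 0 := by
      rw [eval_momentumCl]
      simp only [unitPoint, Sum.elim_inl, Sum.elim_inr, Pi.single_apply, hbi, if_false, zero_mul,
        mul_zero, sub_zero]
      by_cases ha : a = i
      · rw [if_neg fun hb => h2 ⟨ha, hb⟩, mul_zero, mul_zero]
      · rw [if_neg ha, zero_mul, mul_zero]
    rw [smul_eval, map_mul, map_mul, h3, mul_zero, zero_mul, mul_zero]
  · simp

lemma pderiv_momentumCl_of_ne {t : Fin q ⊕ Fin q} {i j : Fin q} (hi : t ≠ Sum.inl i)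
    (hi' : t ≠ Sum.inr i) (hj : t ≠ Sum.inl j) (hj' : t ≠ Sum.inr j) :
    pderiv t (momentumCl ε i j) = 0 := by
  rw [momentumCl_eq]
  simp [hi.symm, hi'.symm, hj.symm, hj'.symm]

lemma pderiv_momentum_casimir_eq_zero {K : ℕ} {m : Fin q} (hm : K ≤ (m : ℕ)) :
    pderiv (Sum.inr m) (substMomenta ε (casimir ε K)) = 0 := by
  rw [derivation_casimir]
  refine Finset.sum_eq_zero fun a _ => ?_
  by_cases ha : (a.1.2 : ℕ) < K
  · have h1 : (a.1.1 : ℕ) < a.1.2 := a.2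
    rw [pderiv_momentumCl_of_ne ε (by simp) (fun h => ?_) (by simp) (fun h => ?_), mul_zero,
      smul_zero]
    · have := congr_arg Fin.val (Sum.inr_injective h)
      omega
    · have := congr_arg Fin.val (Sum.inr_injective h)
      omega
  · rw [casimirCoeff, if_neg ha, Int.cast_zero, zero_smul]

lemma pderiv_momentum_casimir_ne_zero {K : ℕ} {m : Fin q} (hm0 : 0 < (m : ℕ)) (hm : (m : ℕ) < K) :
    pderiv (Sum.inr m) (substMomenta ε (casimir ε K)) ≠ 0 := by
  intro h0
  have hi : (⟨0, by omega⟩ : Fin q) < m := hm0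
  have h1 := eval_derivation_casimir ε (pderiv (Sum.inr m)) rfl hi hm
  rw [h0, map_zero, momentumCl_eq] at h1
  simp [pderiv_X, unitPoint, hi.ne] at h1

/-- The infinitesimal generator of the scaling with weight `1` for the first two oscillators and
weight `-1` for the others. -/
def scalingField : Derivation ℂ (PhasePoly (Fin q)) (PhasePoly (Fin q)) :=
  mkDerivation ℂ (Sum.elim
    (fun i : Fin q => (if (i : ℕ) < 2 then 1 else -1 : ℂ) • X (Sum.inl i))
    (fun i : Fin q => (if (i : ℕ) < 2 then 1 else -1 : ℂ) • X (Sum.inr i)))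

lemma scalingField_momentumCl (i j : Fin q) : scalingField (momentumCl ε i j) =
    ((if (i : ℕ) < 2 then 1 else -1 : ℂ) + (if (j : ℕ) < 2 then 1 else -1 : ℂ)) •
      momentumCl ε i j := by
  simp only [scalingField, momentumCl_eq, map_sub, Derivation.leibniz, derivation_C,
    mkDerivation_X, Sum.elim_inl, Sum.elim_inr, smul_eq_mul, smul_eq_C_mul, C_add]
  ring

/-- At the point x_0 = p_1 = 1 only P_01 contributes, and it has weight 2. -/
lemma scalingField_casimir_ne_zero {K : ℕ} (hq : 2 ≤ q) (hK : 2 ≤ K) :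
    scalingField (substMomenta ε (casimir ε K)) ≠ 0 := by
  intro h0
  have hi : (⟨0, by omega⟩ : Fin q) < ⟨1, by omega⟩ := by simp
  have h1 := eval_derivation_casimir ε scalingField rfl hi (K := K) hK
  rw [h0, map_zero, scalingField_momentumCl, smul_eval, eval_momentumCl] at h1
  norm_num [unitPoint, sign_ne_zero] at h1

lemma momentumCl_ne_zero {i j : Fin q} (h : i ≠ j) : momentumCl ε i j ≠ 0 := by
  intro h0
  have h1 := eval_momentumCl ε (unitPoint i j) i j
  rw [h0, map_zero] at h1
  simp [unitPoint, h, h.symm] at h1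
  exact sign_ne_zero _ h1.symm

end Existence

/-! ### An explicit momentum system from nested Casimirs -/

section StandardSystem

variable {q : ℕ} (ε : Fin q → ℤˣ)

/-- The Casimir elements of the first `q, q - 1, …, q - z + 1` oscillators. -/
def standardZ (z : ℕ) (a : Fin z) : MvPolynomial (Pair q) ℝ := casimir ε (q - a)

/-- The pair of one of the first two oscillators with one of the following `n` oscillators. -/
def standardPair {n : ℕ} (hn : n + 2 ≤ q) (b : Fin 2 × Fin n) : Pair q :=
  ⟨(⟨b.1, by omega⟩, ⟨b.2 + 2, by omega⟩), by
    have := b.1.isLt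
    simp only [Fin.mk_lt_mk]
    omega⟩

/-- The momenta `P_{0j}, P_{1j}` with `2 ≤ j < n + 2`. -/
def standardL {n : ℕ} (hn : n + 2 ≤ q) (b : Fin (2 * n)) : MvPolynomial (Pair q) ℝ :=
  X (standardPair hn (finProdFinEquiv.symm b))

lemma isLinearOrSquares_X {σ : Type} (a : σ) : IsLinearOrSquares (X a : MvPolynomial σ ℝ) :=
  Or.inl (isHomogeneous_X ℝ a)

/-- For each later oscillator j the derivatives in x_j and p_j involve only P_0j and P_1j. They form
a 2 by 2 linear system whose determinant is P_01 up to a sign, so its solution is zero where P_01 ≠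
0. -/
lemma eq_zero_of_relations {n : ℕ} (hn : n + 2 ≤ q) {y : Fin q ⊕ Fin q → ℂ}
    (hy : eval y (momentumCl ε ⟨0, by omega⟩ ⟨1, by omega⟩) ≠ 0) {c : Fin 2 × Fin n → ℂ}
    (hc : ∀ v, ∑ b, c b * eval y (pderiv v (momentumCl ε (standardPair hn b).1.1
      (standardPair hn b).1.2)) = 0) (b : Fin 2 × Fin n) : c b = 0 := by
  have hd : ∀ (t : Fin q → Fin q ⊕ Fin q), (t = Sum.inl ∨ t = Sum.inr) → ∀ j : Fin n,
      c (0, j) * eval y (pderiv (t ⟨j + 2, by omega⟩) (momentumCl ε ⟨0, by omega⟩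
        ⟨j + 2, by omega⟩)) + c (1, j) * eval y (pderiv (t ⟨j + 2, by omega⟩)
        (momentumCl ε ⟨1, by omega⟩ ⟨j + 2, by omega⟩)) = 0 := by
    intro t ht j
    have h1 := hc (t ⟨j + 2, by omega⟩)
    rw [Fintype.sum_prod_type, Fin.sum_univ_two] at h1
    have h2 : ∀ k : Fin 2, ∑ j' : Fin n, c (k, j') * eval y (pderiv (t ⟨j + 2, by omega⟩)
        (momentumCl ε (standardPair hn (k, j')).1.1 (standardPair hn (k, j')).1.2)) =
        c (k, j) * eval y (pderiv (t ⟨j + 2, by omega⟩)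
        (momentumCl ε (standardPair hn (k, j)).1.1 (standardPair hn (k, j)).1.2)) := by
      intro k
      refine Finset.sum_eq_single j (fun j' _ hj => ?_) (by simp)
      have hk := k.isLt
      have hj' : (j : ℕ) ≠ j' := fun h => hj (Fin.ext h.symm)
      have h3 : (j : ℕ) + 2 ≠ k := by omega
      rw [pderiv_momentumCl_of_ne, map_zero, mul_zero] <;> rcases ht with rfl | rfl <;>
        simp [standardPair, hj', h3]
    rw [h2, h2] at h1
    exact h1
  obtain ⟨k, j⟩ := b
  have h1 := hd Sum.inl (Or.inl rfl) j
  have h2 := hd Sum.inr (Or.inr rfl) j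
  have hj0 : (⟨j + 2, by omega⟩ : Fin q) ≠ ⟨0, by omega⟩ := by simp
  have hj1 : (⟨j + 2, by omega⟩ : Fin q) ≠ ⟨1, by omega⟩ := by simp
  set J : Fin q := ⟨j + 2, by omega⟩
  set i0 : Fin q := ⟨0, by omega⟩
  set i1 : Fin q := ⟨1, by omega⟩
  simp [momentumCl_eq, pderiv_X, hj0.symm, hj1.symm] at h1 h2
  rw [eval_momentumCl] at hy
  have h3 := sign_ne_zero (ε J)
  have h2' : c (0, j) * y (Sum.inl i0) + c (1, j) * y (Sum.inl i1) = 0 := by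
    refine (mul_eq_zero.mp ?_).resolve_left h3
    linear_combination h2
  have e0 : c (0, j) = 0 := by
    refine (mul_eq_zero.mp ?_).resolve_right hy
    linear_combination (((ε i1 : ℤ) : ℂ) * y (Sum.inr i1)) * h2' + y (Sum.inl i1) * h1
  have e1 : c (1, j) = 0 := by
    refine (mul_eq_zero.mp ?_).resolve_right hy
    linear_combination (-((ε i0 : ℤ) : ℂ) * y (Sum.inr i0)) * h2' - y (Sum.inl i0) * h1
  have hk : k = 0 ∨ k = 1 := by omega
  rcases hk with rfl | rfl
  exacts [e0, e1]

lemma functionallyIndependent_standard {z n : ℕ} (hz : 1 ≤ z) (hq : n + 1 + z = q)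
    (hn : n + 2 ≤ q) :
    FunctionallyIndependent (Sum.elim (fun a => substMomenta ε (standardZ ε z a))
      (fun b => substMomenta ε (standardL hn b))) := by
  have hlast : ∀ a : Fin z, q - a - 1 < q := fun a => by omega
  -- The open dense set is the complement of the zeros of D, whose factors are the pivots of the
  -- elimination below.
  set D : PhasePoly (Fin q) := momentumCl ε ⟨0, by omega⟩ ⟨1, by omega⟩ *
    scalingField (substMomenta ε (casimir ε (n + 2))) *
    ∏ a : Fin z, pderiv (Sum.inr ⟨q - a - 1, hlast a⟩) (substMomenta ε (standardZ ε z a)) with hD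
  have hD0 : D ≠ 0 := by
    refine mul_ne_zero (mul_ne_zero (momentumCl_ne_zero ε (by simp))
      (scalingField_casimir_ne_zero ε (by omega) (by omega))) (Finset.prod_ne_zero_iff.mpr
        fun a _ => pderiv_momentum_casimir_ne_zero ε ?_ ?_) <;> simp only <;> omega
  refine ⟨{y | eval (fun t => (y t : ℂ)) D ≠ 0}, isOpen_eval_ne_zero D, dense_eval_ne_zero hD0,
    fun y hy => ?_⟩
  rw [Set.mem_ofPred_eq, hD, map_mul, map_mul, map_prod, mul_ne_zero_iff, mul_ne_zero_iff,
    Finset.prod_ne_zero_iff] at hy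
  obtain ⟨⟨hy1, hy2⟩, hy3⟩ := hy
  rw [Fintype.linearIndependent_iff]
  intro c hc
  have hc' : ∀ v, _ = (0 : ℂ) := fun v => by
    have := congr_fun hc v
    simpa only [Finset.sum_apply, Pi.smul_apply, smul_eq_mul, Pi.zero_apply] using this
  -- Triangular elimination, largest Casimir first: the momentum of oscillator q - a - 1 occurs
  -- neither in the later Casimirs nor in L. The latter needs q - a - 1 ≥ n + 2, which excludes the
  -- last Casimir.
  have hZ : ∀ k : ℕ, ∀ a : Fin z, (a : ℕ) = k → k + 1 < z → c (Sum.inl a) = 0 := by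
    intro k
    induction k using Nat.strong_induction_on with
    | _ k ih =>
      intro a hak hkz
      have h1 := hc' (Sum.inr ⟨q - a - 1, hlast a⟩)
      rw [Fintype.sum_sum_type, Finset.sum_eq_single a, Finset.sum_eq_zero, add_zero] at h1
      · exact (mul_eq_zero.mp h1).resolve_right (hy3 a (Finset.mem_univ a))
      · intro b _
        rw [Sum.elim_inr, standardL, substMomenta_X]
        obtain ⟨p, j⟩ := finProdFinEquiv.symm b
        have hp := p.isLt
        have hj := j.isLt
        rw [pderiv_momentumCl_of_ne, map_zero, mul_zero]
        all_goals simp [standardPair]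
        all_goals omega
      · intro a' _ ha'
        have hne : (a' : ℕ) ≠ a := fun h => ha' (Fin.ext h)
        by_cases hlt : (a' : ℕ) < a
        · rw [ih a' (by omega) a' rfl (by omega), zero_mul]
        · rw [Sum.elim_inl, standardZ, pderiv_momentum_casimir_eq_zero, map_zero, mul_zero]
          simp only
          omega
      · simp
  -- The smallest Casimir may share all its oscillators with L. The scaling field separates it: P_0j
  -- and P_1j with j ≥ 2 have weight 1 - 1 = 0, while the scaling derivative of the Casimir is a
  -- factor of D.
  have hLast : c (Sum.inl ⟨z - 1, by omega⟩) = 0 := by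
    have h1 := sum_eval_mkDerivation hc' (Sum.elim
      (fun i : Fin q => (if (i : ℕ) < 2 then 1 else -1 : ℂ) • X (Sum.inl i))
      (fun i : Fin q => (if (i : ℕ) < 2 then 1 else -1 : ℂ) • X (Sum.inr i)))
    change ∑ a, c a * eval _ (scalingField _) = 0 at h1
    rw [Fintype.sum_sum_type, Finset.sum_eq_single ⟨z - 1, by omega⟩, Finset.sum_eq_zero,
      add_zero] at h1
    · refine (mul_eq_zero.mp h1).resolve_right ?_
      have h2 : q - (z - 1) = n + 2 := by omega
      simpa only [Sum.elim_inl, standardZ, h2] using hy2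
    · intro b _
      rw [Sum.elim_inr, standardL, substMomenta_X, scalingField_momentumCl]
      obtain ⟨p, j⟩ := finProdFinEquiv.symm b
      have hp : (p : ℕ) < 2 := p.isLt
      simp [standardPair, hp]
    · intro a _ ha
      have hne : (a : ℕ) ≠ z - 1 := fun h => ha (Fin.ext h)
      rw [hZ a a rfl (by omega), zero_mul]
    · simp
  have hZ' : ∀ a, c (Sum.inl a) = 0 := by
    intro a
    by_cases ha : (a : ℕ) + 1 < z
    · exact hZ a a rfl ha
    · have h1 : a = ⟨z - 1, by omega⟩ := Fin.ext (by simp only; omega)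
      rw [h1, hLast]
  have hL : ∀ b, c (Sum.inr b) = 0 := by
    intro b
    have h1 := eq_zero_of_relations ε hn hy1 (c := fun b => c (Sum.inr (finProdFinEquiv b)))
      (fun v => by
        have h2 := hc' v
        simp only [Fintype.sum_sum_type, Sum.elim_inl, Sum.elim_inr, hZ', zero_mul,
          Finset.sum_const_zero, zero_add, standardL, substMomenta_X] at h2
        rw [← finProdFinEquiv.sum_comp] at h2
        simpa only [Equiv.symm_apply_apply] using h2)
      (finProdFinEquiv.symm b)
    simpa only [Equiv.apply_symm_apply] using h1
  rintro (a | b)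
  exacts [hZ' a, hL b]

theorem exists_isMomentumSystem {z : ℕ} (hq : 1 ≤ q) (hz1 : q = 1 → z = 0)
    (hz : 1 < q → 1 ≤ z ∧ z ≤ q - 1) :
    ∃ (Z : Fin z → MvPolynomial (Pair q) ℝ) (L : Fin (2 * (q - z - 1)) → MvPolynomial (Pair q) ℝ),
      IsMomentumSystem ε Z L := by
  rcases hq.eq_or_lt with h1 | h1
  · obtain rfl : z = 0 := hz1 h1.symm
    have : IsEmpty (Fin (2 * (q - 0 - 1))) := by
      rw [← h1]
      exact Fin.isEmpty
    exact ⟨isEmptyElim, isEmptyElim, isEmptyElim, isEmptyElim,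
      ⟨Set.univ, isOpen_univ, dense_univ, fun _ _ => linearIndependent_empty_type⟩, isEmptyElim,
      isEmptyElim⟩
  · obtain ⟨hz2, hz3⟩ := hz h1
    -- With n = q - z - 1 the smallest Casimir has q - z + 1 = n + 2 oscillators. All pairs in L lie
    -- among them, so every Casimir commutes with every element of L; the inequality is z ≥ 1.
    have hn : (q - z - 1) + 2 ≤ q := by omega
    have hP := isBiderivation_poisson (ι := Fin q)
    refine ⟨standardZ ε z, standardL hn, fun a => isLinearOrSquares_casimir ε _,
      fun b => isLinearOrSquares_X _, functionallyIndependent_standard ε hz2 (by omega) hn,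
      fun a b => ?_, fun a b => ?_⟩
    · rcases le_total (a : ℕ) b with hab | hab
      · exact poisson_casimir_casimir ε (by omega)
      · rw [hP.skew, standardZ, standardZ, poisson_casimir_casimir ε (by omega), neg_zero]
    · rw [standardL, substMomenta_X]
      refine poisson_casimir_momentumCl ε _ ?_ ?_
      · simp only [standardPair]
        omega
      · simp only [standardPair]
        omega

end StandardSystem

end ResonantOscillators

end

theorem mainTheorem7
    (u : ℕ) (q : Fin u → ℕ) (hq : ∀ g, 1 ≤ q g)
    (ε : ResonantOscillators.Osc q → ℤˣ)
    (s : Fin u → ℕ) (hs : ∀ g, 0 < s g)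
    (z : Fin u → ℕ) (hz1 : ∀ g, q g = 1 → z g = 0)
    (hz : ∀ g, 1 < q g → 1 ≤ z g ∧ z g ≤ q g - 1)
    (k' h : ℕ) (hk' : 1 ≤ k') (hk'u : 2 * k' ≤ u) (hk'h : k' ≤ h)
    (m : Fin h → Fin u → ℤ) (hm : LinearIndependent ℤ m)
    (hms : ∀ i, ∑ g, m i g * (s g : ℤ) = 0)
    (hmm : ∀ i j : Fin h, (j : ℕ) < k' → i ≠ j → ∀ g, m i g * m j g = 0)
    (r : Fin (u - k') → Fin u → ℤ) (hr : LinearIndependent ℤ r)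
    (hr1 : ∀ i : Fin (u - k'), (i : ℕ) = 0 → ∀ g, r i g = (s g : ℤ))
    (hrm1 : ∀ (i : Fin (u - k')) (j : Fin h), (j : ℕ) < k' → ∑ g, r i g * m j g = 0)
    (hrm2 : ∀ (i : Fin (u - k')) (j : Fin h), (i : ℕ) < u - h → k' ≤ (j : ℕ) →
      ∑ g, r i g * m j g = 0) :
    (∃ (Z : (g : Fin u) → Fin (z g) → MvPolynomial (ResonantOscillators.Pair (q g)) ℝ)
        (L : (g : Fin u) → Fin (2 * (q g - z g - 1)) →
          MvPolynomial (ResonantOscillators.Pair (q g)) ℝ),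
        ∀ g, ResonantOscillators.IsMomentumSystem (fun i => ε ⟨g, i⟩) (Z g) (L g)) ∧
    ∀ (Z : (g : Fin u) → Fin (z g) → MvPolynomial (ResonantOscillators.Pair (q g)) ℝ)
      (L : (g : Fin u) → Fin (2 * (q g - z g - 1)) →
        MvPolynomial (ResonantOscillators.Pair (q g)) ℝ),
      (∀ g, ResonantOscillators.IsMomentumSystem (fun i => ε ⟨g, i⟩) (Z g) (L g)) →
      ResonantOscillators.IsQuasiIntegrable (u - h + k' + ∑ g, z g)
        (ResonantOscillators.centralSet ε m r Z)
        (ResonantOscillators.otherSet ε m r L) := by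
  refine ⟨?_, fun Z L hZL => ?_⟩
  · choose Z L hZL using fun g =>
      ResonantOscillators.exists_isMomentumSystem (fun i => ε ⟨g, i⟩) (hq g) (hz1 g) (hz g)
    exact ⟨Z, L, hZL⟩
  · refine ResonantOscillators.isQuasiIntegrable_operators ε hq (fun g => ?_) hk'h hm hmm hr hrm1
      hrm2 hZL
    have h1 := hq g
    have h2 := hz1 g
    have h3 := hz g
    omega
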